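/- Let $n \ge 2$, $[n]=\{1,\dots,n\}$, $N=n^2$, and let $W$ be the group of signed permutations of $\{\pm 1,\dots,\pm n\}$ (permutations $\sigma$ with $\sigma(-i)=-\sigma(i)$), generated by $s_1=(1\ \ {-1})$ and $s_k=(k-1\ \ k)(-(k-1)\ \ {-k})$ for $2\le k\le n$. Let $\ell$ be the length function, $w_0=(1\ \ {-1})\cdots(n\ \ {-n})$ (so $\ell(w_0)=N$), and let $R(w)$ be the set of reduced words $(j_1,\dots,j_\ell)$ of $w=s_{j_1}\cdots s_{j_\ell}$. **Skew pipe dreams.** Let $SY_n=\{(i,j)\in\mathbb Z^2 : 1\le i\le n,\ i\le j\le 2n-i\}$; a skew pipe dream is a subset $D\subseteq SY_n$. Write $(i_1,\dots,i_N)=(1,\,2,1,2,\,3,2,1,2,3,\dots,\,n,n-1,\dots,1,\dots,n-1,n)$, and list the boxes of $SY_n$ as $(p_1,q_1),\dots,(p_N,q_N)=(n,n),(n-1,n+1),(n-1,n),(n-1,n-1),\dots,(1,2),(1,1)$, that is, rows from $n$ to $1$, each row from right to left. For $w\in W$ let $(k_1<\dots<k_\ell)$ be the lexicographically smallest sequence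 of positions with $(i_{k_1},\dots,i_{k_\ell})\in R(w)$, and put $D(w)=SY_n\setminus\{(p_{k_1},q_{k_1}),\dots,(p_{k_\ell},q_{k_\ell})\}$. **Ladder moves.** Let $(i,j)=(p_k,q_k)\in D$ with $(i,j+1)\notin D$, and suppose there is $k<l\le N$ with $q_l\in\{j,2n-j\}$ such that $(p_l,q_l),(p_l,q_l+1)\in SY_n\setminus D$ and $(p_r,q_r),(p_r,q_r+1)\in D$ for all $k<r<l$ with $q_r\in\{j,2n-j\}$. Then the ladder move of $D$ at $(i,j)$ is defined, and $L_{i,j}(D)=(D\cup\{(p_l,q_l+1)\})\setminus\{(i,j)\}$. Let $\mathscr L(D)$ be the set of skew pipe dreams obtained from $D$ by (possibly empty) sequences of ladder moves. **Mitosis.** For $i\in[n]$ put $C_i=\{n-i+1,\,n+i-1\}$, and for a skew pipe dream $D$ let $r_0$ be the largest $r$ with $q_r\in C_i$ and $(p_r,q_r+1)\notin D$. If $(p_r,q_r)\in D$ for all $r\ge r_0$ with $q_r\in C_i$, let $M_i(D)$ be the set of skew pipe dreams obtained from $D\setminus\{(p_{r_0},q_{r_0})\}$ by sequences of ladder moves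 $L_{p,q}$ with $q\in C_i$, and let $\mathrm{mitosis}_i^\top(D)$ be the set of those obtained by using only such $L_{p,q}$ with, in addition, $p<\min(\{a : (a,n-i+1)\in SY_n\setminus D\}\cup\{a+1 : (a,n+i-1)\in SY_n\setminus D\}\cup\{n-i+2\})$. Otherwise both sets are empty. Extend $M_i$ and $\mathrm{mitosis}_i^\top$ to sets of skew pipe dreams by taking unions. Put $\mathscr M(w)=M_{i_{k_\ell}}\cdots M_{i_{k_1}}(\{SY_n\})$, where $k_1<\dots<k_\ell$ are the $k$ with $(p_k,q_k)\notin D(w)$. **Reduced skew pipe dreams.** Let $\Omega(D)$ be the set of those boxes $(i,c)$ with $1\le c\le n$, $1\le i\le 2c-1$ such that $((i+1)/2,c)\in D$ if $i$ is odd, and $(i/2,2n+1-c)\in D$ if $i$ is even. In the diagram consisting of all boxes $(i,c)$ with $1\le c\le n$, $1\le i\le 2c$ and the boxes $(i,n+1)$ with $1\le i\le 2n$ (rows numbered downwards, columns to the right), fill each box of $\Omega(D)$ with a crossing; fill each other box $(i,c)$ with an elbow (joining left–top and bottom–right) if $c\le n$ and $i$ is odd, or $c=n+1$ and $i$ is even,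 and with a reversed elbow (joining left–bottom and top–right) otherwise. The pipe $\ell_k$ starting at the left end of row $2(n+1-k)-1$ ends at the top of some column $n+1-v_D(k)$, and $v_D$ is a permutation of $[n]$. Define $w_D\in W$ by $w_D(j)=(-1)^{\sigma_j+1}v_D^{-1}(j)$ for $j\in[n]$, where $\sigma_j$ is the number of self-crossings of the pipe ending at the top of column $n+1-j$. The skew pipe dream $D$ is called reduced if $|D|=\ell(w_0)-\ell(w_D)$. **Theorem.** 1. For all $w\in W$ and $j\in[n]$ with $\ell(w)<\ell(ws_j)$, $$\mathscr L(D(ws_j))=M_j(\mathscr L(D(w)))=\mathrm{mitosis}_j^\top(\mathscr L(D(w))).$$ 2. For all $w\in W$ and $(j_1,\dots,j_\ell)\in R(w)$, $$\mathscr L(D(w))=\mathscr M(w)=M_{j_\ell}\cdots M_{j_1}(\{SY_n\})=\mathrm{mitosis}_{j_\ell}^\top\cdots\mathrm{mitosis}_{j_1}^\top(\{SY_n\}).$$ 3. For all $w\in W$, the set $\mathscr M(w)$ is stable under ladder moves, and it equals the set of reduced skew pipe dreams $D$ with $w_D=w$. -/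

import Mathlib

namespace SkewPipeDream

/-! ### The Weyl group of type `C_n` -/

/-- The group of signed permutations of `{±1, …, ±n}`. A signed permutation is extended by the
identity to the other integers, so that it is an odd permutation of `ℤ` fixing every `z` with
`|z| > n` (and fixing `0`, by oddness). -/
def W (n : ℕ) : Subgroup (Equiv.Perm ℤ) where
  carrier := {σ | (∀ z, σ (-z) = -σ z) ∧ ∀ z : ℤ, (n : ℤ) < |z| → σ z = z}
  mul_mem' := by
    rintro a b ⟨ha, ha'⟩ ⟨hb, hb'⟩
    refine ⟨fun z => ?_, fun z hz => ?_⟩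
    · simp only [Equiv.Perm.mul_apply, hb, ha]
    · simp only [Equiv.Perm.mul_apply, hb' z hz, ha' z hz]
  one_mem' := by simp
  inv_mem' := by
    rintro a ⟨ha, ha'⟩
    refine ⟨fun z => ?_, fun z hz => ?_⟩
    · rw [Equiv.Perm.inv_eq_iff_eq, ha]; simp
    · rw [Equiv.Perm.inv_eq_iff_eq, ha' z hz]

/-- The simple reflections `s_1 = (1 -1)` and `s_k = (k-1 k)(-(k-1) -k)` for `k ≥ 2`. -/
def s (k : ℕ) : Equiv.Perm ℤ :=
  if k = 1 then Equiv.swap 1 (-1)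
  else Equiv.swap ((k : ℤ) - 1) (k : ℤ) * Equiv.swap (-((k : ℤ) - 1)) (-(k : ℤ))

/-- `l` is a word in the alphabet `[n] = {1, …, n}` with `w = s_{l_1} s_{l_2} ⋯`. -/
def IsWord (n : ℕ) (w : Equiv.Perm ℤ) (l : List ℕ) : Prop :=
  (∀ i ∈ l, 1 ≤ i ∧ i ≤ n) ∧ (l.map s).prod = w

/-- `l` is a reduced word for `w`, i.e. `l ∈ R(w)`. -/
def IsReducedWord (n : ℕ) (w : Equiv.Perm ℤ) (l : List ℕ) : Prop :=
  IsWord n w l ∧ ∀ l', IsWord n w l' → l.length ≤ l'.length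

/-- The length `ℓ(w)`. -/
noncomputable def len (n : ℕ) (w : Equiv.Perm ℤ) : ℕ :=
  sInf {r | ∃ l, IsWord n w l ∧ l.length = r}

/-- The longest element `w_0 = (1 -1)(2 -2)⋯(n -n)`. -/
def w₀ (n : ℕ) : Equiv.Perm ℤ :=
  ((List.range n).map fun i : ℕ => Equiv.swap ((i : ℤ) + 1) (-((i : ℤ) + 1))).prod

/-! ### Skew pipe dreams and the enumeration of the boxes

Positions are numbered `1, …, n²`. They are divided into blocks `b = 0, …, n-1`, where block `b`
consists of the `2b+1` positions `b² + t + 1` with `0 ≤ t ≤ 2b`; it corresponds to the letters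
`b+1, b, …, 1, …, b, b+1` of the word `i_C` and to the boxes
`(n-b, n+b), (n-b, n+b-1), …, (n-b, n-b)`, i.e. row `n-b` read from right to left. -/

/-- The block of the position `k`. -/
def blockOf (k : ℕ) : ℕ := Nat.sqrt (k - 1)

/-- The offset of the position `k` in its block. -/
def offsetOf (k : ℕ) : ℕ := k - 1 - blockOf k ^ 2

/-- The `k`-th letter of `i_C = (1, 2,1,2, 3,2,1,2,3, …, n,n-1,…,1,…,n-1,n)`. -/
def iC (k : ℕ) : ℕ := ((blockOf k : ℤ) - (offsetOf k : ℤ)).natAbs + 1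

/-- The row `p_k` of the `k`-th box in `(n,n), (n-1,n+1), (n-1,n), …, (1,2), (1,1)`. -/
def p (n k : ℕ) : ℕ := n - blockOf k

/-- The column `q_k` of the `k`-th box in `(n,n), (n-1,n+1), (n-1,n), …, (1,2), (1,1)`. -/
def q (n k : ℕ) : ℕ := n + blockOf k - offsetOf k

/-- The shifted Young diagram `SY_n`. The skew pipe dreams are its subsets. -/
def SY (n : ℕ) : Finset (ℕ × ℕ) :=
  (Finset.Icc 1 n ×ˢ Finset.Icc 1 (2 * n)).filter fun b => b.1 ≤ b.2 ∧ b.2 ≤ 2 * n - b.1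

/-! ### The skew pipe dream `D(w)` -/

/-- `R(i_C, w)`: the strictly increasing sequences of positions that give reduced words of `w`. -/
def reducedSubwords (n : ℕ) (w : Equiv.Perm ℤ) : Set (List ℕ) :=
  {k | k.Pairwise (· < ·) ∧ (∀ r ∈ k, 1 ≤ r ∧ r ≤ n ^ 2) ∧ IsReducedWord n w (k.map iC)}

/-- `k_w`: the lexicographically smallest element of `R(i_C, w)`. -/
noncomputable def minSubword (n : ℕ) (w : Equiv.Perm ℤ) : List ℕ :=
  Classical.epsilon fun k => k ∈ reducedSubwords n w ∧
    ∀ k' ∈ reducedSubwords n w, k' = k ∨ List.Lex (· < ·) k k'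

/-- `D(w)`: the complement in `SY_n` of the boxes at the positions in `k_w`. -/
noncomputable def Dmin (n : ℕ) (w : Equiv.Perm ℤ) : Finset (ℕ × ℕ) :=
  SY n \ ((minSubword n w).map fun k => (p n k, q n k)).toFinset

/-- `k'_D`: the positions of the boxes of `SY_n \ D`, in ascending order. -/
def complPositions (n : ℕ) (D : Finset (ℕ × ℕ)) : List ℕ :=
  (List.range' 1 (n ^ 2)).filter fun k => (p n k, q n k) ∉ D

/-! ### Ladder moves -/

/-- The ladder move `L_{i,j}` is defined at `D`, and `L_{i,j}(D) = D'`. -/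
def LadderMove (n i j : ℕ) (D D' : Finset (ℕ × ℕ)) : Prop :=
  (i, j) ∈ D ∧ (i, j + 1) ∉ D ∧
  ∃ k l : ℕ, 1 ≤ k ∧ (p n k, q n k) = (i, j) ∧ k + 1 ≤ l ∧ l ≤ n ^ 2 ∧
    (q n l = j ∨ q n l = 2 * n - j) ∧
    (p n l, q n l) ∈ SY n \ D ∧ (p n l, q n l + 1) ∈ SY n \ D ∧
    (∀ r, k + 1 ≤ r → r ≤ l - 1 → (q n r = j ∨ q n r = 2 * n - j) →
      (p n r, q n r) ∈ D ∧ (p n r, q n r + 1) ∈ D) ∧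
    D' = (D ∪ {(p n l, q n l + 1)}) \ {(i, j)}

/-- The set of skew pipe dreams obtained from `D` by sequences of ladder moves `L_{i,j}` at boxes
`(i, j)` satisfying the condition `C`. -/
def ladderOrbit (n : ℕ) (C : ℕ → ℕ → Prop) (D : Finset (ℕ × ℕ)) : Set (Finset (ℕ × ℕ)) :=
  {D' | Relation.ReflTransGen (fun A B => ∃ i j, C i j ∧ LadderMove n i j A B) D D'}

/-- `𝓛(D)`: the set of skew pipe dreams obtained from `D` by sequences of ladder moves. -/
def LL (n : ℕ) (D : Finset (ℕ × ℕ)) : Set (Finset (ℕ × ℕ)) :=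
  ladderOrbit n (fun _ _ => True) D

/-! ### Mitosis operators -/

/-- The condition `q ∈ {n-i+1, n+i-1}` on a column `q`. -/
def InCols (n i c : ℕ) : Prop := c = n + 1 - i ∨ c = n + i - 1

/-- `r` is the number `r_0`, and the condition `(†)` for `D` and `i` holds. -/
def MitosisAt (n i : ℕ) (D : Finset (ℕ × ℕ)) (r : ℕ) : Prop :=
  IsGreatest {r | 1 ≤ r ∧ r ≤ n ^ 2 ∧ InCols n i (q n r) ∧ (p n r, q n r + 1) ∉ D} r ∧
  ∀ r', r ≤ r' → r' ≤ n ^ 2 → InCols n i (q n r') → (p n r', q n r') ∈ D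

/-- The set `M_i(D)`; it is empty if `(†)` is not satisfied. -/
def M₁ (n i : ℕ) (D : Finset (ℕ × ℕ)) : Set (Finset (ℕ × ℕ)) :=
  {D' | ∃ r, MitosisAt n i D r ∧
    D' ∈ ladderOrbit n (fun _ c => InCols n i c) (D \ {(p n r, q n r)})}

/-- The number `start_i^⊤(D)`, the minimum of a nonempty set. -/
noncomputable def start (n i : ℕ) (D : Finset (ℕ × ℕ)) : ℕ :=
  sInf ({a | (a, n + 1 - i) ∈ SY n \ D} ∪ {b | ∃ a, b = a + 1 ∧ (a, n + i - 1) ∈ SY n \ D} ∪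
    {n + 2 - i})

/-- The set `mitosis_i^⊤(D)`; it is empty if `(†)` is not satisfied. -/
def mitosis₁ (n i : ℕ) (D : Finset (ℕ × ℕ)) : Set (Finset (ℕ × ℕ)) :=
  {D' | ∃ r, MitosisAt n i D r ∧
    D' ∈ ladderOrbit n (fun a c => InCols n i c ∧ a < start n i D) (D \ {(p n r, q n r)})}

/-- The operator `M_i` on sets of skew pipe dreams. -/
def M (n i : ℕ) (A : Set (Finset (ℕ × ℕ))) : Set (Finset (ℕ × ℕ)) := ⋃ D ∈ A, M₁ n i D

/-- The operator `mitosis_i^⊤` on sets of skew pipe dreams. -/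
def mitosis (n i : ℕ) (A : Set (Finset (ℕ × ℕ))) : Set (Finset (ℕ × ℕ)) := ⋃ D ∈ A, mitosis₁ n i D

/-- `M_{j_ℓ} ⋯ M_{j_1}(SY_n)` for the word `(j_1, …, j_ℓ)`. -/
def MWord (n : ℕ) (l : List ℕ) : Set (Finset (ℕ × ℕ)) := l.foldl (fun A j => M n j A) {SY n}

/-- `mitosis_{j_ℓ}^⊤ ⋯ mitosis_{j_1}^⊤(SY_n)` for the word `(j_1, …, j_ℓ)`. -/
def mitosisWord (n : ℕ) (l : List ℕ) : Set (Finset (ℕ × ℕ)) :=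
  l.foldl (fun A j => mitosis n j A) {SY n}

/-- The set `𝓜(w) = M_{i_{k_ℓ}} ⋯ M_{i_{k_1}}(SY_n)` with `(k_1, …, k_ℓ) = k'_{D(w)}`. -/
noncomputable def MM (n : ℕ) (w : Equiv.Perm ℤ) : Set (Finset (ℕ × ℕ)) :=
  MWord n ((complPositions n (Dmin n w)).map iC)

/-! ### The path model -/

/-- The boxes of the Gelfand–Tsetlin type diagram. -/
def IsGTBox (n : ℕ) (b : ℕ × ℕ) : Prop :=
  1 ≤ b.2 ∧ b.2 ≤ n ∧ 1 ≤ b.1 ∧ b.1 ≤ 2 * b.2 - 1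

/-- The boxes of the extended diagram: in addition the boxes `(2k, k)` for `1 ≤ k ≤ n` and
`(k, n+1)` for `1 ≤ k ≤ 2n`. -/
def IsExBox (n : ℕ) (b : ℕ × ℕ) : Prop :=
  IsGTBox n b ∨ (1 ≤ b.2 ∧ b.2 ≤ n ∧ b.1 = 2 * b.2) ∨ (1 ≤ b.1 ∧ b.1 ≤ 2 * n ∧ b.2 = n + 1)

/-- The rearrangement `Ω(D)`: row `2k-1` consists of the first `n-k+1` boxes of row `k` of `D`
(in columns `k, …, n`), and row `2k` of the last `n-k` boxes of row `k` of `D` in reversed order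
(in columns `k+1, …, n`). -/
def Ω (n : ℕ) (D : Finset (ℕ × ℕ)) : Set (ℕ × ℕ) :=
  {b | IsGTBox n b ∧
    ((Odd b.1 ∧ ((b.1 + 1) / 2, b.2) ∈ D) ∨ (Even b.1 ∧ (b.1 / 2, 2 * n + 1 - b.2) ∈ D))}

/-- The sides of a box. -/
inductive Side where
  | left | right | top | bottom

/-- The opposite side; a crossing joins opposite sides. -/
def Side.opp : Side → Side
  | .left => .right
  | .right => .left
  | .top => .bottom
  | .bottom => .top

/-- An elbow joint joins left with top, and bottom with right. -/
def Side.elbow : Side → Side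
  | .left => .top
  | .top => .left
  | .bottom => .right
  | .right => .bottom

/-- A reversed elbow joint joins left with bottom, and top with right. -/
def Side.revElbow : Side → Side
  | .left => .bottom
  | .bottom => .left
  | .top => .right
  | .right => .top

/-- The box adjacent to a given one along a given side; rows are numbered from top to bottom and
columns from left to right. -/
def neighbour (b : ℕ × ℕ) : Side → ℕ × ℕ
  | .left => (b.1, b.2 - 1)
  | .right => (b.1, b.2 + 1)
  | .top => (b.1 - 1, b.2)
  | .bottom => (b.1 + 1, b.2)

open Classical in
/-- The side through which a pipe that enters the box `b` of the diagram `𝓖(D)` through the side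
`a` leaves it. -/
noncomputable def exitSide (n : ℕ) (D : Finset (ℕ × ℕ)) (b : ℕ × ℕ) (a : Side) : Side :=
  if b ∈ Ω n D then a.opp
  else if (b.2 ≤ n ∧ Odd b.1) ∨ (b.2 = n + 1 ∧ Even b.1) then a.elbow
  else a.revElbow

/-- One step along a pipe of `𝓖(D)`. A state `(b, a)` means that the pipe enters the box `b`
through the side `a`. -/
def PipeStep (n : ℕ) (D : Finset (ℕ × ℕ)) (x y : (ℕ × ℕ) × Side) : Prop :=
  IsExBox n y.1 ∧ y.1 = neighbour x.1 (exitSide n D x.1 x.2) ∧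
    y.2 = (exitSide n D x.1 x.2).opp

/-- The pipe `ℓ_k`, followed from its left end, enters the box `x.1` through the side `x.2`.
The left ends of the odd rows are numbered from bottom to top: `ℓ_k` starts at the left side of
the leftmost box `(2m-1, m)` of row `2m-1`, where `m = n+1-k`. -/
def PipeVisits (n : ℕ) (D : Finset (ℕ × ℕ)) (k : ℕ) (x : (ℕ × ℕ) × Side) : Prop :=
  Relation.ReflTransGen (PipeStep n D) ((2 * (n + 1 - k) - 1, n + 1 - k), Side.left) x

/-- `ℓ_k = L_j`, i.e. `v_D(k) = j`: the pipe `ℓ_k` ends at the top of column `n+1-j`. -/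
def PipeEnds (n : ℕ) (D : Finset (ℕ × ℕ)) (k j : ℕ) : Prop :=
  ∃ a, PipeVisits n D k ((1, n + 1 - j), a) ∧ exitSide n D (1, n + 1 - j) a = Side.top

/-- The number of self-crossings of `ℓ_k`: the number of crossings through which this pipe runs
both horizontally and vertically. -/
noncomputable def selfCrossings (n : ℕ) (D : Finset (ℕ × ℕ)) (k : ℕ) : ℕ :=
  Set.ncard {b | b ∈ Ω n D ∧
    (PipeVisits n D k (b, Side.left) ∨ PipeVisits n D k (b, Side.right)) ∧
    (PipeVisits n D k (b, Side.top) ∨ PipeVisits n D k (b, Side.bottom))}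

/-- `w_D = w`: for all `j ∈ [n]`, one has `w(j) = (-1)^{sign(L_j)+1} v_D⁻¹(j)`, where `sign(L_j)`
is the number of self-crossings of the pipe `L_j = ℓ_k` with `k = v_D⁻¹(j)`. -/
def IsPermOf (n : ℕ) (D : Finset (ℕ × ℕ)) (w : Equiv.Perm ℤ) : Prop :=
  w ∈ W n ∧ ∀ j, 1 ≤ j → j ≤ n → ∃ k, 1 ≤ k ∧ k ≤ n ∧ PipeEnds n D k j ∧
    w (j : ℤ) = (-1) ^ (selfCrossings n D k + 1) * (k : ℤ)

/-- The set of reduced skew pipe dreams for `w`: those `D` with `w_D = w` and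
`|D| = ℓ(w_0) - ℓ(w_D)`. -/
def RSP (n : ℕ) (w : Equiv.Perm ℤ) : Set (Finset (ℕ × ℕ)) :=
  {D | D ⊆ SY n ∧ IsPermOf n D w ∧ D.card + len n w = len n (w₀ n)}

end SkewPipeDream

open SkewPipeDream

namespace SkewPipeDream

/-! ### Coordinates of boxes and positions -/

/-! The edges of the pipe diagram carry integer labels: the pipe `ℓ_k` has the label `±k`, a turn in
column `n + 1` reverses the sign, and closed loops have the label `0`. The labels at the top form a
signed permutation (`Lab n D w`), and this is `w_D`. Indeed, the upward sweep over a pair of rows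
exchanges two neighbouring labels at each crossing, so comparing the order of `L` and `-L` before
and after shows that the pair contains an odd number of self-crossings of a pipe exactly when the
pipe uses the turn of that pair (`levelWord_spec`).

Ladder moves, deletions of double crossings and the removal of a box in mitosis are all toggles in
the strip of one letter `i`. A toggle at the left box of a row exchanges the labels of two columns
(or negates those of one column if `i = 1`). The change travels upwards through full rows, and
either it is absorbed by a second toggle (`Lab.toggle`), so that `w` is kept, or it reaches the top
and replaces `w` by `w * s i` (`Lab.toggle_top`).

Splitting off the cosets of `W b` in `W (b + 1)` block by block gives a unique normal form `nf t n`
for each `w`, whose word uses the first `t b` positions of every block `b`; `PF n t` is the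
corresponding skew pipe dream. Inverse ladder moves and deletions of double crossings bring any `D`
into such a form (`exists_PF_of_subset`), and the invariant `w` determines which one. Hence `PF n t`
has the least cardinality among all `D` with its `w`, namely `n ^ 2 - len n w`, and the reduced `D`
are those that are reached from it by ladder moves alone (`LL_PF`). The prefix word is also the
lexicographically smallest reduced subword (`minSubword_nf`), so `LL n (Dmin n w) = RSP n w`.

For an ascent `w < w * s j` there remains the sandwich `M (RSP w) ⊆ RSP (w * s j) ⊆ mitosis (RSP w)
⊆ M (RSP w)`. The first inclusion is a toggle at the top of the strip; the second one undoes mitosis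
by inverse ladder moves in the strip (`exists_row_empty`). Induction along a reduced word, starting
from `RSP n 1 = {SY n}`, gives the rest. -/

theorem mem_SY {n a c : ℕ} : (a, c) ∈ SY n ↔ 1 ≤ a ∧ a ≤ c ∧ a + c ≤ 2 * n := by
  simp only [SY, Finset.mem_filter, Finset.mem_product, Finset.mem_Icc]
  omega

theorem blockOf_eq {b m : ℕ} (hm : m ≤ 2 * b) : blockOf (b ^ 2 + m + 1) = b := by
  rw [blockOf, Nat.add_sub_cancel, Nat.sqrt_add_eq' _ (by omega)]

theorem offsetOf_eq {b m : ℕ} (hm : m ≤ 2 * b) : offsetOf (b ^ 2 + m + 1) = m := by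
  rw [offsetOf, blockOf_eq hm]; omega

theorem iC_eq {b m : ℕ} (hm : m ≤ 2 * b) :
    iC (b ^ 2 + m + 1) = ((b : ℤ) - (m : ℤ)).natAbs + 1 := by
  rw [iC, blockOf_eq hm, offsetOf_eq hm]

theorem exists_block {n r : ℕ} (h1 : 1 ≤ r) (hr : r ≤ n ^ 2) :
    ∃ b m, b < n ∧ m ≤ 2 * b ∧ r = b ^ 2 + m + 1 := by
  refine ⟨Nat.sqrt (r - 1), r - 1 - Nat.sqrt (r - 1) ^ 2, ?_, ?_, ?_⟩
  · rw [Nat.sqrt_lt']; omega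
  · have := Nat.sqrt_le_add (r - 1)
    rw [pow_two]; omega
  · have := Nat.sqrt_le' (r - 1)
    omega

/-- The position of the box `(a, c)`. -/
def pos (n a c : ℕ) : ℕ := (n - a) ^ 2 + (2 * n - a - c) + 1

theorem p_pos {n a c : ℕ} (h : (a, c) ∈ SY n) : p n (pos n a c) = a := by
  rw [mem_SY] at h
  rw [p, pos, blockOf_eq (by omega)]; omega

theorem q_pos {n a c : ℕ} (h : (a, c) ∈ SY n) : q n (pos n a c) = c := by
  rw [mem_SY] at h
  rw [q, pos, blockOf_eq (by omega), offsetOf_eq (by omega)]; omega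

theorem pos_le {n a c : ℕ} (h : (a, c) ∈ SY n) : pos n a c ≤ n ^ 2 := by
  rw [mem_SY] at h
  obtain ⟨b, hb⟩ : ∃ b, b = n - a := ⟨_, rfl⟩
  have h2 : (b + 1) ^ 2 ≤ n ^ 2 := Nat.pow_le_pow_left (by omega) 2
  have h3 : (b + 1) ^ 2 = b ^ 2 + 2 * b + 1 := by ring
  rw [pos, ← hb]; omega

theorem one_le_pos {n a c : ℕ} : 1 ≤ pos n a c := by rw [pos]; omega

theorem pos_spec {n r : ℕ} (h1 : 1 ≤ r) (hr : r ≤ n ^ 2) :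
    (p n r, q n r) ∈ SY n ∧ pos n (p n r) (q n r) = r := by
  obtain ⟨b, m, hb, hm, rfl⟩ := exists_block h1 hr
  rw [mem_SY, p, q, pos, blockOf_eq hm, offsetOf_eq hm]
  refine ⟨by omega, ?_⟩
  have h1 : n - (n - b) = b := by omega
  rw [h1]; omega

theorem iC_pos {n a c : ℕ} (h : (a, c) ∈ SY n) : iC (pos n a c) = ((n : ℤ) - c).natAbs + 1 := by
  rw [mem_SY] at h
  rw [pos, iC_eq (by omega)]; omega

theorem pos_lt_pos {n a c a' c' : ℕ} (h : (a, c) ∈ SY n) (h' : (a', c') ∈ SY n) :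
    pos n a c < pos n a' c' ↔ a' < a ∨ (a' = a ∧ c' < c) := by
  have key : ∀ {a c a' c' : ℕ}, (a, c) ∈ SY n → (a', c') ∈ SY n → a' < a →
      pos n a c < pos n a' c' := by
    intro a c a' c' h h' hlt
    rw [mem_SY] at h h'
    obtain ⟨b, hb⟩ : ∃ b, b = n - a := ⟨_, rfl⟩
    obtain ⟨b', hb'⟩ : ∃ b, b = n - a' := ⟨_, rfl⟩
    have h2 : (b + 1) ^ 2 ≤ b' ^ 2 := Nat.pow_le_pow_left (by omega) 2
    have h3 : (b + 1) ^ 2 = b ^ 2 + 2 * b + 1 := by ring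
    rw [pos, pos, ← hb, ← hb']; omega
  rcases lt_trichotomy a' a with hlt | rfl | hlt
  · simp [key h h' hlt, hlt]
  · rw [mem_SY] at h h'
    rw [pos, pos]; omega
  · have := key h' h hlt
    omega

theorem card_SY (n : ℕ) : (SY n).card = n ^ 2 := by
  have h : (Finset.Icc 1 (n ^ 2)).card = (SY n).card := by
    refine Finset.card_bij (fun r _ => (p n r, q n r)) ?_ ?_ ?_
    · intro r hr
      rw [Finset.mem_Icc] at hr
      exact (pos_spec hr.1 hr.2).1
    · intro r hr r' hr' h
      rw [Finset.mem_Icc] at hr hr'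
      rw [Prod.mk.injEq] at h
      rw [← (pos_spec hr.1 hr.2).2, ← (pos_spec hr'.1 hr'.2).2, h.1, h.2]
    · rintro ⟨a, c⟩ h
      exact ⟨pos n a c, Finset.mem_Icc.2 ⟨one_le_pos, pos_le h⟩, by rw [p_pos h, q_pos h]⟩
  rw [← h]; simp

/-! ### Strips

The strip of the letter `i` consists of the boxes `xb n i ρ` in the columns of `C_i`, numbered from
the last position to the first one, together with their right neighbours `yb n i ρ`. -/

/-- The number of rows of the strip of the letter `i`. -/
def slen (n i : ℕ) : ℕ := if i = 1 then n else 2 * (n + 1 - i)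

/-- The box in row `ρ` of the strip of the letter `i`. -/
def xb (n i ρ : ℕ) : ℕ × ℕ :=
  if i = 1 then (ρ, n) else if ρ % 2 = 1 then ((ρ + 1) / 2, n + 1 - i) else (ρ / 2, n + i - 1)

/-- The right neighbour of the box in row `ρ` of the strip of the letter `i`. -/
def yb (n i ρ : ℕ) : ℕ × ℕ := ((xb n i ρ).1, (xb n i ρ).2 + 1)

/-- The position of the box in row `ρ` of the strip of the letter `i`. -/
def pr (n i ρ : ℕ) : ℕ := pos n (xb n i ρ).1 (xb n i ρ).2

section Strip

variable {n i ρ σ : ℕ}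

theorem xb_mem (hi : 1 ≤ i) (h1 : 1 ≤ ρ) (h2 : ρ ≤ slen n i) : xb n i ρ ∈ SY n := by
  unfold slen at h2
  unfold xb
  split_ifs at * <;> rw [mem_SY] <;> omega

theorem yb_mem (hi : 1 ≤ i) (h1 : 1 ≤ ρ) (h2 : ρ < slen n i) : yb n i ρ ∈ SY n := by
  unfold slen at h2
  unfold yb xb
  split_ifs at * <;> rw [mem_SY] <;> simp only <;> omega

theorem yb_notMem (hn : i ≤ n) : yb n i (slen n i) ∉ SY n := by
  unfold slen yb xb
  split_ifs at * <;> rw [mem_SY] <;> simp only <;> omega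

theorem xb_inj (h : xb n i ρ = xb n i σ) : ρ = σ := by
  unfold xb at h
  split_ifs at h <;> rw [Prod.mk.injEq] at h <;> omega

theorem yb_inj (h : yb n i ρ = yb n i σ) : ρ = σ := by
  refine xb_inj (n := n) (i := i) ?_
  rw [yb, yb, Prod.mk.injEq] at h
  exact Prod.ext h.1 (by omega)

theorem xb_ne_yb (hi : 1 ≤ i) (hn : i ≤ n) : xb n i ρ ≠ yb n i σ := by
  unfold yb xb
  split_ifs <;> rw [Ne, Prod.mk.injEq] <;> simp only <;> omega

theorem p_pr (hi : 1 ≤ i) (h1 : 1 ≤ ρ) (h2 : ρ ≤ slen n i) : p n (pr n i ρ) = (xb n i ρ).1 :=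
  p_pos (xb_mem hi h1 h2)

theorem q_pr (hi : 1 ≤ i) (h1 : 1 ≤ ρ) (h2 : ρ ≤ slen n i) : q n (pr n i ρ) = (xb n i ρ).2 :=
  q_pos (xb_mem hi h1 h2)

theorem pr_le (hi : 1 ≤ i) (h1 : 1 ≤ ρ) (h2 : ρ ≤ slen n i) : pr n i ρ ≤ n ^ 2 :=
  pos_le (xb_mem hi h1 h2)

theorem pr_lt_pr (hi : 1 ≤ i) (hn : i ≤ n) (h1 : 1 ≤ ρ) (h2 : ρ ≤ slen n i) (h3 : 1 ≤ σ)
    (h4 : σ ≤ slen n i) : pr n i ρ < pr n i σ ↔ σ < ρ := by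
  unfold pr
  rw [pos_lt_pos (a := (xb n i ρ).1) (c := (xb n i ρ).2) (a' := (xb n i σ).1)
    (c' := (xb n i σ).2)
    (xb_mem hi h1 h2) (xb_mem hi h3 h4)]
  unfold xb
  split_ifs <;> simp only <;> omega

theorem pr_le_pr (hi : 1 ≤ i) (hn : i ≤ n) (h1 : 1 ≤ ρ) (h2 : ρ ≤ slen n i) (h3 : 1 ≤ σ)
    (h4 : σ ≤ slen n i) : pr n i ρ ≤ pr n i σ ↔ σ ≤ ρ := by
  rw [← not_lt, pr_lt_pr hi hn h3 h4 h1 h2, not_lt]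

theorem inCols_xb : InCols n i (xb n i ρ).2 := by
  unfold InCols xb
  split_ifs
  · left; change n = _; omega
  · exact Or.inl rfl
  · exact Or.inr rfl

theorem exists_xb_of_inCols {b : ℕ × ℕ} (hi : 1 ≤ i) (hn : i ≤ n) (hb : b ∈ SY n)
    (h : InCols n i b.2) : ∃ ρ, 1 ≤ ρ ∧ ρ ≤ slen n i ∧ xb n i ρ = b := by
  obtain ⟨a, c⟩ := b
  rw [mem_SY] at hb
  unfold InCols at h
  simp only at h
  by_cases h1 : i = 1
  · refine ⟨a, by omega, ?_, ?_⟩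
    · rw [slen, if_pos h1]; omega
    · rw [xb, if_pos h1, Prod.mk.injEq]; omega
  · by_cases hc : c ≤ n
    · refine ⟨2 * a - 1, by omega, ?_, ?_⟩
      · rw [slen, if_neg h1]; omega
      · rw [xb, if_neg h1, if_pos (by omega), Prod.mk.injEq]; omega
    · refine ⟨2 * a, by omega, ?_, ?_⟩
      · rw [slen, if_neg h1]; omega
      · rw [xb, if_neg h1, if_neg (by omega), Prod.mk.injEq]; omega

theorem exists_pr (hi : 1 ≤ i) (hn : i ≤ n) {r : ℕ} (h1 : 1 ≤ r) (h2 : r ≤ n ^ 2)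
    (h : InCols n i (q n r)) : ∃ ρ, 1 ≤ ρ ∧ ρ ≤ slen n i ∧ pr n i ρ = r := by
  obtain ⟨ha, hb⟩ := pos_spec h1 h2
  obtain ⟨ρ, hρ, hρ', h3⟩ := exists_xb_of_inCols hi hn ha h
  exact ⟨ρ, hρ, hρ', by rw [pr, h3, hb]⟩

theorem exists_xb {b : ℕ × ℕ} (hb : b ∈ SY n) :
    ∃ i ρ, 1 ≤ i ∧ i ≤ n ∧ 1 ≤ ρ ∧ ρ ≤ slen n i ∧ xb n i ρ = b := by
  have hb' := mem_SY.1 hb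
  obtain ⟨ρ, h⟩ := exists_xb_of_inCols (i := ((n : ℤ) - b.2).natAbs + 1) (by omega) (by omega) hb
    (by unfold InCols; omega)
  exact ⟨_, ρ, by omega, by omega, h⟩

theorem inCols_iff {a j c : ℕ} (hi : 1 ≤ i) (hn : i ≤ n)
    (h : xb n i ρ = (a, j)) : (c = j ∨ c = 2 * n - j) ↔ InCols n i c := by
  have := inCols_xb (n := n) (i := i) (ρ := ρ)
  rw [h] at this
  unfold InCols at *
  simp only at this
  omega

theorem iC_pr (hi : 1 ≤ i) (hn : i ≤ n) (h1 : 1 ≤ ρ) (h2 : ρ ≤ slen n i) : iC (pr n i ρ) = i := by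
  rw [pr, iC_pos (a := (xb n i ρ).1) (c := (xb n i ρ).2) (xb_mem hi h1 h2)]
  have := inCols_xb (n := n) (i := i) (ρ := ρ)
  unfold InCols at this
  omega

/-- Row `ρ` of the strip of the letter `i` is contained in `D`. -/
def Full (n i : ℕ) (D : Finset (ℕ × ℕ)) (ρ : ℕ) : Prop := xb n i ρ ∈ D ∧ yb n i ρ ∈ D

/-- Positions increase towards smaller row numbers of the strip (`pr_lt_pr`), so the range `k < r <
l` of positions becomes a range of strip rows with the ends reversed. -/
theorem ladderMove_iff {D D' : Finset (ℕ × ℕ)} (hD : D ⊆ SY n) {a j : ℕ} :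
    LadderMove n a j D D' ↔ ∃ i κ l, 1 ≤ i ∧ i ≤ n ∧ 1 ≤ l ∧ l < κ ∧ κ ≤ slen n i ∧
      xb n i κ = (a, j) ∧ xb n i κ ∈ D ∧ yb n i κ ∉ D ∧ xb n i l ∉ D ∧ yb n i l ∉ D ∧
      (∀ ρ, l < ρ → ρ < κ → Full n i D ρ) ∧ D' = insert (yb n i l) (D.erase (xb n i κ)) := by
  constructor
  · rintro ⟨hx, hy, k, l, hk, hkij, hkl, hl, hq, hxl, hyl, hfull, rfl⟩
    have hkn : k ≤ n ^ 2 := by omega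
    obtain ⟨i, κ, hi, hin, hκ1, hκ2, hκ⟩ := exists_xb (hD hx)
    have hkκ : pr n i κ = k := by
      rw [← (pos_spec hk hkn).2, pr, hκ]
      rw [Prod.mk.injEq] at hkij
      rw [hkij.1, hkij.2]
    rw [inCols_iff hi hin hκ] at hq
    obtain ⟨σ, hσ1, hσ2, hσ⟩ := exists_pr hi hin (by omega) hl hq
    subst hσ
    subst hkκ
    rw [p_pr hi hσ1 hσ2, q_pr hi hσ1 hσ2, Finset.mem_sdiff] at hxl hyl
    have hlt : σ < κ := (pr_lt_pr hi hin hκ1 hκ2 hσ1 hσ2).1 (by omega)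
    refine ⟨i, κ, σ, hi, hin, hσ1, hlt, hκ2, hκ, hκ ▸ hx, ?_, hxl.2, hyl.2, ?_, ?_⟩
    · rw [yb, hκ]; exact hy
    · intro ρ h1 h2
      have h3 : 1 ≤ ρ := by omega
      have h4 : ρ ≤ slen n i := by omega
      have := hfull (pr n i ρ) ((pr_lt_pr hi hin hκ1 hκ2 h3 h4).2 h2)
        (by have := (pr_lt_pr hi hin h3 h4 hσ1 hσ2).2 h1; omega) (by
          rw [inCols_iff hi hin hκ, q_pr hi h3 h4]; exact inCols_xb)
      rw [p_pr hi h3 h4, q_pr hi h3 h4] at this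
      exact this
    · rw [p_pr hi hσ1 hσ2, q_pr hi hσ1 hσ2, hκ]
      change (D ∪ {yb n i σ}) \ {(a, j)} = _
      have := xb_ne_yb (ρ := κ) (σ := σ) hi hin
      rw [hκ] at this
      ext b
      simp only [Finset.mem_sdiff, Finset.mem_union, Finset.mem_singleton, Finset.mem_insert,
        Finset.mem_erase]
      constructor
      · tauto
      · rintro (rfl | h)
        · exact ⟨Or.inr rfl, this.symm⟩
        · tauto
  · rintro ⟨i, κ, σ, hi, hin, hσ1, hlt, hκ2, hκ, hxκ, hyκ, hxσ, hyσ, hfull, rfl⟩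
    have hκ1 : 1 ≤ κ := by omega
    have hσ2 : σ ≤ slen n i := by omega
    refine ⟨hκ ▸ hxκ, ?_, pr n i κ, pr n i σ, one_le_pos, ?_, ?_, pr_le hi hσ1 hσ2, ?_, ?_, ?_,
      ?_, ?_⟩
    · rw [yb, hκ] at hyκ; exact hyκ
    · rw [p_pr hi hκ1 hκ2, q_pr hi hκ1 hκ2, hκ]
    · exact (pr_lt_pr hi hin hκ1 hκ2 hσ1 hσ2).2 hlt
    · rw [inCols_iff hi hin hκ, q_pr hi hσ1 hσ2]; exact inCols_xb
    · rw [p_pr hi hσ1 hσ2, q_pr hi hσ1 hσ2, Finset.mem_sdiff]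
      exact ⟨xb_mem hi hσ1 hσ2, hxσ⟩
    · rw [p_pr hi hσ1 hσ2, q_pr hi hσ1 hσ2, Finset.mem_sdiff]
      exact ⟨yb_mem hi hσ1 (by omega), hyσ⟩
    · intro r h1 h2 hq
      rw [inCols_iff hi hin hκ] at hq
      have hσn := pr_le hi hσ1 hσ2
      obtain ⟨ρ, h3, h4, rfl⟩ := exists_pr hi hin (by omega) (by omega) hq
      have h5 := (pr_lt_pr hi hin hκ1 hκ2 h3 h4).1 (by omega)
      have h6 := (pr_lt_pr hi hin h3 h4 hσ1 hσ2).1 (by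
        have := one_le_pos (n := n) (a := (xb n i σ).1) (c := (xb n i σ).2)
        change 1 ≤ pr n i σ at this
        omega)
      rw [p_pr hi h3 h4, q_pr hi h3 h4]
      exact hfull ρ h6 h5
    · rw [p_pr hi hσ1 hσ2, q_pr hi hσ1 hσ2, hκ]
      change _ = (D ∪ {yb n i σ}) \ {(a, j)}
      have := xb_ne_yb (ρ := κ) (σ := σ) hi hin
      rw [hκ] at this
      ext b
      simp only [Finset.mem_sdiff, Finset.mem_union, Finset.mem_singleton, Finset.mem_insert,
        Finset.mem_erase]
      constructor
      · rintro (rfl | h)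
        · exact ⟨Or.inr rfl, this.symm⟩
        · tauto
      · tauto

/-- The largest position `r_0` belongs to the topmost strip row without its right box, and the
condition `(†)` supplies the left boxes up to that row. So the rows above it are full and the row
itself contains only its left box. -/
theorem mitosisAt_iff {D : Finset (ℕ × ℕ)} (hi : 1 ≤ i) (hn : i ≤ n) {r : ℕ} :
    MitosisAt n i D r ↔ ∃ ρ, 1 ≤ ρ ∧ ρ ≤ slen n i ∧ r = pr n i ρ ∧ xb n i ρ ∈ D ∧ yb n i ρ ∉ D ∧
      ∀ σ, 1 ≤ σ → σ < ρ → Full n i D σ := by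
  constructor
  · rintro ⟨⟨⟨h1, h2, hq, hy⟩, hmax⟩, hx⟩
    obtain ⟨ρ, h3, h4, rfl⟩ := exists_pr hi hn h1 h2 hq
    rw [p_pr hi h3 h4, q_pr hi h3 h4] at hy
    have hx' : ∀ σ, 1 ≤ σ → σ ≤ ρ → xb n i σ ∈ D := by
      intro σ h5 h6
      have := hx (pr n i σ) ((pr_le_pr hi hn h3 h4 h5 (by omega)).2 h6) (pr_le hi h5 (by omega))
        (by rw [q_pr hi h5 (by omega)]; exact inCols_xb)
      rwa [p_pr hi h5 (by omega), q_pr hi h5 (by omega)] at this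
    refine ⟨ρ, h3, h4, rfl, hx' ρ h3 le_rfl, hy, fun σ h5 h6 => ⟨hx' σ h5 h6.le, ?_⟩⟩
    by_contra hcon
    have := hmax (a := pr n i σ) ⟨one_le_pos, pr_le hi h5 (by omega), by
      rw [q_pr hi h5 (by omega)]; exact inCols_xb, by
      rw [p_pr hi h5 (by omega), q_pr hi h5 (by omega)]; exact hcon⟩
    rw [pr_le_pr hi hn h5 (by omega) h3 h4] at this
    omega
  · rintro ⟨ρ, h3, h4, rfl, hx, hy, hfull⟩
    refine ⟨⟨⟨one_le_pos, pr_le hi h3 h4, ?_, ?_⟩, ?_⟩, ?_⟩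
    · rw [q_pr hi h3 h4]; exact inCols_xb
    · rw [p_pr hi h3 h4, q_pr hi h3 h4]; exact hy
    · rintro r ⟨h1, h2, hq, hyr⟩
      obtain ⟨σ, h5, h6, rfl⟩ := exists_pr hi hn h1 h2 hq
      rw [p_pr hi h5 h6, q_pr hi h5 h6] at hyr
      rw [pr_le_pr hi hn h5 h6 h3 h4]
      by_contra hcon
      exact hyr (hfull σ h5 (by omega)).2
    · intro r h1 h2 hq
      have h0 : 1 ≤ pr n i ρ := one_le_pos
      obtain ⟨σ, h5, h6, rfl⟩ := exists_pr hi hn (by omega) h2 hq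
      rw [pr_le_pr hi hn h3 h4 h5 h6] at h1
      rw [p_pr hi h5 h6, q_pr hi h5 h6]
      rcases h1.eq_or_lt with rfl | h1
      · exact hx
      · exact (hfull σ h5 h1).1

end Strip

/-! ### Simple reflections -/

theorem s_one_apply (z : ℤ) : s 1 z = if z = 1 ∨ z = -1 then -z else z := by
  simp only [s, if_true, Equiv.swap_apply_def]
  split_ifs <;> omega

theorem s_apply {i : ℕ} (hi : 2 ≤ i) (z : ℤ) : s i z =
    if z = i then (i : ℤ) - 1 else if z = i - 1 then (i : ℤ) else
    if z = -i then -((i : ℤ) - 1) else if z = -(i - 1) then -(i : ℤ) else z := by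
  rw [s, if_neg (by omega), Equiv.Perm.mul_apply]
  simp only [Equiv.swap_apply_def]
  split_ifs <;> omega

theorem s_mul_self {i : ℕ} (hi : 1 ≤ i) : s i * s i = 1 := by
  ext z
  rw [Equiv.Perm.mul_apply, Equiv.Perm.one_apply]
  rcases hi.eq_or_lt with rfl | hi
  · simp only [s_one_apply]; split_ifs <;> omega
  · simp only [s_apply hi]; split_ifs <;> omega

theorem s_mem_W {n i : ℕ} (hi : 1 ≤ i) (hn : i ≤ n) : s i ∈ W n := by
  change (∀ z, s i (-z) = -s i z) ∧ ∀ z : ℤ, (n : ℤ) < |z| → s i z = z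
  rcases hi.eq_or_lt with rfl | hi
  · simp only [s_one_apply]
    refine ⟨fun z => by split_ifs <;> omega, fun z hz => ?_⟩
    rw [lt_abs] at hz
    split_ifs <;> omega
  · simp only [s_apply hi]
    refine ⟨fun z => by split_ifs <;> omega, fun z hz => ?_⟩
    rw [lt_abs] at hz
    split_ifs <;> omega

/-! ### Labellings

The edges of the extended diagram are labelled by integers. The label of a pipe changes its sign
whenever the pipe makes a turn in column `n + 1`, and a closed loop has the label `0`. The label
`h ρ C` belongs to the left side of the box `(ρ, C)`, and `e ρ C` to its bottom side. -/

/-- The labels of the edges of a box, which is a crossing if `d` holds, and an elbow or a reversed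
elbow otherwise. -/
def BoxRule (d : Prop) (hi vi ho vo : ℤ) : Prop :=
  (d → ho = hi ∧ vo = vi) ∧ (¬d → ho = vi ∧ vo = hi)

/-- The labels `h` and `e` are compatible with the pipes of `D`. -/
structure IsLabelling (n : ℕ) (D : Finset (ℕ × ℕ)) (h e : ℕ → ℕ → ℤ) : Prop where
  start : ∀ a, 1 ≤ a → a ≤ n → h (2 * a - 1) a = -((n : ℤ) + 1 - a)
  turn : ∀ a, 1 ≤ a → a ≤ n → h (2 * a) (n + 1) = -h (2 * a - 1) (n + 1)
  odd : ∀ a C, 1 ≤ a → a ≤ C → C ≤ n → BoxRule ((a, C) ∈ D)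
    (h (2 * a - 1) C) (e (2 * a - 1) C) (h (2 * a - 1) (C + 1)) (e (2 * a - 2) C)
  even : ∀ a C, 1 ≤ a → a ≤ C → C ≤ n → BoxRule ((a, 2 * n + 1 - C) ∈ D)
    (h (2 * a) (C + 1)) (e (2 * a) C) (h (2 * a) C) (e (2 * a - 1) C)

/-- There is a labelling of the pipes of `D` whose labels at the top are the values of `w`. -/
def Lab (n : ℕ) (D : Finset (ℕ × ℕ)) (w : Equiv.Perm ℤ) : Prop :=
  ∃ h e, IsLabelling n D h e ∧ ∀ j : ℕ, 1 ≤ j → j ≤ n → e 0 (n + 1 - j) = w j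

/-- `D'` is obtained from `D` by toggling `xb n i κ`, and also `yb n i l` if `l ≠ 0`, where row `κ`
does not contain `yb n i κ`, row `l` does not contain `xb n i l`, and the rows in between are
full. -/
structure Toggle (n i l κ : ℕ) (D D' : Finset (ℕ × ℕ)) : Prop where
  one_le : 1 ≤ i
  le : i ≤ n
  lt : l < κ
  le_slen : κ ≤ slen n i
  y_bot : yb n i κ ∉ D
  full : ∀ ρ, l < ρ → ρ < κ → Full n i D ρ
  x_top : 1 ≤ l → xb n i l ∉ D
  x_iff : xb n i κ ∈ D' ↔ xb n i κ ∉ D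
  y_iff : 1 ≤ l → (yb n i l ∈ D' ↔ yb n i l ∉ D)
  mem_iff : ∀ b, b ≠ xb n i κ → (1 ≤ l → b ≠ yb n i l) → (b ∈ D' ↔ b ∈ D)

theorem Toggle.x_mem {n i l κ : ℕ} {D D' : Finset (ℕ × ℕ)} (t : Toggle n i l κ D D') {ρ : ℕ}
    (h : ρ ≠ κ) : xb n i ρ ∈ D' ↔ xb n i ρ ∈ D :=
  t.mem_iff _ (fun h' => h (xb_inj h')) fun _ => xb_ne_yb t.one_le t.le

theorem Toggle.y_mem {n i l κ : ℕ} {D D' : Finset (ℕ × ℕ)} (t : Toggle n i l κ D D') {ρ : ℕ}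
    (h : ρ ≠ l) : yb n i ρ ∈ D' ↔ yb n i ρ ∈ D :=
  t.mem_iff _ (fun h' => xb_ne_yb t.one_le t.le h'.symm) fun _ h' => h (yb_inj h')

theorem BoxRule.congr {d d' : Prop} {hi vi ho vo hi' vi' ho' vo' : ℤ}
    (hr : BoxRule d hi vi ho vo) (hd : d' ↔ d) (h1 : hi' = hi) (h2 : vi' = vi) (h3 : ho' = ho)
    (h4 : vo' = vo) : BoxRule d' hi' vi' ho' vo' := by
  subst h1 h2 h3 h4
  rwa [BoxRule, hd]

/-- The toggled labels of a row in the strip of a letter `i ≥ 2`. -/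
theorem boxRule_toggle_row {l κ ρ : ℕ} {x y x' y' : Prop} [Decidable x']
    {hin mid hout vx vy ox oy : ℤ}
    (hlκ : l < κ) (h1 : 1 ≤ ρ) (hlρ : l ≤ ρ) (hρκ : ρ ≤ κ)
    (ybot : ρ = κ → ¬y) (xtop : ρ = l → ¬x) (full : l < ρ → ρ < κ → x ∧ y)
    (xiff : ρ = κ → (x' ↔ ¬x)) (yiff : ρ = l → (y' ↔ ¬y)) (xmem : ρ ≠ κ → (x' ↔ x))
    (ymem : ρ ≠ l → (y' ↔ y))
    (r1 : BoxRule x hin vx mid ox) (r2 : BoxRule y mid vy hout oy) :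
    BoxRule x' hin (if l ≤ ρ ∧ ρ < κ then vy else vx)
      (if x' then hin else if l ≤ ρ ∧ ρ < κ then vy else vx)
      (if l ≤ ρ - 1 ∧ ρ - 1 < κ then oy else ox) ∧
    BoxRule y' (if x' then hin else if l ≤ ρ ∧ ρ < κ then vy else vx)
      (if l ≤ ρ ∧ ρ < κ then vx else vy) hout
      (if l ≤ ρ - 1 ∧ ρ - 1 < κ then ox else oy) := by
  -- Top row `l`: the first box is an elbow, so its incoming label leaves upwards unchanged, and the
  -- toggle of the second box undoes the exchange. In row `κ` the second box is an elbow, and the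
  -- toggle of the first box starts the exchange. Full rows only transmit it.
  rcases hlρ.eq_or_lt with rfl | hlρ
  · have hx := xtop rfl
    have hx' : ¬x' := fun h => hx ((xmem (by omega)).1 h)
    obtain ⟨m1, m2⟩ := r1.2 hx
    have c1 : l ≤ l ∧ l < κ := ⟨le_rfl, hlκ⟩
    have c2 : ¬(l ≤ l - 1 ∧ l - 1 < κ) := by omega
    simp only [if_pos c1, if_neg c2, if_neg hx']
    refine ⟨⟨fun h => absurd h hx', fun _ => ⟨rfl, m2⟩⟩, fun hy => ?_, fun hy => ?_⟩
    · obtain ⟨m3, m4⟩ := r2.2 ((yiff rfl).1 hy)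
      exact ⟨m3, m4.trans m1⟩
    · obtain ⟨m3, m4⟩ := r2.1 (not_not.1 fun h => hy ((yiff rfl).2 h))
      exact ⟨m3.trans m1, m4⟩
  · rcases hρκ.eq_or_lt with rfl | hρκ
    · have hy := ybot rfl
      have hy' : ¬y' := fun h => hy ((ymem (by omega)).1 h)
      obtain ⟨m3, m4⟩ := r2.2 hy
      have c1 : ¬(l ≤ ρ ∧ ρ < ρ) := by omega
      have c2 : l ≤ ρ - 1 ∧ ρ - 1 < ρ := by omega
      simp only [if_neg c1, if_pos c2]
      by_cases hx : x'
      · obtain ⟨m1, m2⟩ := r1.2 ((xiff rfl).1 hx)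
        rw [if_pos hx]
        exact ⟨⟨fun _ => ⟨rfl, m4.trans m1⟩, fun h => absurd hx h⟩,
          fun h => absurd h hy', fun _ => ⟨m3, m2⟩⟩
      · obtain ⟨m1, m2⟩ := r1.1 (not_not.1 fun h => hx ((xiff rfl).2 h))
        rw [if_neg hx]
        exact ⟨⟨fun h => absurd h hx, fun _ => ⟨rfl, m4.trans m1⟩⟩,
          fun h => absurd h hy', fun _ => ⟨m3, m2⟩⟩
    · obtain ⟨hx, hy⟩ := full hlρ hρκ
      have hx' := (xmem (by omega)).2 hx
      have hy' := (ymem (by omega)).2 hy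
      obtain ⟨m1, m2⟩ := r1.1 hx
      obtain ⟨m3, m4⟩ := r2.1 hy
      have c1 : l ≤ ρ ∧ ρ < κ := by omega
      have c2 : l ≤ ρ - 1 ∧ ρ - 1 < κ := by omega
      simp only [if_pos c1, if_pos c2, if_pos hx']
      exact ⟨⟨fun _ => ⟨rfl, m4⟩, fun h => absurd hx' h⟩,
        fun _ => ⟨m3.trans m1, m2⟩, fun h => absurd hy' h⟩

/-- The labels of the edges after a toggle in the strip of a letter `i ≥ 2`. -/
theorem IsLabelling.toggle_of_two_le {n i l κ : ℕ} {D D' : Finset (ℕ × ℕ)} {h e : ℕ → ℕ → ℤ}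
    (hL : IsLabelling n D h e) (t : Toggle n i l κ D D') (hi : 2 ≤ i) :
    ∃ h' e', IsLabelling n D' h' e' ∧ (1 ≤ l → e' 0 = e 0) ∧
      (l = 0 → ∀ C, e' 0 C = if C = n + 1 - i then e 0 (n + 2 - i) else
        if C = n + 2 - i then e 0 (n + 1 - i) else e 0 C) := by
  classical
  have hlen : slen n i = 2 * (n + 1 - i) := by rw [slen, if_neg (by omega)]
  have hκ := t.le_slen
  rw [hlen] at hκ
  have hin := t.le
  have hlκ := t.lt
  obtain ⟨c, hc⟩ : ∃ c, c = n + 1 - i := ⟨_, rfl⟩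
  have hc2 : n + 2 - i = c + 1 := by omega
  rw [← hc] at hκ
  have xodd : ∀ a, 1 ≤ a → xb n i (2 * a - 1) = (a, c) := fun a ha => by
    rw [xb, if_neg (by omega), if_pos (by omega), hc, Prod.mk.injEq]; omega
  have xeven : ∀ a, xb n i (2 * a) = (a, 2 * n + 1 - (c + 1)) := fun a => by
    rw [xb, if_neg (by omega), if_neg (by omega), Prod.mk.injEq]; omega
  have yodd : ∀ a, 1 ≤ a → yb n i (2 * a - 1) = (a, c + 1) := fun a ha => by
    rw [yb, xodd a ha]
  have yeven : ∀ a, yb n i (2 * a) = (a, 2 * n + 1 - c) := fun a => by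
    rw [yb, xeven a, Prod.mk.injEq]; omega
  have xcol : (xb n i κ).2 = c ∨ (xb n i κ).2 = 2 * n - c := by
    unfold xb; split_ifs <;> simp only <;> omega
  have ycol : (yb n i l).2 = c + 1 ∨ (yb n i l).2 = 2 * n + 1 - c := by
    unfold yb xb; split_ifs <;> simp only <;> omega
  -- The vertical labels of the columns `c` and `c + 1` are exchanged exactly between the rows `κ`
  -- and `l`.
  set e' : ℕ → ℕ → ℤ := fun ρ C => if l ≤ ρ ∧ ρ < κ then
    (if C = c then e ρ (c + 1) else if C = c + 1 then e ρ c else e ρ C) else e ρ C with he'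
  -- Only the horizontal edge between the two boxes of a row gets a new label, dictated by the first
  -- box that is met. Odd rows are traversed to the right, entering at column `c`, and even rows to
  -- the left, entering at the edge `c + 2`.
  set h' : ℕ → ℕ → ℤ := fun ρ C => if C = c + 1 ∧ 1 ≤ ρ ∧ l ≤ ρ ∧ ρ ≤ κ then
    (if xb n i ρ ∈ D' then (if ρ % 2 = 1 then h ρ c else h ρ (c + 2))
      else e' ρ (if ρ % 2 = 1 then c else c + 1)) else h ρ C with hh'
  have e1 : ∀ ρ, e' ρ c = if l ≤ ρ ∧ ρ < κ then e ρ (c + 1) else e ρ c := fun ρ => by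
    simp [he']
  have e2 : ∀ ρ, e' ρ (c + 1) = if l ≤ ρ ∧ ρ < κ then e ρ c else e ρ (c + 1) := fun ρ => by
    simp [he']
  have e3 : ∀ ρ C, C ≠ c → C ≠ c + 1 → e' ρ C = e ρ C := fun ρ C h1 h2 => by
    simp [he', h1, h2]
  have e4 : ∀ ρ C, ¬(l ≤ ρ ∧ ρ < κ) → e' ρ C = e ρ C := fun ρ C h1 => by
    simp only [he', if_neg h1]
  have h1 : ∀ ρ C, C ≠ c + 1 → h' ρ C = h ρ C := fun ρ C h1 => by
    simp only [hh']; rw [if_neg (by omega)]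
  have h2 : ∀ ρ C, ¬(1 ≤ ρ ∧ l ≤ ρ ∧ ρ ≤ κ) → h' ρ C = h ρ C := fun ρ C h1 => by
    simp only [hh']; rw [if_neg (by tauto)]
  have rowodd : ∀ a, 1 ≤ a → l ≤ 2 * a - 1 → 2 * a - 1 ≤ κ →
      BoxRule ((a, c) ∈ D') (h' (2 * a - 1) c) (e' (2 * a - 1) c) (h' (2 * a - 1) (c + 1))
        (e' (2 * a - 2) c) ∧
      BoxRule ((a, c + 1) ∈ D') (h' (2 * a - 1) (c + 1)) (e' (2 * a - 1) (c + 1))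
        (h' (2 * a - 1) (c + 2)) (e' (2 * a - 2) (c + 1)) := by
    intro a ha hl hk
    have r1 := hL.odd a c ha (by omega) (by omega)
    have r2 := hL.odd a (c + 1) ha (by omega) (by omega)
    rw [← xodd a ha] at r1 ⊢
    rw [← yodd a ha] at r2 ⊢
    have key := boxRule_toggle_row (x' := xb n i (2 * a - 1) ∈ D') (y' := yb n i (2 * a - 1) ∈ D')
      hlκ (by omega) hl hk (fun h => h ▸ t.y_bot) (fun h => h ▸ t.x_top (by omega))
      (t.full _) (fun h => h ▸ t.x_iff) (fun h => h ▸ t.y_iff (by omega)) t.x_mem t.y_mem r1 r2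
    have hmid : h' (2 * a - 1) (c + 1) = if xb n i (2 * a - 1) ∈ D' then h (2 * a - 1) c else
        if l ≤ 2 * a - 1 ∧ 2 * a - 1 < κ then e (2 * a - 1) (c + 1) else e (2 * a - 1) c := by
      rw [← e1]
      simp only [hh']
      have c1 : (2 * a - 1) % 2 = 1 := by omega
      rw [if_pos ⟨trivial, by omega, hl, hk⟩, if_pos c1, if_pos c1]
    rw [hmid, e1, e2, e1, e2, h1 _ c (by omega), h1 _ (c + 2) (by omega)]
    exact key
  have roweven : ∀ a, 1 ≤ a → l ≤ 2 * a → 2 * a ≤ κ →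
      BoxRule ((a, 2 * n + 1 - (c + 1)) ∈ D') (h' (2 * a) (c + 2)) (e' (2 * a) (c + 1))
        (h' (2 * a) (c + 1)) (e' (2 * a - 1) (c + 1)) ∧
      BoxRule ((a, 2 * n + 1 - c) ∈ D') (h' (2 * a) (c + 1)) (e' (2 * a) c)
        (h' (2 * a) c) (e' (2 * a - 1) c) := by
    intro a ha hl hk
    have r1 := hL.even a (c + 1) ha (by omega) (by omega)
    have r2 := hL.even a c ha (by omega) (by omega)
    rw [← xeven a] at r1 ⊢
    rw [← yeven a] at r2 ⊢
    have key := boxRule_toggle_row (x' := xb n i (2 * a) ∈ D') (y' := yb n i (2 * a) ∈ D')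
      hlκ (by omega) hl hk (fun h => h ▸ t.y_bot) (fun h => h ▸ t.x_top (by omega))
      (t.full _) (fun h => h ▸ t.x_iff) (fun h => h ▸ t.y_iff (by omega)) t.x_mem t.y_mem r1 r2
    have hmid : h' (2 * a) (c + 1) = if xb n i (2 * a) ∈ D' then h (2 * a) (c + 2) else
        if l ≤ 2 * a ∧ 2 * a < κ then e (2 * a) c else e (2 * a) (c + 1) := by
      rw [← e2]
      simp only [hh']
      have c1 : ¬(2 * a) % 2 = 1 := by omega
      rw [if_pos ⟨trivial, by omega, hl, hk⟩, if_neg c1, if_neg c1]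
    rw [hmid, e1, e2, e1, e2, h1 _ c (by omega), h1 _ (c + 2) (by omega)]
    exact key
  have memodd : ∀ a C, C ≤ n → ((C ≠ c ∧ C ≠ c + 1) ∨ ¬(l ≤ 2 * a - 1 ∧ 2 * a - 1 ≤ κ)) → 1 ≤ a →
      ((a, C) ∈ D' ↔ (a, C) ∈ D) := by
    intro a C hC hor ha
    refine t.mem_iff _ (fun h => ?_) fun _ h => ?_
    · rw [← h] at xcol
      have hCc : C = c := by simp only at xcol; omega
      rw [hCc, ← xodd a ha] at h
      have := xb_inj h
      omega
    · rw [← h] at ycol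
      have hCc : C = c + 1 := by simp only at ycol; omega
      rw [hCc, ← yodd a ha] at h
      have := yb_inj h
      omega
  have memeven : ∀ a C, C ≤ n → ((C ≠ c ∧ C ≠ c + 1) ∨ ¬(l ≤ 2 * a ∧ 2 * a ≤ κ)) → 1 ≤ a →
      ((a, 2 * n + 1 - C) ∈ D' ↔ (a, 2 * n + 1 - C) ∈ D) := by
    intro a C hC hor ha
    refine t.mem_iff _ (fun h => ?_) fun _ h => ?_
    · rw [← h] at xcol
      have hCc : C = c + 1 := by simp only at xcol; omega
      rw [hCc, ← xeven a] at h
      have := xb_inj h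
      omega
    · rw [← h] at ycol
      have hCc : C = c := by simp only at ycol; omega
      rw [hCc, ← yeven a] at h
      have := yb_inj h
      omega
  refine ⟨h', e', ⟨?_, ?_, ?_, ?_⟩, ?_, ?_⟩
  · intro a ha ha'
    rw [← hL.start a ha ha']
    by_cases hac : a = c + 1
    · exact h2 _ _ (by omega)
    · exact h1 _ _ hac
  · intro a ha ha'
    rw [h1 _ _ (by omega), h1 _ _ (by omega), hL.turn a ha ha']
  · intro a C ha haC hC
    by_cases hr : l ≤ 2 * a - 1 ∧ 2 * a - 1 ≤ κ
    · by_cases hCc : C = c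
      · rw [hCc]; exact (rowodd a ha hr.1 hr.2).1
      by_cases hCc' : C = c + 1
      · rw [hCc']; exact (rowodd a ha hr.1 hr.2).2
      exact (hL.odd a C ha haC hC).congr (memodd a C hC (Or.inl ⟨hCc, hCc'⟩) ha)
        (h1 _ _ hCc') (e3 _ _ hCc hCc') (h1 _ _ (by omega)) (e3 _ _ hCc hCc')
    · exact (hL.odd a C ha haC hC).congr (memodd a C hC (Or.inr hr) ha)
        (h2 _ _ (by omega)) (e4 _ _ (by omega)) (h2 _ _ (by omega)) (e4 _ _ (by omega))
  · intro a C ha haC hC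
    by_cases hr : l ≤ 2 * a ∧ 2 * a ≤ κ
    · by_cases hCc : C = c
      · rw [hCc]; exact (roweven a ha hr.1 hr.2).2
      by_cases hCc' : C = c + 1
      · rw [hCc']; exact (roweven a ha hr.1 hr.2).1
      exact (hL.even a C ha haC hC).congr (memeven a C hC (Or.inl ⟨hCc, hCc'⟩) ha)
        (h1 _ _ (by omega)) (e3 _ _ hCc hCc') (h1 _ _ hCc') (e3 _ _ hCc hCc')
    · exact (hL.even a C ha haC hC).congr (memeven a C hC (Or.inr hr) ha)
        (h2 _ _ (by omega)) (e4 _ _ (by omega)) (h2 _ _ (by omega)) (e4 _ _ (by omega))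
  · intro hl
    funext C
    exact e4 _ _ (by omega)
  · intro hl C
    rw [hc2, ← hc]
    simp only [he']
    rw [if_pos (by omega)]

/-- The labels of the edges after a toggle in the strip of the letter `1`. -/
theorem IsLabelling.toggle_one {n l κ : ℕ} {D D' : Finset (ℕ × ℕ)} {h e : ℕ → ℕ → ℤ}
    (hL : IsLabelling n D h e) (t : Toggle n 1 l κ D D') :
    ∃ h' e', IsLabelling n D' h' e' ∧ (1 ≤ l → e' 0 = e 0) ∧
      (l = 0 → ∀ C, e' 0 C = if C = n then -e 0 n else e 0 C) := by
  classical
  have hκ : κ ≤ n := by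
    have := t.le_slen
    rwa [slen, if_pos rfl] at this
  have hlκ := t.lt
  have hxb : ∀ a, xb n 1 a = (a, n) := fun a => by rw [xb, if_pos rfl]
  have hyb : ∀ a, yb n 1 a = (a, n + 1) := fun a => by rw [yb, hxb]
  -- Both boxes of a strip row now lie in column `n`, one in row `2a - 1` and one in row `2a`,
  -- joined by the turn. The label `v a` below them is negated between the toggled rows.
  obtain ⟨v, hv⟩ : ∃ v : ℕ → ℤ, v = fun a => if l ≤ a ∧ a < κ then -e (2 * a) n else e (2 * a) n :=
    ⟨_, rfl⟩
  -- `g` is the label just after the turn and `m` the one between the two boxes. If both boxes are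
  -- elbows, these edges form a closed loop with a single sign change, which forces the value `0`.
  obtain ⟨g, hg⟩ : ∃ g : ℕ → ℤ, g = fun a => if (a, n) ∈ D' then -h (2 * a - 1) n else
    if (a, n + 1) ∈ D' then -v a else 0 := ⟨_, rfl⟩
  obtain ⟨m, hm⟩ : ∃ m : ℕ → ℤ, m = fun a => if (a, n + 1) ∈ D' then v a else
    if (a, n) ∈ D' then -h (2 * a - 1) n else 0 := ⟨_, rfl⟩
  obtain ⟨e', he'⟩ : ∃ e' : ℕ → ℕ → ℤ, e' = fun ρ C => if C = n then
      (if ρ % 2 = 0 then v (ρ / 2) else if l ≤ (ρ + 1) / 2 ∧ (ρ + 1) / 2 ≤ κ then m ((ρ + 1) / 2)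
        else e ρ n) else e ρ C := ⟨_, rfl⟩
  obtain ⟨h', hh'⟩ : ∃ h' : ℕ → ℕ → ℤ, h' = fun ρ C =>
      if C = n + 1 ∧ l ≤ (ρ + 1) / 2 ∧ (ρ + 1) / 2 ≤ κ then
      (if ρ % 2 = 0 then g ((ρ + 1) / 2) else -g ((ρ + 1) / 2)) else h ρ C := ⟨_, rfl⟩
  have e1 : ∀ a, e' (2 * a) n = v a := fun a => by
    simp only [he']; rw [if_pos trivial, if_pos (by omega)]; congr 1; omega
  have e2 : ∀ a, 1 ≤ a → l ≤ a → a ≤ κ → e' (2 * a - 1) n = m a := fun a ha h1 h2 => by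
    have h3 : (2 * a - 1 + 1) / 2 = a := by omega
    simp only [he', h3]; rw [if_pos trivial, if_neg (by omega), if_pos ⟨h1, h2⟩]
  have e2' : ∀ a, 1 ≤ a → ¬(l ≤ a ∧ a ≤ κ) → e' (2 * a - 1) n = e (2 * a - 1) n :=
    fun a ha h1 => by
    have h3 : (2 * a - 1 + 1) / 2 = a := by omega
    simp only [he', h3]; rw [if_pos trivial, if_neg (by omega), if_neg h1]
  have e3 : ∀ ρ C, C ≠ n → e' ρ C = e ρ C := fun ρ C h1 => by simp [he', h1]
  have e4 : ∀ a, 1 ≤ a → e' (2 * a - 2) n = v (a - 1) := fun a ha => by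
    rw [← e1]; congr 1; omega
  have v1 : ∀ a, l ≤ a → a < κ → v a = -e (2 * a) n := fun a h1 h2 => by
    simp only [hv]; rw [if_pos ⟨h1, h2⟩]
  have v2 : ∀ a, ¬(l ≤ a ∧ a < κ) → v a = e (2 * a) n := fun a h1 => by
    simp only [hv]; rw [if_neg h1]
  have h1 : ∀ ρ C, C ≠ n + 1 → h' ρ C = h ρ C := fun ρ C h1 => by
    simp only [hh']; rw [if_neg (by omega)]
  have h2 : ∀ a, 1 ≤ a → l ≤ a → a ≤ κ → h' (2 * a - 1) (n + 1) = -g a := fun a ha h1 h2 => by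
    have h3 : (2 * a - 1 + 1) / 2 = a := by omega
    simp only [hh', h3]; rw [if_pos ⟨trivial, h1, h2⟩, if_neg (by omega)]
  have h3 : ∀ a, l ≤ a → a ≤ κ → h' (2 * a) (n + 1) = g a := fun a h1 h2 => by
    have h3 : (2 * a + 1) / 2 = a := by omega
    simp only [hh', h3]; rw [if_pos ⟨trivial, h1, h2⟩, if_pos (by omega)]
  have h4 : ∀ ρ, ¬(l ≤ (ρ + 1) / 2 ∧ (ρ + 1) / 2 ≤ κ) → h' ρ (n + 1) = h ρ (n + 1) :=
    fun ρ h1 => by simp only [hh']; rw [if_neg (by tauto)]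
  have memx : ∀ a, a ≠ κ → ((a, n) ∈ D' ↔ (a, n) ∈ D) := fun a ha => by
    rw [← hxb]; exact t.x_mem ha
  have memy : ∀ a, a ≠ l → ((a, n + 1) ∈ D' ↔ (a, n + 1) ∈ D) := fun a ha => by
    rw [← hyb]; exact t.y_mem ha
  have mem : ∀ a c, c ≠ n → c ≠ n + 1 → ((a, c) ∈ D' ↔ (a, c) ∈ D) := by
    intro a c h1 h2
    refine t.mem_iff _ ?_ fun _ => ?_
    · rw [hxb, Ne, Prod.mk.injEq]; tauto
    · rw [hyb, Ne, Prod.mk.injEq]; tauto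
  have hyκ : (κ, n + 1) ∉ D := by rw [← hyb]; exact t.y_bot
  have hxκ : (κ, n) ∈ D' ↔ (κ, n) ∉ D := by rw [← hxb]; exact t.x_iff
  have hxl : 1 ≤ l → (l, n) ∉ D := by rw [← hxb]; exact t.x_top
  have hyl : 1 ≤ l → ((l, n + 1) ∈ D' ↔ (l, n + 1) ∉ D) := by rw [← hyb]; exact t.y_iff
  have hfull : ∀ a, l < a → a < κ → (a, n) ∈ D ∧ (a, n + 1) ∈ D := fun a h1 h2 => by
    have := t.full a h1 h2
    rwa [Full, hxb, hyb] at this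
  have hy1 : 2 * n + 1 - n = n + 1 := by omega
  -- In row `l` the first box is an elbow, so toggling the second one reverses the sign of the
  -- outgoing horizontal label, and the negated `v l` compensates for this. In row `κ` the second
  -- box is an elbow, and toggling the first one reverses the sign of the label leaving at the top.
  have row : ∀ a, 1 ≤ a → l ≤ a → a ≤ κ →
      BoxRule ((a, n) ∈ D') (h (2 * a - 1) n) (m a) (-g a) (v (a - 1)) ∧
      BoxRule ((a, n + 1) ∈ D') (g a) (v a) (h (2 * a) n) (m a) := by
    intro a ha hla haκ
    have r1 := hL.odd a n ha (by omega) le_rfl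
    have r2 := hL.even a n ha (by omega) le_rfl
    have r3 := hL.turn a ha (by omega)
    have hpred : 2 * (a - 1) = 2 * a - 2 := by omega
    rw [hy1] at r2
    unfold BoxRule at *
    rcases hla.eq_or_lt with rfl | hla
    · have x0 := hxl ha
      have x1 : (l, n) ∉ D' := fun hh => x0 ((memx l (by omega)).1 hh)
      have y0 := hyl ha
      have va := v1 l le_rfl hlκ
      have vp : v (l - 1) = e (2 * l - 2) n := by rw [v2 _ (by omega), hpred]
      have r1' := r1.2 x0
      by_cases y1 : (l, n + 1) ∈ D'
      · have r2' := r2.2 (y0.1 y1)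
        have gl : g l = -v l := by simp only [hg]; rw [if_neg x1, if_pos y1]
        have ml : m l = v l := by simp only [hm]; rw [if_pos y1]
        refine ⟨⟨fun hh => absurd hh x1, fun _ => ⟨?_, ?_⟩⟩, ⟨fun _ => ⟨?_, ?_⟩,
          fun hh => absurd y1 hh⟩⟩ <;> linarith [r1'.1, r1'.2, r2'.1, r2'.2]
      · have r2' := r2.1 (not_not.1 fun hh => y1 (y0.2 hh))
        have gl : g l = 0 := by simp only [hg]; rw [if_neg x1, if_neg y1]
        have ml : m l = 0 := by simp only [hm]; rw [if_neg y1, if_neg x1]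
        refine ⟨⟨fun hh => absurd hh x1, fun _ => ⟨?_, ?_⟩⟩, ⟨fun hh => absurd hh y1,
          fun _ => ⟨?_, ?_⟩⟩⟩ <;> linarith [r1'.1, r1'.2, r2'.1, r2'.2]
    · have vp : v (a - 1) = -e (2 * a - 2) n := by rw [v1 _ (by omega) (by omega), hpred]
      rcases haκ.eq_or_lt with rfl | haκ
      · have y1 : (a, n + 1) ∉ D' := fun hh => hyκ ((memy a (by omega)).1 hh)
        have va := v2 a (by omega)
        have r2' := r2.2 hyκ
        by_cases x1 : (a, n) ∈ D'
        · have r1' := r1.2 (hxκ.1 x1)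
          have gl : g a = -h (2 * a - 1) n := by simp only [hg]; rw [if_pos x1]
          have ml : m a = -h (2 * a - 1) n := by simp only [hm]; rw [if_neg y1, if_pos x1]
          refine ⟨⟨fun _ => ⟨?_, ?_⟩, fun hh => absurd x1 hh⟩, ⟨fun hh => absurd hh y1,
            fun _ => ⟨?_, ?_⟩⟩⟩ <;> linarith [r1'.1, r1'.2, r2'.1, r2'.2]
        · have r1' := r1.1 (not_not.1 fun hh => x1 (hxκ.2 hh))
          have gl : g a = 0 := by simp only [hg]; rw [if_neg x1, if_neg y1]
          have ml : m a = 0 := by simp only [hm]; rw [if_neg y1, if_neg x1]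
          refine ⟨⟨fun hh => absurd hh x1, fun _ => ⟨?_, ?_⟩⟩, ⟨fun hh => absurd hh y1,
            fun _ => ⟨?_, ?_⟩⟩⟩ <;> linarith [r1'.1, r1'.2, r2'.1, r2'.2]
      · obtain ⟨x0, y0⟩ := hfull a hla haκ
        have x1 := (memx a (by omega)).2 x0
        have y1 := (memy a (by omega)).2 y0
        have va := v1 a (by omega) haκ
        have r1' := r1.1 x0
        have r2' := r2.1 y0
        have gl : g a = -h (2 * a - 1) n := by simp only [hg]; rw [if_pos x1]
        have ml : m a = v a := by simp only [hm]; rw [if_pos y1]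
        refine ⟨⟨fun _ => ⟨?_, ?_⟩, fun hh => absurd x1 hh⟩, ⟨fun _ => ⟨?_, ?_⟩,
          fun hh => absurd y1 hh⟩⟩ <;> linarith [r1'.1, r1'.2, r2'.1, r2'.2]
  refine ⟨h', e', ⟨?_, ?_, ?_, ?_⟩, ?_, ?_⟩
  · intro a ha ha'
    rw [← hL.start a ha ha', h1 _ _ (by omega)]
  · intro a ha ha'
    by_cases hr : l ≤ a ∧ a ≤ κ
    · rw [h2 a ha hr.1 hr.2, h3 a hr.1 hr.2, neg_neg]
    · rw [h4 _ (by omega), h4 _ (by omega), hL.turn a ha ha']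
  · intro a C ha haC hC
    by_cases hCn : C = n
    · subst hCn
      by_cases hr : l ≤ a ∧ a ≤ κ
      · rw [h1 _ _ (by omega), h2 a ha hr.1 hr.2, e2 a ha hr.1 hr.2, e4 a ha]
        exact (row a ha hr.1 hr.2).1
      · refine (hL.odd a C ha haC hC).congr (memx a (by omega)) (h1 _ _ (by omega))
          (e2' a ha hr) (h4 _ (by omega)) ?_
        rw [e4 a ha, v2 _ (by omega)]
        congr 1; omega
    · exact (hL.odd a C ha haC hC).congr (mem a C hCn (by omega)) (h1 _ _ (by omega))
        (e3 _ _ hCn) (h1 _ _ (by omega)) (e3 _ _ hCn)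
  · intro a C ha haC hC
    by_cases hCn : C = n
    · subst hCn
      by_cases hr : l ≤ a ∧ a ≤ κ
      · rw [h1 _ C (by omega), h3 a hr.1 hr.2, e2 a ha hr.1 hr.2, e1 a, hy1]
        exact (row a ha hr.1 hr.2).2
      · refine (hL.even a C ha haC hC).congr ?_ (h4 _ (by omega)) ?_
          (h1 _ _ (by omega)) (e2' a ha hr)
        · rw [hy1]; exact memy a (by omega)
        · rw [e1 a, v2 _ (by omega)]
    · exact (hL.even a C ha haC hC).congr (mem a _ (by omega) (by omega)) (h1 _ _ (by omega))
        (e3 _ _ hCn) (h1 _ _ (by omega)) (e3 _ _ hCn)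
  · intro hl
    funext C
    by_cases hCn : C = n
    · rw [hCn, show 0 = 2 * 0 from rfl, e1, v2 _ (by omega)]
    · exact e3 _ _ hCn
  · intro hl C
    by_cases hCn : C = n
    · rw [if_pos hCn, hCn, show 0 = 2 * 0 from rfl, e1, v1 _ (by omega) (by omega)]
    · rw [if_neg hCn, e3 _ _ hCn]

theorem Lab.toggle {n i l κ : ℕ} {D D' : Finset (ℕ × ℕ)} {w : Equiv.Perm ℤ} (hL : Lab n D w)
    (t : Toggle n i l κ D D') (hl : 1 ≤ l) : Lab n D' w := by
  obtain ⟨h, e, hL, htop⟩ := hL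
  by_cases hi : i = 1
  · subst hi
    obtain ⟨h', e', hL', he, -⟩ := hL.toggle_one t
    exact ⟨h', e', hL', by rw [he hl]; exact htop⟩
  · obtain ⟨h', e', hL', he, -⟩ := hL.toggle_of_two_le t (by have := t.one_le; omega)
    exact ⟨h', e', hL', by rw [he hl]; exact htop⟩

theorem Lab.toggle_top {n i κ : ℕ} {D D' : Finset (ℕ × ℕ)} {w : Equiv.Perm ℤ} (hw : w ∈ W n)
    (hL : Lab n D w) (t : Toggle n i 0 κ D D') : Lab n D' (w * s i) := by
  obtain ⟨h, e, hL, htop⟩ := hL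
  have hin := t.le
  by_cases hi : i = 1
  · subst hi
    obtain ⟨h', e', hL', -, he⟩ := hL.toggle_one t
    refine ⟨h', e', hL', fun j h1 h2 => ?_⟩
    rw [he rfl, Equiv.Perm.mul_apply, s_one_apply]
    by_cases hj : j = 1
    · subst hj
      have := htop 1 le_rfl hin
      rw [if_pos (by omega), if_pos (by simp), hw.1, ← this]
      congr 2
    · rw [if_neg (by omega), if_neg (by omega), htop j h1 h2]
  · have hi2 : 2 ≤ i := by have := t.one_le; omega
    obtain ⟨h', e', hL', -, he⟩ := hL.toggle_of_two_le t hi2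
    refine ⟨h', e', hL', fun j h1 h2 => ?_⟩
    rw [he rfl, Equiv.Perm.mul_apply, s_apply hi2]
    by_cases hj : j = i
    · rw [if_pos (show n + 1 - j = n + 1 - i by omega), if_pos (show (j : ℤ) = i by omega)]
      have := htop (i - 1) (by omega) (by omega)
      rw [Nat.cast_sub (by omega), Nat.cast_one] at this
      rw [← this]; congr 1; omega
    · rw [if_neg (show ¬n + 1 - j = n + 1 - i by omega), if_neg (show ¬(j : ℤ) = i by omega)]
      by_cases hj' : j = i - 1
      · rw [if_pos (show n + 1 - j = n + 2 - i by omega),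
          if_pos (show (j : ℤ) = (i : ℤ) - 1 by omega), ← htop i (by omega) hin]
      · rw [if_neg (show ¬n + 1 - j = n + 2 - i by omega),
          if_neg (show ¬(j : ℤ) = (i : ℤ) - 1 by omega), if_neg (show ¬(j : ℤ) = -(i : ℤ) by omega),
          if_neg (show ¬(j : ℤ) = -((i : ℤ) - 1) by omega), htop j h1 h2]

/-! ### The course of a pipe -/

section Pipe

variable {n k : ℕ} {D : Finset (ℕ × ℕ)}

theorem Side.opp_opp (a : Side) : a.opp.opp = a := by cases a <;> rfl

/-- Each box pairs its sides by an involution, so a pipe can be traced backwards: every state has at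
most one predecessor. This is what `pipeVisits_iff` uses. -/
theorem exitSide_exitSide (b : ℕ × ℕ) (a : Side) :
    exitSide n D b (exitSide n D b a) = a := by
  unfold exitSide
  split_ifs <;> cases a <;> rfl

theorem isExBox_odd {a C : ℕ} (ha : 1 ≤ a) (haC : a ≤ C) (hC : C ≤ n + 1) (han : a ≤ n) :
    IsExBox n (2 * a - 1, C) := by
  unfold IsExBox IsGTBox; simp only; omega

theorem isExBox_even {a C : ℕ} (ha : 1 ≤ a) (haC : a ≤ C) (hC : C ≤ n + 1) (han : a ≤ n) :
    IsExBox n (2 * a, C) := by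
  unfold IsExBox IsGTBox; simp only; omega

theorem mem_Ω_odd {a C : ℕ} (ha : 1 ≤ a) (haC : a ≤ C) (hC : C ≤ n) :
    (2 * a - 1, C) ∈ Ω n D ↔ (a, C) ∈ D := by
  have h1 : Odd (2 * a - 1) := ⟨a - 1, by omega⟩
  have h2 : ¬Even (2 * a - 1) := Nat.not_even_iff_odd.2 h1
  have h3 : (2 * a - 1 + 1) / 2 = a := by omega
  have h4 : IsGTBox n (2 * a - 1, C) := by unfold IsGTBox; simp only; omega
  simp only [Ω, Set.mem_ofPred_eq, h1, h2, h3, h4, true_and, false_and, or_false]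

theorem mem_Ω_even (hD : D ⊆ SY n) {a C : ℕ} (ha : 1 ≤ a) (haC : a ≤ C) (hC : C ≤ n) :
    (2 * a, C) ∈ Ω n D ↔ (a, 2 * n + 1 - C) ∈ D := by
  have h1 : Even (2 * a) := ⟨a, by omega⟩
  have h2 : ¬Odd (2 * a) := Nat.not_odd_iff_even.2 h1
  have h3 : (2 * a) / 2 = a := by omega
  simp only [Ω, Set.mem_ofPred_eq, h1, h2, h3, true_and, false_and, false_or]
  refine ⟨fun h => h.2, fun h => ⟨?_, h⟩⟩
  have := mem_SY.1 (hD h)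
  unfold IsGTBox; simp only; omega

theorem exitSide_odd {a C : ℕ} (ha : 1 ≤ a) (haC : a ≤ C) (hC : C ≤ n) (t : Side) :
    ((a, C) ∈ D → exitSide n D (2 * a - 1, C) t = t.opp) ∧
    ((a, C) ∉ D → exitSide n D (2 * a - 1, C) t = t.elbow) := by
  have h1 : Odd (2 * a - 1) := ⟨a - 1, by omega⟩
  rw [exitSide, mem_Ω_odd ha haC hC]
  exact ⟨fun h => by rw [if_pos h], fun h => by rw [if_neg h, if_pos (Or.inl ⟨hC, h1⟩)]⟩

theorem exitSide_even (hD : D ⊆ SY n) {a C : ℕ} (ha : 1 ≤ a) (haC : a ≤ C) (hC : C ≤ n)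
    (t : Side) :
    ((a, 2 * n + 1 - C) ∈ D → exitSide n D (2 * a, C) t = t.opp) ∧
    ((a, 2 * n + 1 - C) ∉ D → exitSide n D (2 * a, C) t = t.revElbow) := by
  have h1 : ¬Odd (2 * a) := Nat.not_odd_iff_even.2 ⟨a, by omega⟩
  rw [exitSide, mem_Ω_even hD ha haC hC]
  refine ⟨fun h => by rw [if_pos h], fun h => ?_⟩
  rw [if_neg h, if_neg]
  rintro (hh | hh)
  · exact h1 hh.2
  · have := hh.1
    simp only at this
    omega

theorem notMem_Ω {ρ : ℕ} : (ρ, n + 1) ∉ Ω n D := by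
  intro h
  have := h.1.2.1
  simp only at this
  omega

theorem exitSide_odd_last {a : ℕ} (ha : 1 ≤ a) (t : Side) :
    exitSide n D (2 * a - 1, n + 1) t = t.revElbow := by
  have h1 : ¬Even (2 * a - 1) := Nat.not_even_iff_odd.2 ⟨a - 1, by omega⟩
  rw [exitSide, if_neg notMem_Ω, if_neg]
  rintro (hh | hh)
  · have := hh.1
    simp only at this
    omega
  · exact h1 hh.2

theorem exitSide_even_last {a : ℕ} (t : Side) :
    exitSide n D (2 * a, n + 1) t = t.elbow := by
  have h1 : Even (2 * a) := ⟨a, by omega⟩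
  rw [exitSide, if_neg notMem_Ω, if_pos (Or.inr ⟨rfl, h1⟩)]

theorem PipeVisits.isExBox (h1 : 1 ≤ k) (h2 : k ≤ n) {x : (ℕ × ℕ) × Side}
    (h : PipeVisits n D k x) : IsExBox n x.1 := by
  rcases Relation.ReflTransGen.cases_tail h with h | ⟨y, -, h⟩
  · rw [h]
    exact isExBox_odd (by omega) le_rfl (by omega) (by omega)
  · exact h.1

/-- A pipe enters the box `b` through the side `t` if and only if it leaves the adjacent box `c`
through the opposite side. -/
theorem pipeVisits_iff (h1 : 1 ≤ k) (h2 : k ≤ n) {b c : ℕ × ℕ} {t : Side}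
    (hb : IsExBox n b) (hs : (b, t) ≠ ((2 * (n + 1 - k) - 1, n + 1 - k), Side.left))
    (hc : ∀ x, IsExBox n x → (b = neighbour x t.opp ↔ x = c)) (hcb : b = neighbour c t.opp) :
    PipeVisits n D k (b, t) ↔ PipeVisits n D k (c, exitSide n D c t.opp) := by
  constructor
  · intro h
    rcases Relation.ReflTransGen.cases_tail h with h | ⟨⟨x, u⟩, hx, -, h3, h4⟩
    · exact absurd h hs
    · simp only at h3 h4
      have h5 : exitSide n D x u = t.opp := by rw [h4, Side.opp_opp]
      rw [h5] at h3
      have hxc := (hc x (PipeVisits.isExBox h1 h2 hx)).1 h3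
      subst hxc
      rw [← h5, exitSide_exitSide]
      exact hx
  · intro h
    refine Relation.ReflTransGen.tail h ⟨hb, ?_, ?_⟩
    · simp only [exitSide_exitSide]; exact hcb
    · simp only [exitSide_exitSide, Side.opp_opp]

theorem IsExBox.one_le {b : ℕ × ℕ} (h : IsExBox n b) : 1 ≤ b.1 ∧ 1 ≤ b.2 := by
  unfold IsExBox IsGTBox at h; omega

theorem pipeVisits_left (h1 : 1 ≤ k) (h2 : k ≤ n) {ρ C : ℕ} (hb : IsExBox n (ρ, C + 1))
    (hs : ¬(ρ = 2 * (n + 1 - k) - 1 ∧ C + 1 = n + 1 - k)) :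
    PipeVisits n D k ((ρ, C + 1), Side.left) ↔
      PipeVisits n D k ((ρ, C), exitSide n D (ρ, C) Side.right) := by
  refine pipeVisits_iff h1 h2 hb (fun h => hs ?_) (fun x hx => ?_) rfl
  · simpa using h
  · simp only [neighbour, Side.opp, Prod.ext_iff]; omega

theorem pipeVisits_bottom (h1 : 1 ≤ k) (h2 : k ≤ n) {ρ C : ℕ} (hb : IsExBox n (ρ, C)) :
    PipeVisits n D k ((ρ, C), Side.bottom) ↔
      PipeVisits n D k ((ρ + 1, C), exitSide n D (ρ + 1, C) Side.top) := by
  refine pipeVisits_iff h1 h2 hb (fun h => ?_) (fun x hx => ?_) rfl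
  · simp at h
  · have := hx.one_le
    simp only [neighbour, Side.opp, Prod.ext_iff]; omega

theorem pipeVisits_right (h1 : 1 ≤ k) (h2 : k ≤ n) {ρ C : ℕ} (hb : IsExBox n (ρ, C)) :
    PipeVisits n D k ((ρ, C), Side.right) ↔
      PipeVisits n D k ((ρ, C + 1), exitSide n D (ρ, C + 1) Side.left) := by
  refine pipeVisits_iff h1 h2 hb (fun h => ?_) (fun x hx => ?_) rfl
  · simp at h
  · have := hx.one_le
    simp only [neighbour, Side.opp, Prod.ext_iff]; omega

theorem pipeVisits_top (h1 : 1 ≤ k) (h2 : k ≤ n) {ρ C : ℕ} (hb : IsExBox n (ρ + 1, C)) :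
    PipeVisits n D k ((ρ + 1, C), Side.top) ↔
      PipeVisits n D k ((ρ, C), exitSide n D (ρ, C) Side.bottom) := by
  refine pipeVisits_iff h1 h2 hb (fun h => ?_) (fun x hx => ?_) rfl
  · simp at h
  · simp only [neighbour, Side.opp, Prod.ext_iff]; omega

/-- The possible states of a pipe, whose label has the absolute value `k`. -/
inductive GoodState (n k : ℕ) (h e : ℕ → ℕ → ℤ) : (ℕ × ℕ) × Side → Prop
  | oddLeft (a C : ℕ) (ha : 1 ≤ a) (han : a ≤ n) (haC : a ≤ C) (hC : C ≤ n + 1)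
      (hk : |h (2 * a - 1) C| = k) : GoodState n k h e ((2 * a - 1, C), Side.left)
  | oddBottom (a C : ℕ) (ha : 1 ≤ a) (haC : a ≤ C) (hC : C ≤ n)
      (hk : |e (2 * a - 1) C| = k) : GoodState n k h e ((2 * a - 1, C), Side.bottom)
  | evenRight (a C : ℕ) (ha : 1 ≤ a) (haC : a ≤ C) (hC : C ≤ n)
      (hk : |h (2 * a) (C + 1)| = k) : GoodState n k h e ((2 * a, C), Side.right)
  | evenBottom (a C : ℕ) (ha : 1 ≤ a) (haC : a + 1 ≤ C) (hC : C ≤ n)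
      (hk : |e (2 * a) C| = k) : GoodState n k h e ((2 * a, C), Side.bottom)
  | evenTop (a : ℕ) (ha : 1 ≤ a) (han : a ≤ n)
      (hk : |h (2 * a) (n + 1)| = k) : GoodState n k h e ((2 * a, n + 1), Side.top)

variable {h e : ℕ → ℕ → ℤ}

theorem GoodState.up {a C : ℕ} (ha : 1 ≤ a) (haC : a ≤ C) (hC : C ≤ n)
    (hk : |e (2 * a - 2) C| = k) (hb : IsExBox n (2 * a - 1 - 1, C)) :
    GoodState n k h e ((2 * a - 1 - 1, C), Side.bottom) := by
  have := hb.one_le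
  simp only at this
  obtain ⟨b, rfl⟩ : ∃ b, a = b + 1 := ⟨a - 1, by omega⟩
  have h1 : 2 * (b + 1) - 1 - 1 = 2 * b := by omega
  have h2 : 2 * (b + 1) - 2 = 2 * b := by omega
  rw [h2] at hk
  rw [h1]
  exact .evenBottom b C (by omega) (by omega) hC hk

theorem GoodState.left {a C : ℕ} (ha : 1 ≤ a) (hC : C ≤ n)
    (hk : |h (2 * a) C| = k) (hb : IsExBox n (2 * a, C - 1)) :
    GoodState n k h e ((2 * a, C - 1), Side.right) := by
  unfold IsExBox IsGTBox at hb
  simp only at hb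
  have h1 : C - 1 + 1 = C := by omega
  exact .evenRight a (C - 1) ha (by omega) (by omega) (by rw [h1]; exact hk)

/-- Pipes run to the right in odd rows, to the left in even rows, and otherwise upwards; the only
downward step is the turn in column `n + 1`. The absolute value of the label is constant along the
way. -/
theorem GoodState.step (hD : D ⊆ SY n) (hL : IsLabelling n D h e) {x y : (ℕ × ℕ) × Side}
    (hx : GoodState n k h e x) (hxy : PipeStep n D x y) : GoodState n k h e y := by
  obtain ⟨b, t⟩ := y
  obtain ⟨hb, h1, h2⟩ := hxy
  simp only at hb h1 h2
  cases hx with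
  | oddLeft a C ha han haC hC hk =>
    simp only at h1 h2
    rcases hC.eq_or_lt with rfl | hC
    · rw [exitSide_odd_last ha] at h1 h2
      simp only [neighbour, Side.revElbow, Side.opp] at h1 h2
      have h3 : 2 * a - 1 + 1 = 2 * a := by omega
      rw [h1, h2, h3]
      exact .evenTop a ha han (by rw [hL.turn a ha han, abs_neg]; exact hk)
    · have hC' : C ≤ n := by omega
      have hr := hL.odd a C ha haC hC'
      by_cases hd : (a, C) ∈ D
      · rw [(exitSide_odd ha haC hC' _).1 hd] at h1 h2
        simp only [neighbour, Side.opp] at h1 h2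
        rw [h1, h2]
        exact .oddLeft a (C + 1) ha han (by omega) (by omega) (by rw [(hr.1 hd).1]; exact hk)
      · rw [(exitSide_odd ha haC hC' _).2 hd] at h1 h2
        simp only [neighbour, Side.elbow, Side.opp] at h1 h2
        rw [h1] at hb
        rw [h1, h2]
        exact .up ha haC hC' (by rw [(hr.2 hd).2]; exact hk) hb
  | oddBottom a C ha haC hC hk =>
    simp only at h1 h2
    have hr := hL.odd a C ha haC hC
    by_cases hd : (a, C) ∈ D
    · rw [(exitSide_odd ha haC hC _).1 hd] at h1 h2
      simp only [neighbour, Side.opp] at h1 h2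
      rw [h1] at hb
      rw [h1, h2]
      exact .up ha haC hC (by rw [(hr.1 hd).2]; exact hk) hb
    · rw [(exitSide_odd ha haC hC _).2 hd] at h1 h2
      simp only [neighbour, Side.elbow, Side.opp] at h1 h2
      rw [h1, h2]
      exact .oddLeft a (C + 1) ha (by omega) (by omega) (by omega)
        (by rw [(hr.2 hd).1]; exact hk)
  | evenRight a C ha haC hC hk =>
    simp only at h1 h2
    have hr := hL.even a C ha haC hC
    by_cases hd : (a, 2 * n + 1 - C) ∈ D
    · rw [(exitSide_even hD ha haC hC _).1 hd] at h1 h2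
      simp only [neighbour, Side.opp] at h1 h2
      rw [h1] at hb
      rw [h1, h2]
      exact .left ha hC (by rw [(hr.1 hd).1]; exact hk) hb
    · rw [(exitSide_even hD ha haC hC _).2 hd] at h1 h2
      simp only [neighbour, Side.revElbow, Side.opp] at h1 h2
      rw [h1, h2]
      exact .oddBottom a C ha haC hC (by rw [(hr.2 hd).2]; exact hk)
  | evenBottom a C ha haC hC hk =>
    simp only at h1 h2
    have hr := hL.even a C ha (by omega) hC
    by_cases hd : (a, 2 * n + 1 - C) ∈ D
    · rw [(exitSide_even hD ha (by omega) hC _).1 hd] at h1 h2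
      simp only [neighbour, Side.opp] at h1 h2
      rw [h1, h2]
      exact .oddBottom a C ha (by omega) hC (by rw [(hr.1 hd).2]; exact hk)
    · rw [(exitSide_even hD ha (by omega) hC _).2 hd] at h1 h2
      simp only [neighbour, Side.revElbow, Side.opp] at h1 h2
      rw [h1] at hb
      rw [h1, h2]
      exact .left ha hC (by rw [(hr.2 hd).1]; exact hk) hb
  | evenTop a ha han hk =>
    simp only at h1 h2
    rw [exitSide_even_last] at h1 h2
    simp only [neighbour, Side.elbow, Side.opp] at h1 h2
    rw [h1, h2]
    exact .evenRight a n ha han le_rfl hk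

theorem PipeVisits.goodState (hD : D ⊆ SY n) (hL : IsLabelling n D h e) (h1 : 1 ≤ k) (h2 : k ≤ n)
    {x : (ℕ × ℕ) × Side} (hx : PipeVisits n D k x) : GoodState n k h e x := by
  induction hx with
  | refl =>
    refine .oddLeft _ _ (by omega) (by omega) le_rfl (by omega) ?_
    rw [hL.start _ (by omega) (by omega), abs_neg, Nat.cast_sub (by omega)]
    push_cast
    rw [show (n : ℤ) + 1 - (n + 1 - k) = k by ring]
    exact abs_of_nonneg (by positivity)
  | tail _ hs ih => exact ih.step hD hL hs

end Pipe

/-! ### Parity of the number of self-crossings -/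

section Word

/-- The number of pairs of positions in a word with the letter `L` at the first one and `-L` at the
second one, modulo two. -/
def wordInv (L : ℤ) : List ℤ → ZMod 2
  | [] => 0
  | x :: l => (if x = L then (l.count (-L) : ZMod 2) else 0) + wordInv L l

/-- The word has the letters `0`, `L`, `-L`, where `L` and `-L` occur at most once. -/
def Sparse (L : ℤ) (l : List ℤ) : Prop :=
  (∀ x ∈ l, x = 0 ∨ x = L ∨ x = -L) ∧ l.count L ≤ 1 ∧ l.count (-L) ≤ 1

variable {L : ℤ}

theorem Sparse.perm {l l' : List ℤ} (h : Sparse L l) (hp : l.Perm l') : Sparse L l' :=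
  ⟨fun x hx => h.1 x (hp.mem_iff.2 hx), by rw [← hp.count_eq]; exact h.2.1,
    by rw [← hp.count_eq]; exact h.2.2⟩

theorem Sparse.tail {x : ℤ} {l : List ℤ} (h : Sparse L (x :: l)) : Sparse L l :=
  ⟨fun y hy => h.1 y (List.mem_cons_of_mem _ hy),
    (List.count_le_count_cons).trans h.2.1, (List.count_le_count_cons).trans h.2.2⟩

/-- What the first letter contributes depends only on the letter counts of the rest. -/
theorem wordInv_cons_perm {x : ℤ} {l l' : List ℤ} (hp : l.Perm l') :
    wordInv L (x :: l) + wordInv L l' = wordInv L (x :: l') + wordInv L l := by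
  simp only [wordInv, hp.count_eq]; ring

/-- Two nonzero neighbours in a sparse word are `L` and `-L` in some order, so exchanging them
changes the number of inversions by one. Neighbours with a zero among them contribute nothing. -/
theorem wordInv_swap (hL : L ≠ 0) {x y : ℤ} {l : List ℤ} (h : Sparse L (x :: y :: l)) :
    wordInv L (x :: y :: l) = wordInv L (y :: x :: l) + if x ≠ 0 ∧ y ≠ 0 then 1 else 0 := by
  obtain ⟨h1, h2, h3⟩ := h
  have hx := h1 x (by simp)
  have hy := h1 y (by simp)
  have hLn : L ≠ -L := by omega
  simp only [wordInv]
  have two : (1 : ZMod 2) + 1 = 0 := rfl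
  rcases hx with rfl | rfl | rfl <;> rcases hy with rfl | rfl | rfl
  · simp
  · simp [hL, Ne.symm hL]
  · simp [hL, Ne.symm hL, hLn.symm]
  · simp [hL, Ne.symm hL]
  · simp at h2
  · simp [hL, hLn.symm]; ring
  · simp [hL, Ne.symm hL, hLn.symm]
  · simp [hL, hLn.symm]
    linear_combination -two
  · simp at h3

theorem wordInv_concat {x : ℤ} {l : List ℤ} :
    wordInv L (l ++ [x]) = wordInv L l + if x = -L then (l.count L : ZMod 2) else 0 := by
  induction l with
  | nil => simp [wordInv]
  | cons y l ih =>
    simp only [List.cons_append, wordInv, ih, List.count_append, List.count_cons, List.count_nil]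
    by_cases h1 : y = L <;> by_cases h2 : x = -L <;> (simp [h1, h2]; try ring)

theorem wordInv_eq_zero {l : List ℤ} (h : L ∉ l) : wordInv L l = 0 := by
  induction l with
  | nil => rfl
  | cons y l ih =>
    rw [List.mem_cons, not_or] at h
    rw [wordInv, ih h.2, if_neg (Ne.symm h.1), add_zero]

theorem wordInv_eq_zero' {l : List ℤ} (h : -L ∉ l) : wordInv L l = 0 := by
  induction l with
  | nil => rfl
  | cons y l ih =>
    rw [List.mem_cons, not_or] at h
    rw [wordInv, ih h.2, List.count_eq_zero_of_not_mem h.2]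
    simp

open Classical in
/-- A horizontal edge moving to the left through a row of boxes. -/
theorem scan_left (hL : L ≠ 0) {X : ℕ → Prop} {h v o : ℕ → ℤ} (m : ℕ) :
    ∀ c : ℕ, (∀ C, c ≤ C → C < c + m → BoxRule (X C) (h (C + 1)) (v C) (h C) (o C)) →
    ((List.range' c m).map v ++ [h (c + m)]).Perm (h c :: (List.range' c m).map o) ∧
    (Sparse L ((List.range' c m).map v ++ [h (c + m)]) →
      wordInv L ((List.range' c m).map v ++ [h (c + m)]) =
        wordInv L (h c :: (List.range' c m).map o) +
        ∑ C ∈ Finset.Ico c (c + m), if X C ∧ h (C + 1) ≠ 0 ∧ v C ≠ 0 then 1 else 0) := by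
  induction m with
  | zero => intro c _; simp
  | succ m ih =>
    intro c hr
    obtain ⟨hp, hw⟩ := ih (c + 1) fun C h1 h2 => hr C (by omega) (by omega)
    have hcm : c + 1 + m = c + (m + 1) := by omega
    rw [hcm] at hp hw
    rw [List.range'_succ, List.map_cons, List.map_cons, List.cons_append]
    set V := (List.range' (c + 1) m).map v ++ [h (c + (m + 1))]
    set O := (List.range' (c + 1) m).map o
    rw [Finset.sum_eq_sum_Ico_succ_bot (by omega)]
    have hb := hr c le_rfl (by omega)
    have hp1 : (v c :: V).Perm (v c :: h (c + 1) :: O) := hp.cons _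
    have hw1 : Sparse L (v c :: V) → wordInv L (v c :: V) = wordInv L (v c :: h (c + 1) :: O) +
        ∑ C ∈ Finset.Ico (c + 1) (c + (m + 1)), if X C ∧ h (C + 1) ≠ 0 ∧ v C ≠ 0 then 1 else 0 := by
      intro hs
      have e1 := wordInv_cons_perm (L := L) (x := v c) hp
      have e2 := hw hs.tail
      linear_combination e1 + e2
    -- The word is read along a frontier. Moving it past the box replaces the neighbouring letters
    -- `v c, h (c + 1)` by `h c, o c`, which is an exchange at a crossing and no change at an elbow.
    by_cases hX : X c
    · obtain ⟨h1, h2⟩ := hb.1 hX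
      rw [h1, h2]
      refine ⟨hp1.trans (List.Perm.swap _ _ _), fun hs => ?_⟩
      rw [hw1 hs, wordInv_swap hL (hs.perm hp1)]
      simp only [hX, true_and, and_comm (a := v c ≠ 0)]
      ring
    · obtain ⟨h1, h2⟩ := hb.2 hX
      rw [h1, h2]
      refine ⟨hp1, fun hs => ?_⟩
      rw [hw1 hs, if_neg (by tauto), zero_add]

open Classical in
/-- A horizontal edge moving to the right through a row of boxes. -/
theorem scan_right (hL : L ≠ 0) {X : ℕ → Prop} {h v o : ℕ → ℤ} (m : ℕ) :
    ∀ c : ℕ, (∀ C, c ≤ C → C < c + m → BoxRule (X C) (h C) (v C) (h (C + 1)) (o C)) →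
    (h c :: (List.range' c m).map v).Perm ((List.range' c m).map o ++ [h (c + m)]) ∧
    (Sparse L (h c :: (List.range' c m).map v) →
      wordInv L (h c :: (List.range' c m).map v) =
        wordInv L ((List.range' c m).map o ++ [h (c + m)]) +
        ∑ C ∈ Finset.Ico c (c + m), if X C ∧ h C ≠ 0 ∧ v C ≠ 0 then 1 else 0) := by
  induction m with
  | zero => intro c _; simp
  | succ m ih =>
    intro c hr
    obtain ⟨hp, hw⟩ := ih (c + 1) fun C h1 h2 => hr C (by omega) (by omega)
    have hcm : c + 1 + m = c + (m + 1) := by omega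
    rw [hcm] at hp hw
    rw [List.range'_succ, List.map_cons, List.map_cons, List.cons_append]
    set V := (List.range' (c + 1) m).map v
    set O := (List.range' (c + 1) m).map o ++ [h (c + (m + 1))]
    rw [Finset.sum_eq_sum_Ico_succ_bot (by omega)]
    have hb := hr c le_rfl (by omega)
    have hp1 : (o c :: h (c + 1) :: V).Perm (o c :: O) := hp.cons _
    have hw1 : Sparse L (o c :: h (c + 1) :: V) →
        wordInv L (o c :: h (c + 1) :: V) = wordInv L (o c :: O) +
        ∑ C ∈ Finset.Ico (c + 1) (c + (m + 1)), if X C ∧ h C ≠ 0 ∧ v C ≠ 0 then 1 else 0 := by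
      intro hs
      have e1 := wordInv_cons_perm (L := L) (x := o c) hp
      have e2 := hw hs.tail
      linear_combination e1 + e2
    by_cases hX : X c
    · obtain ⟨h1, h2⟩ := hb.1 hX
      rw [h1, h2] at hp1 hw1
      rw [h2]
      refine ⟨(List.Perm.swap _ _ _).trans hp1, fun hs => ?_⟩
      have hs' : Sparse L (v c :: h c :: V) := hs.perm (List.Perm.swap _ _ _)
      rw [wordInv_swap hL hs, hw1 hs']
      simp only [hX, true_and]
      ring
    · obtain ⟨h1, h2⟩ := hb.2 hX
      rw [h1, h2] at hp1 hw1
      rw [h2]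
      refine ⟨hp1, fun hs => ?_⟩
      rw [hw1 hs, if_neg (by tauto), zero_add]

/-- The letter `L` occurs exactly once in the word, and all other letters are `0`. -/
def Single (L : ℤ) (l : List ℤ) : Prop := (∀ x ∈ l, x = 0 ∨ x = L) ∧ l.count L = 1

/-- The labels of a pipe below and above a pair of rows. -/
theorem single_step (hL : L ≠ 0) {U T : List ℤ} {z : ℤ} (hU : Single L U)
    (hz : z = 0 ∨ z = L ∨ z = -L) (hp : (U ++ [z]).Perm (T ++ [-z])) :
    Sparse L (U ++ [z]) ∧
    ((z = 0 ∧ Single L T ∧ wordInv L (U ++ [z]) = wordInv L (T ++ [-z])) ∨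
    (z = -L ∧ Single (-L) T ∧ wordInv L (U ++ [z]) = wordInv L (T ++ [-z]) + 1)) := by
  have hLn : L ≠ -L := by omega
  have hnU : -L ∉ U := fun h => by rcases hU.1 _ h with h | h <;> omega
  have hn0 : U.count (-L) = 0 := List.count_eq_zero_of_not_mem hnU
  have hc1 := hp.count_eq L
  have hc2 := hp.count_eq (-L)
  rw [List.count_append, List.count_append, hU.2] at hc1
  rw [List.count_append, List.count_append, hn0] at hc2
  have hT : ∀ x ∈ T, x = 0 ∨ x = L ∨ x = z := fun x hx => by
    have := hp.mem_iff.2 (List.mem_append_left [-z] hx)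
    rw [List.mem_append, List.mem_singleton] at this
    rcases this with h | h
    · rcases hU.1 x h with h | h <;> tauto
    · tauto
  -- The case `z = L` is impossible, since `-L` would occur above but not below. For `z = -L` the
  -- word below has `L` before `-L`, one inversion, while above `-L` comes before `L`, none; hence
  -- the extra `1`.
  rcases hz with rfl | rfl | rfl
  · have hc1' : T.count L = 1 := by simpa [hL, Ne.symm hL] using hc1.symm
    have hnT : -L ∉ T := fun h => by rcases hT _ h with h | h | h <;> omega
    refine ⟨⟨fun x hx => ?_, ?_, ?_⟩, Or.inl ⟨rfl, ⟨fun x hx => ?_, hc1'⟩, ?_⟩⟩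
    · rw [List.mem_append, List.mem_singleton] at hx
      rcases hx with h | h
      · rcases hU.1 x h with h | h <;> tauto
      · tauto
    · rw [List.count_append, hU.2]; simp [Ne.symm hL]
    · rw [List.count_append, hn0, zero_add]; exact List.count_le_length
    · have := hT x hx; tauto
    · rw [wordInv_eq_zero', wordInv_eq_zero']
      · rw [List.mem_append, List.mem_singleton]; rintro (h | h)
        · exact hnT h
        · omega
      · rw [List.mem_append, List.mem_singleton]; rintro (h | h)
        · exact hnU h
        · omega
  · exfalso
    simp [hLn] at hc2
  · rw [neg_neg] at hc1 hc2 ⊢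
    have hc1' : T.count L = 0 := by simpa [hLn, hLn.symm] using hc1.symm
    have hc2' : T.count (-L) = 1 := by simpa [hLn, hLn.symm] using hc2.symm
    have hLT : L ∉ T := List.count_eq_zero.1 hc1'
    refine ⟨⟨fun x hx => ?_, ?_, ?_⟩, Or.inr ⟨rfl, ⟨fun x hx => ?_, hc2'⟩, ?_⟩⟩
    · rw [List.mem_append, List.mem_singleton] at hx
      rcases hx with h | h
      · rcases hU.1 x h with h | h <;> tauto
      · tauto
    · rw [List.count_append, hU.2]; simp [hLn.symm]
    · rw [List.count_append, hn0]; simp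
    · rcases hT x hx with h | h | h
      · exact Or.inl h
      · exact absurd (h ▸ hx) hLT
      · exact Or.inr h
    · rw [wordInv_concat, wordInv_concat, if_pos rfl, if_neg hLn, wordInv_eq_zero' hnU,
        wordInv_eq_zero hLT, hU.2]
      simp

theorem zero_step (hL : L ≠ 0) {U T : List ℤ} {z : ℤ} (hU : ∀ x ∈ U, x = 0)
    (hz : z = 0 ∨ z = L ∨ z = -L) (hp : (U ++ [z]).Perm (T ++ [-z])) :
    Sparse L (U ++ [z]) ∧ (∀ x ∈ T, x = 0) ∧
      wordInv L (U ++ [z]) = wordInv L (T ++ [-z]) := by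
  have h0 : z = 0 := by
    have : -z ∈ U ++ [z] := hp.mem_iff.2 (by simp)
    rw [List.mem_append, List.mem_singleton] at this
    rcases this with h | h
    · have := hU _ h; omega
    · omega
  subst h0
  have hU' : ∀ x ∈ U ++ [0], x = 0 := fun x hx => by
    rw [List.mem_append, List.mem_singleton] at hx
    rcases hx with h | h
    · exact hU x h
    · exact h
  have hT' : ∀ x ∈ T ++ [-0], x = 0 := fun x hx => hU' x (hp.mem_iff.2 hx)
  refine ⟨⟨fun x hx => Or.inl (hU' x hx), ?_, ?_⟩, fun x hx => hT' x (by simp [hx]), ?_⟩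
  · rw [List.count_eq_zero_of_not_mem fun h => hL (hU' _ h)]; omega
  · rw [List.count_eq_zero_of_not_mem fun h => hL (by have := hU' _ h; omega)]; omega
  · rw [wordInv_eq_zero fun h => hL (hU' _ h), wordInv_eq_zero fun h => hL (hT' _ h)]

end Word

/-! ### The labels of a single pipe -/

section Mask

variable {n k : ℕ} {D : Finset (ℕ × ℕ)} {h e : ℕ → ℕ → ℤ}

/-- The pipe `ℓ_k` runs through the left side of the box `(ρ, C)`. -/
def VH (n : ℕ) (D : Finset (ℕ × ℕ)) (k ρ C : ℕ) : Prop :=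
  if ρ % 2 = 1 then PipeVisits n D k ((ρ, C), Side.left)
  else PipeVisits n D k ((ρ, C - 1), Side.right)

/-- The pipe `ℓ_k` runs through the bottom side of the box `(ρ, C)`. -/
def VE (n : ℕ) (D : Finset (ℕ × ℕ)) (k ρ C : ℕ) : Prop :=
  if ρ = 0 then PipeVisits n D k ((1, C), exitSide n D (1, C) Side.top)
  else PipeVisits n D k ((ρ, C), Side.bottom)

theorem VH_odd {a C : ℕ} (ha : 1 ≤ a) :
    VH n D k (2 * a - 1) C ↔ PipeVisits n D k ((2 * a - 1, C), Side.left) := by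
  rw [VH, if_pos (by omega)]

theorem VH_even {a C : ℕ} :
    VH n D k (2 * a) (C + 1) ↔ PipeVisits n D k ((2 * a, C), Side.right) := by
  rw [VH, if_neg (by omega), Nat.add_sub_cancel]

theorem VE_of_pos {ρ C : ℕ} (hρ : 1 ≤ ρ) :
    VE n D k ρ C ↔ PipeVisits n D k ((ρ, C), Side.bottom) := by
  rw [VE, if_neg (by omega)]

theorem VE_up (h1 : 1 ≤ k) (h2 : k ≤ n) {a C : ℕ} (ha : 1 ≤ a) (haC : a ≤ C) (hC : C ≤ n) :
    VE n D k (2 * a - 2) C ↔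
      PipeVisits n D k ((2 * a - 1, C), exitSide n D (2 * a - 1, C) Side.top) := by
  rcases ha.eq_or_lt with rfl | ha
  · rfl
  · obtain ⟨b, rfl⟩ : ∃ b, a = b + 1 := ⟨a - 1, by omega⟩
    rw [VE_of_pos (by omega)]
    have e1 : 2 * (b + 1) - 2 = 2 * b := by omega
    have e2 : 2 * (b + 1) - 1 = 2 * b + 1 := by omega
    rw [e1, e2]
    exact pipeVisits_bottom h1 h2 (isExBox_even (by omega) (by omega) (by omega) (by omega))

theorem VH_VE_odd (h1 : 1 ≤ k) (h2 : k ≤ n) {a C : ℕ} (ha : 1 ≤ a) (haC : a ≤ C) (hC : C ≤ n) :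
    ((a, C) ∈ D → (VH n D k (2 * a - 1) (C + 1) ↔ VH n D k (2 * a - 1) C) ∧
      (VE n D k (2 * a - 2) C ↔ VE n D k (2 * a - 1) C)) ∧
    ((a, C) ∉ D → (VH n D k (2 * a - 1) (C + 1) ↔ VE n D k (2 * a - 1) C) ∧
      (VE n D k (2 * a - 2) C ↔ VH n D k (2 * a - 1) C)) := by
  rw [VH_odd ha, VH_odd ha, VE_up h1 h2 ha haC hC, VE_of_pos (by omega),
    pipeVisits_left h1 h2 (isExBox_odd ha (by omega) (by omega) (by omega)) (by omega)]
  refine ⟨fun hd => ?_, fun hd => ?_⟩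
  · rw [(exitSide_odd ha haC hC _).1 hd, (exitSide_odd ha haC hC _).1 hd]
    exact ⟨Iff.rfl, Iff.rfl⟩
  · rw [(exitSide_odd ha haC hC _).2 hd, (exitSide_odd ha haC hC _).2 hd]
    exact ⟨Iff.rfl, Iff.rfl⟩

theorem VE_odd_iff (h1 : 1 ≤ k) (h2 : k ≤ n) {a C : ℕ} (ha : 1 ≤ a) (haC : a ≤ C) (hC : C ≤ n) :
    VE n D k (2 * a - 1) C ↔ PipeVisits n D k ((2 * a, C), exitSide n D (2 * a, C) Side.top) := by
  rw [VE_of_pos (by omega), pipeVisits_bottom h1 h2 (isExBox_odd ha haC (by omega) (by omega))]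
  have e1 : 2 * a - 1 + 1 = 2 * a := by omega
  rw [e1]

theorem VH_VE_even (hD : D ⊆ SY n) (h1 : 1 ≤ k) (h2 : k ≤ n) {a C : ℕ} (ha : 1 ≤ a)
    (haC : a + 1 ≤ C) (hC : C ≤ n) :
    ((a, 2 * n + 1 - C) ∈ D → (VH n D k (2 * a) C ↔ VH n D k (2 * a) (C + 1)) ∧
      (VE n D k (2 * a - 1) C ↔ VE n D k (2 * a) C)) ∧
    ((a, 2 * n + 1 - C) ∉ D → (VH n D k (2 * a) C ↔ VE n D k (2 * a) C) ∧
      (VE n D k (2 * a - 1) C ↔ VH n D k (2 * a) (C + 1))) := by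
  obtain ⟨c, rfl⟩ : ∃ c, C = c + 1 := ⟨C - 1, by omega⟩
  rw [VH_even, VH_even, VE_odd_iff h1 h2 ha (by omega) hC, VE_of_pos (by omega),
    pipeVisits_right h1 h2 (isExBox_even ha (by omega) (by omega) (by omega))]
  refine ⟨fun hd => ?_, fun hd => ?_⟩
  · rw [(exitSide_even hD ha (by omega) hC _).1 hd, (exitSide_even hD ha (by omega) hC _).1 hd]
    exact ⟨Iff.rfl, Iff.rfl⟩
  · rw [(exitSide_even hD ha (by omega) hC _).2 hd, (exitSide_even hD ha (by omega) hC _).2 hd]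
    exact ⟨Iff.rfl, Iff.rfl⟩

/-- The additional boxes `(2a, a)` are therefore never crossings: a pipe arriving there from the
right leaves through the top. -/
theorem notMem_of_end (hD : D ⊆ SY n) {a : ℕ} : (a, 2 * n + 1 - a) ∉ D := fun hd => by
  have := mem_SY.1 (hD hd)
  omega

theorem VE_end (hD : D ⊆ SY n) (h1 : 1 ≤ k) (h2 : k ≤ n) {a : ℕ} (ha : 1 ≤ a) (han : a ≤ n) :
    VE n D k (2 * a - 1) a ↔ VH n D k (2 * a) (a + 1) := by
  rw [VE_odd_iff h1 h2 ha le_rfl han, (exitSide_even hD ha le_rfl han _).2 (notMem_of_end hD),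
    VH_even]
  rfl

theorem VH_turn (h1 : 1 ≤ k) (h2 : k ≤ n) {a : ℕ} (ha : 1 ≤ a) (han : a ≤ n) :
    VH n D k (2 * a) (n + 1) ↔ VH n D k (2 * a - 1) (n + 1) := by
  rw [VH_even, VH_odd ha, pipeVisits_right h1 h2 (isExBox_even ha han (by omega) han),
    exitSide_even_last]
  have e1 : 2 * a = 2 * a - 1 + 1 := by omega
  have hb : IsExBox n (2 * a - 1 + 1, n + 1) := by
    rw [← e1]; exact isExBox_even ha (by omega) le_rfl han
  have := pipeVisits_top (D := D) h1 h2 hb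
  rw [← e1, exitSide_odd_last ha] at this
  exact this

theorem VH_start (h1 : 1 ≤ k) (h2 : k ≤ n) {a : ℕ} (ha : 1 ≤ a) (han : a ≤ n) :
    VH n D k (2 * a - 1) a ↔ a = n + 1 - k := by
  rw [VH_odd ha]
  constructor
  · intro hv
    by_contra hne
    obtain ⟨c, rfl⟩ : ∃ c, a = c + 1 := ⟨a - 1, by omega⟩
    rw [pipeVisits_left h1 h2 (isExBox_odd ha le_rfl (by omega) han) (by omega)] at hv
    have := hv.isExBox h1 h2
    unfold IsExBox IsGTBox at this
    simp only at this
    omega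
  · rintro rfl
    exact Relation.ReflTransGen.refl

open Classical in
/-- The labels on the left sides of the boxes belonging to the pipe `ℓ_k`. -/
noncomputable def hm (n : ℕ) (D : Finset (ℕ × ℕ)) (k : ℕ) (h : ℕ → ℕ → ℤ) (ρ C : ℕ) : ℤ :=
  if VH n D k ρ C then h ρ C else 0

open Classical in
/-- The labels on the bottom sides of the boxes belonging to the pipe `ℓ_k`. -/
noncomputable def em (n : ℕ) (D : Finset (ℕ × ℕ)) (k : ℕ) (e : ℕ → ℕ → ℤ) (ρ C : ℕ) : ℤ :=
  if VE n D k ρ C then e ρ C else 0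

theorem boxRule_odd (hL : IsLabelling n D h e) (h1 : 1 ≤ k) (h2 : k ≤ n) {a C : ℕ}
    (ha : 1 ≤ a) (haC : a ≤ C) (hC : C ≤ n) :
    BoxRule ((a, C) ∈ D) (hm n D k h (2 * a - 1) C) (em n D k e (2 * a - 1) C)
      (hm n D k h (2 * a - 1) (C + 1)) (em n D k e (2 * a - 2) C) := by
  have hr := hL.odd a C ha haC hC
  have hv := VH_VE_odd (D := D) h1 h2 ha haC hC
  classical
  unfold hm em
  refine ⟨fun hd => ?_, fun hd => ?_⟩
  · rw [(hr.1 hd).1, (hr.1 hd).2]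
    exact ⟨if_congr (hv.1 hd).1 rfl rfl, if_congr (hv.1 hd).2 rfl rfl⟩
  · rw [(hr.2 hd).1, (hr.2 hd).2]
    exact ⟨if_congr (hv.2 hd).1 rfl rfl, if_congr (hv.2 hd).2 rfl rfl⟩

theorem boxRule_even (hD : D ⊆ SY n) (hL : IsLabelling n D h e) (h1 : 1 ≤ k) (h2 : k ≤ n)
    {a C : ℕ} (ha : 1 ≤ a) (haC : a + 1 ≤ C) (hC : C ≤ n) :
    BoxRule ((a, 2 * n + 1 - C) ∈ D) (hm n D k h (2 * a) (C + 1)) (em n D k e (2 * a) C)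
      (hm n D k h (2 * a) C) (em n D k e (2 * a - 1) C) := by
  have hr := hL.even a C ha (by omega) hC
  have hv := VH_VE_even (D := D) hD h1 h2 ha haC hC
  classical
  unfold hm em
  refine ⟨fun hd => ?_, fun hd => ?_⟩
  · rw [(hr.1 hd).1, (hr.1 hd).2]
    exact ⟨if_congr (hv.1 hd).1 rfl rfl, if_congr (hv.1 hd).2 rfl rfl⟩
  · rw [(hr.2 hd).1, (hr.2 hd).2]
    exact ⟨if_congr (hv.2 hd).1 rfl rfl, if_congr (hv.2 hd).2 rfl rfl⟩

theorem em_end (hD : D ⊆ SY n) (hL : IsLabelling n D h e) (h1 : 1 ≤ k) (h2 : k ≤ n) {a : ℕ}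
    (ha : 1 ≤ a) (han : a ≤ n) :
    em n D k e (2 * a - 1) a = hm n D k h (2 * a) (a + 1) := by
  classical
  unfold hm em
  rw [((hL.even a a ha le_rfl han).2 (notMem_of_end hD)).2]
  exact if_congr (VE_end hD h1 h2 ha han) rfl rfl

theorem hm_turn (hL : IsLabelling n D h e) (h1 : 1 ≤ k) (h2 : k ≤ n) {a : ℕ}
    (ha : 1 ≤ a) (han : a ≤ n) :
    hm n D k h (2 * a - 1) (n + 1) = -hm n D k h (2 * a) (n + 1) := by
  unfold hm
  rw [hL.turn a ha han]
  by_cases hv : VH n D k (2 * a) (n + 1)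
  · rw [if_pos hv, if_pos ((VH_turn h1 h2 ha han).1 hv), neg_neg]
  · rw [if_neg hv, if_neg (fun hv' => hv ((VH_turn h1 h2 ha han).2 hv')), neg_zero]

theorem hm_start (hL : IsLabelling n D h e) (h1 : 1 ≤ k) (h2 : k ≤ n) {a : ℕ}
    (ha : 1 ≤ a) (han : a ≤ n) :
    hm n D k h (2 * a - 1) a = if a = n + 1 - k then -(k : ℤ) else 0 := by
  unfold hm
  rw [hL.start a ha han]
  by_cases hv : a = n + 1 - k
  · rw [if_pos hv, if_pos ((VH_start h1 h2 ha han).2 hv)]; omega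
  · rw [if_neg hv, if_neg (fun hv' => hv ((VH_start h1 h2 ha han).1 hv'))]

theorem GoodState.abs_left {ρ C : ℕ} (hg : GoodState n k h e ((ρ, C), Side.left)) :
    |h ρ C| = k := by
  generalize hx : ((ρ, C), Side.left) = x at hg
  cases hg <;> simp only [Prod.mk.injEq, reduceCtorEq, and_false, and_true] at hx
  obtain ⟨rfl, rfl⟩ := hx
  assumption

theorem GoodState.abs_right {ρ C : ℕ} (hg : GoodState n k h e ((ρ, C), Side.right)) :
    ρ % 2 = 0 ∧ |h ρ (C + 1)| = k := by
  generalize hx : ((ρ, C), Side.right) = x at hg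
  cases hg <;> simp only [Prod.mk.injEq, reduceCtorEq, and_false, and_true] at hx
  obtain ⟨rfl, rfl⟩ := hx
  exact ⟨by omega, by assumption⟩

theorem GoodState.odd_of_left {ρ C : ℕ} (hg : GoodState n k h e ((ρ, C), Side.left)) :
    ρ % 2 = 1 := by
  generalize hx : ((ρ, C), Side.left) = x at hg
  cases hg <;> simp only [Prod.mk.injEq, reduceCtorEq, and_false, and_true] at hx
  omega

theorem GoodState.abs_bottom {ρ C : ℕ} (hg : GoodState n k h e ((ρ, C), Side.bottom)) :
    |e ρ C| = k ∧ (ρ % 2 = 0 → ρ + 2 ≤ 2 * C) := by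
  generalize hx : ((ρ, C), Side.bottom) = x at hg
  cases hg <;> simp only [Prod.mk.injEq, reduceCtorEq, and_false, and_true] at hx
  all_goals
    obtain ⟨rfl, rfl⟩ := hx
    exact ⟨by assumption, by omega⟩

theorem GoodState.not_top {ρ C : ℕ} (hC : C ≤ n) (hg : GoodState n k h e ((ρ, C), Side.top)) :
    False := by
  generalize hx : ((ρ, C), Side.top) = x at hg
  cases hg <;> simp only [Prod.mk.injEq, reduceCtorEq, and_false, and_true] at hx
  omega

theorem hm_even_cases (hD : D ⊆ SY n) (hL : IsLabelling n D h e) (h1 : 1 ≤ k) (h2 : k ≤ n)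
    {a C : ℕ} : hm n D k h (2 * a) (C + 1) = 0 ∨ |hm n D k h (2 * a) (C + 1)| = k := by
  unfold hm
  split_ifs with hv
  · rw [VH_even] at hv
    exact Or.inr (hv.goodState hD hL h1 h2).abs_right.2
  · exact Or.inl rfl

theorem hm_odd_ne_zero (hD : D ⊆ SY n) (hL : IsLabelling n D h e) (h1 : 1 ≤ k) (h2 : k ≤ n)
    {a C : ℕ} (ha : 1 ≤ a) :
    hm n D k h (2 * a - 1) C ≠ 0 ↔ PipeVisits n D k ((2 * a - 1, C), Side.left) := by
  unfold hm
  split_ifs with hv <;> rw [VH_odd ha] at hv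
  · have := (hv.goodState hD hL h1 h2).abs_left
    simp only [hv, iff_true]
    rintro h0
    rw [h0, abs_zero] at this
    omega
  · simp [hv]

theorem hm_even_ne_zero (hD : D ⊆ SY n) (hL : IsLabelling n D h e) (h1 : 1 ≤ k) (h2 : k ≤ n)
    {a C : ℕ} :
    hm n D k h (2 * a) (C + 1) ≠ 0 ↔ PipeVisits n D k ((2 * a, C), Side.right) := by
  unfold hm
  split_ifs with hv <;> rw [VH_even] at hv
  · have := (hv.goodState hD hL h1 h2).abs_right.2
    simp only [hv, iff_true]
    rintro h0
    rw [h0, abs_zero] at this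
    omega
  · simp [hv]

theorem em_ne_zero (hD : D ⊆ SY n) (hL : IsLabelling n D h e) (h1 : 1 ≤ k) (h2 : k ≤ n)
    {ρ C : ℕ} (hρ : 1 ≤ ρ) :
    em n D k e ρ C ≠ 0 ↔ PipeVisits n D k ((ρ, C), Side.bottom) := by
  unfold em
  split_ifs with hv <;> rw [VE_of_pos hρ] at hv
  · have := (hv.goodState hD hL h1 h2).abs_bottom.1
    simp only [hv, iff_true]
    rintro h0
    rw [h0, abs_zero] at this
    omega
  · simp [hv]

/-- The labels of the pipe `ℓ_k` below row `2 a`. -/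
noncomputable def levelWord (n : ℕ) (D : Finset (ℕ × ℕ)) (k : ℕ) (e : ℕ → ℕ → ℤ) (a : ℕ) :
    List ℤ :=
  (List.range' (a + 1) (n - a)).map (em n D k e (2 * a))

open Classical in
/-- The columns of the self-crossings of the pipe `ℓ_k` in row `2 a - 1`. -/
noncomputable def oddSelf (n : ℕ) (D : Finset (ℕ × ℕ)) (k : ℕ) (h e : ℕ → ℕ → ℤ) (a : ℕ) :
    Finset ℕ :=
  (Finset.Ico a (n + 1)).filter fun C => (a, C) ∈ D ∧ hm n D k h (2 * a - 1) C ≠ 0 ∧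
    em n D k e (2 * a - 1) C ≠ 0

open Classical in
/-- The columns of the self-crossings of the pipe `ℓ_k` in row `2 a`. -/
noncomputable def evenSelf (n : ℕ) (D : Finset (ℕ × ℕ)) (k : ℕ) (h e : ℕ → ℕ → ℤ) (a : ℕ) :
    Finset ℕ :=
  (Finset.Ico (a + 1) (n + 1)).filter fun C => (a, 2 * n + 1 - C) ∈ D ∧
    hm n D k h (2 * a) (C + 1) ≠ 0 ∧ em n D k e (2 * a) C ≠ 0

/-- The frontier sweeps row `2a` from right to left and then row `2a - 1` from left to right. In
between, the letter that leaves row `2a` on the left reenters at the first box of row `2a - 1`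
(`em_end`), and the turn in column `n + 1` identifies the two end letters up to sign. Each exchange
of two nonzero letters is a self-crossing. -/
theorem row_step (hD : D ⊆ SY n) (hL : IsLabelling n D h e) (h1 : 1 ≤ k) (h2 : k ≤ n) {a : ℕ}
    (ha : 1 ≤ a) (han : a ≤ n) {L : ℤ} (hL0 : L ≠ 0) :
    (((hm n D k h (2 * a - 1) a :: levelWord n D k e a) ++ [hm n D k h (2 * a) (n + 1)]).Perm
      (levelWord n D k e (a - 1) ++ [-hm n D k h (2 * a) (n + 1)])) ∧
    (Sparse L ((hm n D k h (2 * a - 1) a :: levelWord n D k e a) ++ [hm n D k h (2 * a) (n + 1)]) →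
      wordInv L ((hm n D k h (2 * a - 1) a :: levelWord n D k e a) ++
        [hm n D k h (2 * a) (n + 1)]) =
      wordInv L (levelWord n D k e (a - 1) ++ [-hm n D k h (2 * a) (n + 1)]) +
        ((oddSelf n D k h e a).card + (evenSelf n D k h e a).card : ℕ)) := by
  classical
  obtain ⟨hp1, hw1⟩ := scan_left hL0 (X := fun C => (a, 2 * n + 1 - C) ∈ D)
    (h := hm n D k h (2 * a)) (v := em n D k e (2 * a)) (o := em n D k e (2 * a - 1)) (n - a)
    (a + 1) fun C hC1 hC2 => boxRule_even hD hL h1 h2 ha hC1 (by omega)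
  obtain ⟨hp2, hw2⟩ := scan_right hL0 (X := fun C => (a, C) ∈ D)
    (h := hm n D k h (2 * a - 1)) (v := em n D k e (2 * a - 1)) (o := em n D k e (2 * a - 2))
    (n - a + 1) a fun C hC1 hC2 => boxRule_odd hL h1 h2 ha hC1 (by omega)
  have e1 : a + 1 + (n - a) = n + 1 := by omega
  have e2 : a + (n - a + 1) = n + 1 := by omega
  have e3 : levelWord n D k e (a - 1) =
      (List.range' a (n - a + 1)).map (em n D k e (2 * a - 2)) := by
    rw [levelWord]
    congr 2 <;> omega
  have e4 : (List.range' a (n - a + 1)).map (em n D k e (2 * a - 1)) =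
      hm n D k h (2 * a) (a + 1) :: (List.range' (a + 1) (n - a)).map (em n D k e (2 * a - 1)) := by
    rw [List.range'_succ, List.map_cons, em_end hD hL h1 h2 ha han]
  rw [e1] at hp1 hw1
  rw [e2, hm_turn hL h1 h2 ha han, ← e3, e4] at hp2 hw2
  have s1 : ∑ C ∈ Finset.Ico (a + 1) (n + 1), (if (a, 2 * n + 1 - C) ∈ D ∧
      hm n D k h (2 * a) (C + 1) ≠ 0 ∧ em n D k e (2 * a) C ≠ 0 then (1 : ZMod 2) else 0) =
      ((evenSelf n D k h e a).card : ZMod 2) := by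
    rw [evenSelf, ← Finset.sum_boole]
  have s2 : ∑ C ∈ Finset.Ico a (n + 1), (if (a, C) ∈ D ∧ hm n D k h (2 * a - 1) C ≠ 0 ∧
      em n D k e (2 * a - 1) C ≠ 0 then (1 : ZMod 2) else 0) =
      ((oddSelf n D k h e a).card : ZMod 2) := by
    rw [oddSelf, ← Finset.sum_boole]
  change (levelWord n D k e a ++ _).Perm _ at hp1
  change Sparse L (levelWord n D k e a ++ _) → wordInv L (levelWord n D k e a ++ _) = _ at hw1
  rw [List.cons_append]
  have hp3 := hp1.cons (hm n D k h (2 * a - 1) a)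
  refine ⟨hp3.trans hp2, fun hs => ?_⟩
  have c1 := wordInv_cons_perm (L := L) (x := hm n D k h (2 * a - 1) a) hp1
  have c2 := (hw1 hs.tail).trans (congrArg (_ + ·) ((Finset.sum_congr rfl
    fun C _ => by congr).trans s1))
  have c3 := (hw2 (hs.perm hp3)).trans (congrArg (_ + ·) ((Finset.sum_congr rfl
    fun C _ => by congr).trans s2))
  push_cast
  linear_combination c1 + c2 + c3

/-- The number of self-crossings of the pipe `ℓ_k` below row `2 a`. -/
noncomputable def selfBelow (n : ℕ) (D : Finset (ℕ × ℕ)) (k : ℕ) (h e : ℕ → ℕ → ℤ) (a : ℕ) : ℕ :=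
  ∑ b ∈ Finset.Ioc a n, ((oddSelf n D k h e b).card + (evenSelf n D k h e b).card)

/-- Induction from the bottom level upwards. Below its start the pipe is absent; above it, the pipe
meets every level exactly once. Its sign changes only at a turn, and by `single_step` this happens
exactly when the current pair of rows has an odd number of self-crossings. The sweep yields only
parities, hence `Even` in the first part. -/
theorem levelWord_spec (hD : D ⊆ SY n) (hL : IsLabelling n D h e) (h1 : 1 ≤ k) (h2 : k ≤ n)
    (d : ℕ) : ∀ a, a + d = n →
    (n + 1 - k ≤ a → (∀ x ∈ levelWord n D k e a, x = 0) ∧ Even (selfBelow n D k h e a)) ∧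
    (a < n + 1 - k → Single ((-1) ^ (selfBelow n D k h e a + 1) * k) (levelWord n D k e a)) := by
  induction d with
  | zero =>
    intro a ha
    have : a = n := by omega
    subst this
    simp [levelWord, selfBelow]
    omega
  | succ d ih =>
    intro a ha
    obtain ⟨ih1, ih2⟩ := ih (a + 1) (by omega)
    have hz : ∀ L : ℤ, |L| = k → (hm n D k h (2 * (a + 1)) (n + 1) = 0 ∨
        hm n D k h (2 * (a + 1)) (n + 1) = L ∨ hm n D k h (2 * (a + 1)) (n + 1) = -L) := by
      intro L hLk
      rcases hm_even_cases (a := a + 1) (C := n) hD hL h1 h2 with h0 | h0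
      · exact Or.inl h0
      · rw [← hLk, abs_eq_abs] at h0
        exact Or.inr h0
    have hst := hm_start (a := a + 1) hL h1 h2 (by omega) (by omega)
    have hsum : selfBelow n D k h e a = selfBelow n D k h e (a + 1) +
        ((oddSelf n D k h e (a + 1)).card + (evenSelf n D k h e (a + 1)).card) := by
      rw [selfBelow, selfBelow, ← Finset.insert_Ioc_add_one_left_eq_Ioc (by omega),
        Finset.sum_insert (by simp), add_comm]
    set N := (oddSelf n D k h e (a + 1)).card + (evenSelf n D k h e (a + 1)).card
    have hk0 : (k : ℤ) ≠ 0 := by omega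
    by_cases hak : n + 1 - k ≤ a
    · refine ⟨fun _ => ?_, fun h => absurd h (by omega)⟩
      obtain ⟨ih1, ih3⟩ := ih1 (by omega)
      obtain ⟨hp, hw⟩ := row_step hD hL h1 h2 (a := a + 1) (by omega) (by omega) hk0
      rw [if_neg (by omega)] at hst
      obtain ⟨hs, hT, hi⟩ := zero_step hk0 (by
        intro x hx
        rw [List.mem_cons, hst] at hx
        rcases hx with hx | hx
        · exact hx
        · exact ih1 x hx) (hz k (by simp)) hp
      refine ⟨hT, ?_⟩
      have hN := hw hs
      rw [hi, left_eq_add] at hN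
      rw [hsum]
      exact ih3.add ((ZMod.natCast_eq_zero_iff_even).1 hN)
    · refine ⟨fun h => absurd h hak, fun _ => ?_⟩
      obtain ⟨L, hLdef⟩ : ∃ L : ℤ, L = (-1) ^ (selfBelow n D k h e (a + 1) + 1) * k := ⟨_, rfl⟩
      have hLk : |L| = k := by rw [hLdef, abs_mul, abs_pow]; simp
      have hL0 : L ≠ 0 := by rintro rfl; simp at hLk; omega
      have hU : Single L (hm n D k h (2 * (a + 1) - 1) (a + 1) :: levelWord n D k e (a + 1)) := by
        by_cases hak' : a + 1 = n + 1 - k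
        · obtain ⟨ih1, ih3⟩ := ih1 (by omega)
          rw [if_pos hak'] at hst
          -- The pipe enters at the left end with the label `-k`, in accordance with the even count
          -- below.
          have hLk' : L = -k := by
            rw [hLdef, pow_succ, ih3.neg_one_pow]; ring
          rw [hst, hLk']
          refine ⟨fun x hx => ?_, ?_⟩
          · rw [List.mem_cons] at hx
            rcases hx with hx | hx
            · exact Or.inr hx
            · exact Or.inl (ih1 x hx)
          · rw [List.count_cons_self, List.count_eq_zero_of_not_mem]
            intro hx
            have := ih1 _ hx
            omega
        · rw [if_neg hak'] at hst
          have ih2 := ih2 (by omega)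
          rw [← hLdef] at ih2
          rw [hst]
          refine ⟨fun x hx => ?_, ?_⟩
          · rw [List.mem_cons] at hx
            rcases hx with hx | hx
            · exact Or.inl hx
            · exact ih2.1 x hx
          · rw [List.count_cons_of_ne (Ne.symm hL0), ih2.2]
      obtain ⟨hp, hw⟩ := row_step hD hL h1 h2 (a := a + 1) (by omega) (by omega) hL0
      obtain ⟨hs, hor⟩ := single_step hL0 hU (hz L hLk) hp
      have hN := hw hs
      rcases hor with ⟨-, hT, hi⟩ | ⟨-, hT, hi⟩
      · rw [hi, left_eq_add] at hN
        have hev : Even N := (ZMod.natCast_eq_zero_iff_even).1 hN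
        have : (-1 : ℤ) ^ (selfBelow n D k h e a + 1) * k = L := by
          rw [hsum, hLdef, add_right_comm, pow_add, hev.neg_one_pow, mul_one]
        rw [this]
        exact hT
      · rw [hi, add_right_inj] at hN
        have hodd : Odd N := (ZMod.natCast_eq_one_iff_odd).1 hN.symm
        have : (-1 : ℤ) ^ (selfBelow n D k h e a + 1) * k = -L := by
          rw [hsum, hLdef, add_right_comm, pow_add, hodd.neg_one_pow]; ring
        rw [this]
        exact hT

end Mask

/-! ### Reading off `w_D` from a labelling -/

section Certificate

variable {n k : ℕ} {D : Finset (ℕ × ℕ)} {h e : ℕ → ℕ → ℤ}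

theorem selfCrossings_eq (hD : D ⊆ SY n) (hL : IsLabelling n D h e) (h1 : 1 ≤ k) (h2 : k ≤ n) :
    selfCrossings n D k = selfBelow n D k h e 0 := by
  classical
  have hset : {b | b ∈ Ω n D ∧
      (PipeVisits n D k (b, Side.left) ∨ PipeVisits n D k (b, Side.right)) ∧
      (PipeVisits n D k (b, Side.top) ∨ PipeVisits n D k (b, Side.bottom))} =
      (((Finset.Ioc 0 n).biUnion fun b => (oddSelf n D k h e b).image (fun C => (2 * b - 1, C)) ∪
        (evenSelf n D k h e b).image (fun C => (2 * b, C)) : Finset (ℕ × ℕ)) : Set (ℕ × ℕ)) := by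
    ext ⟨ρ, C⟩
    simp only [Set.mem_ofPred_eq, Finset.coe_biUnion, Set.mem_iUnion, Finset.coe_union,
      Finset.coe_image, Set.mem_union, Set.mem_image, Finset.mem_coe, Prod.mk.injEq,
      Finset.mem_Ioc, exists_prop]
    constructor
    · rintro ⟨hΩ, hh, hv⟩
      have hC : C ≤ n := hΩ.1.2.1
      have hC1 : ρ ≤ 2 * C - 1 := hΩ.1.2.2.2
      have hρ : 1 ≤ ρ := hΩ.1.2.2.1
      -- In the columns up to `n` no pipe enters a box from above.
      have hv : PipeVisits n D k ((ρ, C), Side.bottom) :=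
        hv.resolve_left fun hv => (hv.goodState hD hL h1 h2).not_top hC
      have hb := (hv.goodState hD hL h1 h2).abs_bottom.2
      rcases hh with hh | hh
      · have hodd := (hh.goodState hD hL h1 h2).odd_of_left
        obtain ⟨a, rfl⟩ : ∃ a, ρ = 2 * a - 1 := ⟨(ρ + 1) / 2, by omega⟩
        refine ⟨a, by omega, Or.inl ⟨C, ?_, rfl, rfl⟩⟩
        rw [oddSelf, Finset.mem_filter, Finset.mem_Ico, ← mem_Ω_odd (by omega) (by omega) hC,
          hm_odd_ne_zero hD hL h1 h2 (by omega), em_ne_zero hD hL h1 h2 (by omega)]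
        exact ⟨by omega, hΩ, hh, hv⟩
      · have heven := (hh.goodState hD hL h1 h2).abs_right.1
        obtain ⟨a, rfl⟩ : ∃ a, ρ = 2 * a := ⟨ρ / 2, by omega⟩
        refine ⟨a, by omega, Or.inr ⟨C, ?_, rfl, rfl⟩⟩
        rw [evenSelf, Finset.mem_filter, Finset.mem_Ico, ← mem_Ω_even hD (by omega) (by omega) hC,
          hm_even_ne_zero hD hL h1 h2, em_ne_zero hD hL h1 h2 (by omega)]
        exact ⟨by omega, hΩ, hh, hv⟩
    · rintro ⟨a, ha, ⟨C, hC, rfl, rfl⟩ | ⟨C, hC, rfl, rfl⟩⟩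
      · rw [oddSelf, Finset.mem_filter, Finset.mem_Ico, hm_odd_ne_zero hD hL h1 h2 (by omega),
          em_ne_zero hD hL h1 h2 (by omega)] at hC
        rw [mem_Ω_odd (by omega) (by omega) (by omega)]
        tauto
      · rw [evenSelf, Finset.mem_filter, Finset.mem_Ico, hm_even_ne_zero hD hL h1 h2,
          em_ne_zero hD hL h1 h2 (by omega)] at hC
        rw [mem_Ω_even hD (by omega) (by omega) (by omega)]
        tauto
  rw [selfCrossings, hset, Set.ncard_coe_finset, selfBelow, Finset.card_biUnion]
  · refine Finset.sum_congr rfl fun b hb => ?_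
    rw [Finset.mem_Ioc] at hb
    rw [Finset.card_union_of_disjoint, Finset.card_image_of_injective,
      Finset.card_image_of_injective]
    · intro x y hxy; simpa using hxy
    · intro x y hxy; simpa using hxy
    · rw [Finset.disjoint_left]
      intro x hx hx'
      rw [Finset.mem_image] at hx hx'
      obtain ⟨c, -, rfl⟩ := hx
      obtain ⟨c', -, hc'⟩ := hx'
      rw [Prod.mk.injEq] at hc'
      omega
  · intro b hb b' hb' hne
    rw [Finset.mem_coe, Finset.mem_Ioc] at hb hb'
    rw [Function.onFun, Finset.disjoint_left]
    intro x hx hx'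
    simp only [Finset.mem_union, Finset.mem_image] at hx hx'
    rcases hx with ⟨c, -, rfl⟩ | ⟨c, -, rfl⟩ <;> rcases hx' with ⟨c', -, hc'⟩ | ⟨c', -, hc'⟩ <;>
      rw [Prod.mk.injEq] at hc' <;> omega

theorem pipeEnds_iff {j : ℕ} : PipeEnds n D k j ↔ VE n D k 0 (n + 1 - j) := by
  rw [VE, if_pos rfl, PipeEnds]
  constructor
  · rintro ⟨a, h1, h2⟩
    rw [← h2, exitSide_exitSide]
    exact h1
  · intro h
    exact ⟨_, h, exitSide_exitSide _ _⟩

/-- The word at level `0` has a single nonzero letter; its column is the end of the pipe and its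
value is the signed number. -/
theorem IsLabelling.exists_pipeEnds (hD : D ⊆ SY n) (hL : IsLabelling n D h e) (h1 : 1 ≤ k)
    (h2 : k ≤ n) : ∃ j, 1 ≤ j ∧ j ≤ n ∧ PipeEnds n D k j ∧
      e 0 (n + 1 - j) = (-1) ^ (selfCrossings n D k + 1) * k := by
  have hsp := (levelWord_spec hD hL h1 h2 n 0 (by omega)).2 (by omega)
  rw [← selfCrossings_eq hD hL h1 h2] at hsp
  have hne : (-1 : ℤ) ^ (selfCrossings n D k + 1) * k ≠ 0 :=
    mul_ne_zero (by simp) (by omega)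
  have hmem := List.count_pos_iff.1 (lt_of_lt_of_eq Nat.zero_lt_one hsp.2.symm)
  rw [levelWord, List.mem_map] at hmem
  obtain ⟨C, hC, hCe⟩ := hmem
  rw [List.mem_range'_1] at hC
  rw [Nat.mul_zero, em] at hCe
  split_ifs at hCe with hv
  · have hj : n + 1 - (n + 1 - C) = C := by omega
    refine ⟨n + 1 - C, by omega, by omega, ?_, ?_⟩
    · rw [pipeEnds_iff, hj]; exact hv
    · rw [hj]; exact hCe
  · exact absurd hCe.symm hne

theorem IsLabelling.eq_of_pipeEnds (hD : D ⊆ SY n) (hL : IsLabelling n D h e) (h1 : 1 ≤ k)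
    (h2 : k ≤ n) {j : ℕ} (hj1 : 1 ≤ j) (hj2 : j ≤ n) (hj : PipeEnds n D k j)
    (he : e 0 (n + 1 - j) ≠ 0) :
    e 0 (n + 1 - j) = (-1) ^ (selfCrossings n D k + 1) * k := by
  have hsp := (levelWord_spec hD hL h1 h2 n 0 (by omega)).2 (by omega)
  rw [← selfCrossings_eq hD hL h1 h2] at hsp
  rw [pipeEnds_iff] at hj
  have hem : em n D k e (2 * 0) (n + 1 - j) = e 0 (n + 1 - j) := by
    rw [Nat.mul_zero, em, if_pos hj]
  have := hsp.1 (e 0 (n + 1 - j)) (by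
    rw [levelWord, List.mem_map]
    exact ⟨n + 1 - j, by rw [List.mem_range'_1]; omega, hem⟩)
  exact this.resolve_left he

end Certificate

/-! ### Uniqueness of the signed permutation of a labelling -/

theorem apply_ne_zero {n : ℕ} {w : Equiv.Perm ℤ} (hw : w ∈ W n) {z : ℤ} (hz : z ≠ 0) :
    w z ≠ 0 := by
  have h0 : w 0 = 0 := by
    have := hw.1 0
    rw [neg_zero] at this
    omega
  rw [← h0]
  exact fun h => hz (w.injective h)

theorem abs_apply_le {n : ℕ} {w : Equiv.Perm ℤ} (hw : w ∈ W n) {z : ℤ} (hz : |z| ≤ n) :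
    |w z| ≤ n := by
  by_contra hc
  have h1 := hw.2 (w z) (by omega)
  have h2 := w.injective h1
  rw [h2] at hc
  exact hc hz

theorem eq_of_forall_eq {n : ℕ} {w w' : Equiv.Perm ℤ} (hw : w ∈ W n) (hw' : w' ∈ W n)
    (h : ∀ j : ℕ, 1 ≤ j → j ≤ n → w j = w' j) : w = w' := by
  have h0 : ∀ {v : Equiv.Perm ℤ}, v ∈ W n → v 0 = 0 := fun hv => by
    have := hv.1 0
    rw [neg_zero] at this
    omega
  have hpos : ∀ m : ℕ, w m = w' m := by
    intro m
    by_cases hm : m = 0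
    · rw [hm, Nat.cast_zero, h0 hw, h0 hw']
    by_cases hmn : m ≤ n
    · exact h m (by omega) hmn
    · rw [hw.2 m (by rw [Nat.abs_cast]; omega), hw'.2 m (by rw [Nat.abs_cast]; omega)]
  ext z
  obtain ⟨m, rfl | rfl⟩ := z.eq_nat_or_neg
  · exact hpos m
  · rw [hw.1, hw'.1, hpos m]

/-- The pipe with the number `|w j|` ends in a column whose label has the same absolute value. As
`w` is odd and injective, this column is the one of `j`. -/
theorem Lab.isPermOf {n : ℕ} {D : Finset (ℕ × ℕ)} {w : Equiv.Perm ℤ} (hD : D ⊆ SY n)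
    (hw : w ∈ W n) (hL : Lab n D w) : IsPermOf n D w := by
  obtain ⟨h, e, hL, htop⟩ := hL
  refine ⟨hw, fun j h1 h2 => ?_⟩
  have hle := abs_apply_le hw (z := j) (by rw [Nat.abs_cast]; omega)
  have hne := apply_ne_zero hw (z := j) (by omega)
  have hk1 : 1 ≤ (w j).natAbs := by omega
  have hk2 : (w j).natAbs ≤ n := by rw [Int.abs_eq_natAbs] at hle; omega
  obtain ⟨j', h3, h4, h5, h6⟩ := hL.exists_pipeEnds hD hk1 hk2
  have h7 := htop j' h3 h4
  have hjj : |w j'| = |w j| := by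
    rw [← h7, h6, abs_mul, abs_pow, abs_neg, abs_one, one_pow, one_mul, Nat.abs_cast,
      Int.natCast_natAbs]
  have : j' = j := by
    rcases abs_eq_abs.1 hjj with h | h
    · have := w.injective h; omega
    · rw [← hw.1] at h
      have := w.injective h; omega
  subst this
  exact ⟨_, hk1, hk2, h5, h7.symm.trans h6⟩

theorem Lab.eq_of_isPermOf {n : ℕ} {D : Finset (ℕ × ℕ)} {w w' : Equiv.Perm ℤ} (hD : D ⊆ SY n)
    (hw : w ∈ W n) (hL : Lab n D w) (hp : IsPermOf n D w') : w = w' := by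
  obtain ⟨h, e, hL, htop⟩ := hL
  refine eq_of_forall_eq hw hp.1 fun j h1 h2 => ?_
  obtain ⟨k, hk1, hk2, hj, hwj⟩ := hp.2 j h1 h2
  have h3 := htop j h1 h2
  rw [hwj, ← h3]
  refine hL.eq_of_pipeEnds hD hk1 hk2 h1 h2 hj ?_
  rw [h3]
  exact apply_ne_zero hw (by omega)

/-- This turns `Lab` into an invariant of `D`: all later comparisons of normal forms rest on it. -/
theorem Lab.unique {n : ℕ} {D : Finset (ℕ × ℕ)} {w w' : Equiv.Perm ℤ} (hD : D ⊆ SY n)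
    (hw : w ∈ W n) (hw' : w' ∈ W n) (hL : Lab n D w) (hL' : Lab n D w') : w = w' :=
  hL.eq_of_isPermOf hD hw (hL'.isPermOf hD hw')

/-! ### Labellings of the largest and the smallest skew pipe dream -/

theorem lab_SY (n : ℕ) : Lab n (SY n) 1 := by
  -- Labels are constant along rows and columns: a pipe runs along row `2a - 1`, turns, comes back
  -- along row `2a` with the opposite sign, and climbs column `a` from its end box.
  refine ⟨fun ρ _ => if ρ % 2 = 1 then -((n : ℤ) + 1 - ((ρ + 1) / 2 : ℕ)) else
    (n : ℤ) + 1 - ((ρ + 1) / 2 : ℕ), fun _ C => (n : ℤ) + 1 - C, ⟨?_, ?_, ?_, ?_⟩, ?_⟩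
  · intro a ha han
    rw [if_pos (by omega)]
    have : (2 * a - 1 + 1) / 2 = a := by omega
    rw [this]
  · intro a ha han
    rw [if_neg (by omega), if_pos (by omega)]
    have h1 : (2 * a - 1 + 1) / 2 = a := by omega
    have h2 : (2 * a + 1) / 2 = a := by omega
    rw [h1, h2, neg_neg]
  · intro a C ha haC hC
    exact ⟨fun _ => ⟨rfl, rfl⟩, fun h => absurd (mem_SY.2 (by omega)) h⟩
  · intro a C ha haC hC
    refine ⟨fun _ => ⟨rfl, rfl⟩, fun h => ?_⟩
    rw [mem_SY] at h
    have hCa : C = a := by omega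
    have h2 : (2 * a + 1) / 2 = a := by omega
    rw [if_neg (by omega), h2, hCa]
    exact ⟨rfl, rfl⟩
  · intro j h1 h2
    rw [Equiv.Perm.one_apply]
    dsimp only
    omega

theorem w₀_apply (n : ℕ) (z : ℤ) : w₀ n z = if |z| ≤ n then -z else z := by
  induction n generalizing z with
  | zero =>
    simp only [w₀, List.range_zero, List.map_nil, List.prod_nil, Equiv.Perm.one_apply,
      Nat.cast_zero, abs_nonpos_iff]
    split_ifs <;> omega
  | succ n ih =>
    have : w₀ (n + 1) = w₀ n * Equiv.swap ((n : ℤ) + 1) (-((n : ℤ) + 1)) := by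
      simp [w₀, List.range_succ]
    rw [this, Equiv.Perm.mul_apply, ih, Equiv.swap_apply_def]
    simp only [abs_le]
    push_cast
    split_ifs <;> omega

theorem w₀_mem (n : ℕ) : w₀ n ∈ W n := by
  refine ⟨fun z => ?_, fun z hz => ?_⟩
  · simp only [w₀_apply, abs_neg]
    split_ifs <;> rfl
  · rw [w₀_apply, if_neg (by omega)]

theorem lab_empty (n : ℕ) : Lab n ∅ (w₀ n) := by
  -- No pipe reaches column `n + 1`. The edges there belong to closed loops, in agreement with the
  -- value `0` at `C = n + 1`.
  refine ⟨fun ρ C => -((n : ℤ) + 1 - C), fun ρ C => if ρ % 2 = 1 then -((n : ℤ) - C) else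
    -((n : ℤ) + 1 - C), ⟨?_, ?_, ?_, ?_⟩, ?_⟩
  · intro a ha han; rfl
  · intro a ha han; push_cast; ring
  · intro a C ha haC hC
    refine ⟨fun h => absurd h (by simp), fun _ => ?_⟩
    rw [if_pos (by omega), if_neg (by omega)]
    exact ⟨by push_cast; ring, rfl⟩
  · intro a C ha haC hC
    refine ⟨fun h => absurd h (by simp), fun _ => ?_⟩
    rw [if_neg (by omega), if_pos (by omega)]
    exact ⟨rfl, by push_cast; ring⟩
  · intro j h1 h2
    rw [w₀_apply, if_pos (by rw [Nat.abs_cast]; omega)]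
    dsimp only
    rw [if_neg (by omega)]
    omega

/-! ### Normal forms of signed permutations -/

theorem W_mono {m n : ℕ} (h : m ≤ n) : W m ≤ W n :=
  fun _ hw => ⟨hw.1, fun z hz => hw.2 z (by omega)⟩

/-- The product of the first `t` letters of block `b`. -/
def blockProd (b t : ℕ) : Equiv.Perm ℤ :=
  (((List.range' (b ^ 2 + 1) t).map iC).map s).prod

/-- The positions in the blocks `0, …, b - 1` which are among the first `t β` ones of the
block `β`. -/
def prefixPos (t : ℕ → ℕ) : ℕ → List ℕ
  | 0 => []
  | b + 1 => prefixPos t b ++ List.range' (b ^ 2 + 1) (t b)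

/-- The signed permutation with the reduced word given by the positions `prefixPos t b`. -/
def nf (t : ℕ → ℕ) (b : ℕ) : Equiv.Perm ℤ := (((prefixPos t b).map iC).map s).prod

theorem nf_succ (t : ℕ → ℕ) (b : ℕ) : nf t (b + 1) = nf t b * blockProd b (t b) := by
  simp [nf, prefixPos, blockProd]

theorem blockProd_succ (b t : ℕ) : blockProd b (t + 1) = blockProd b t * s (iC (b ^ 2 + t + 1)) := by
  rw [blockProd, List.range'_concat, one_mul, add_right_comm]
  simp [blockProd]

theorem iC_le {b m : ℕ} (hm : m ≤ 2 * b) : 1 ≤ iC (b ^ 2 + m + 1) ∧ iC (b ^ 2 + m + 1) ≤ b + 1 := by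
  rw [iC_eq hm]; omega

theorem blockProd_mem {b t : ℕ} (ht : t ≤ 2 * b + 1) : blockProd b t ∈ W (b + 1) := by
  induction t with
  | zero => exact one_mem _
  | succ t ih =>
    rw [blockProd_succ]
    have := iC_le (b := b) (m := t) (by omega)
    exact mul_mem (ih (by omega)) (s_mem_W this.1 this.2)

theorem s_inv {i : ℕ} (hi : 1 ≤ i) : (s i)⁻¹ = s i := inv_eq_of_mul_eq_one_left (s_mul_self hi)

/-- As `t` runs from `0` to `2 * b + 1`, the value descends through `b + 1, …, 1, -1, …, -(b + 1)`.
It takes every possible value of `w⁻¹ (b + 1)` once, so the products `blockProd b t` represent the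
cosets of `W b` in `W (b + 1)`. -/
theorem blockProd_inv_apply {b t : ℕ} (ht : t ≤ 2 * b + 1) :
    (blockProd b t)⁻¹ ((b : ℤ) + 1) = if t ≤ b then (b : ℤ) + 1 - t else (b : ℤ) - t := by
  induction t with
  | zero => simp [blockProd]
  | succ t ih =>
    have hi := iC_le (b := b) (m := t) (by omega)
    rw [blockProd_succ, mul_inv_rev, Equiv.Perm.mul_apply, ih (by omega), s_inv hi.1]
    have hc := iC_eq (b := b) (m := t) (by omega)
    generalize iC (b ^ 2 + t + 1) = i at *
    by_cases h1 : i = 1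
    · subst h1
      rw [s_one_apply]
      push_cast
      split_ifs <;> omega
    · rw [s_apply (by omega)]
      push_cast
      split_ifs <;> omega

theorem nf_mem {t : ℕ → ℕ} {b : ℕ} (ht : ∀ β < b, t β ≤ 2 * β + 1) : nf t b ∈ W b := by
  induction b with
  | zero => exact one_mem _
  | succ b ih =>
    rw [nf_succ]
    exact mul_mem (W_mono (Nat.le_succ b) (ih fun β hβ => ht β (by omega)))
      (blockProd_mem (ht b (by omega)))

theorem nf_inv_apply {t : ℕ → ℕ} {b : ℕ} (ht : ∀ β < b + 1, t β ≤ 2 * β + 1) :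
    (nf t (b + 1))⁻¹ ((b : ℤ) + 1) =
      if t b ≤ b then (b : ℤ) + 1 - t b else (b : ℤ) - t b := by
  have h1 := (inv_mem (nf_mem (t := t) (b := b) fun β hβ => ht β (by omega))).2 ((b : ℤ) + 1)
    (by rw [abs_of_nonneg (by omega)]; omega)
  rw [nf_succ, mul_inv_rev, Equiv.Perm.mul_apply, h1, blockProd_inv_apply (ht b (by omega))]

/-- The value of the inverse at `b + 1` recovers the last exponent; the last block is then
cancelled. -/
theorem nf_inj {t t' : ℕ → ℕ} {b : ℕ} (ht : ∀ β < b, t β ≤ 2 * β + 1)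
    (ht' : ∀ β < b, t' β ≤ 2 * β + 1) (h : nf t b = nf t' b) : ∀ β < b, t β = t' β := by
  induction b with
  | zero => intro β hβ; omega
  | succ b ih =>
    have h1 := nf_inv_apply ht
    rw [h, nf_inv_apply ht'] at h1
    have hb : t b = t' b := by
      have := ht b (by omega)
      have := ht' b (by omega)
      split_ifs at h1 <;> omega
    rw [nf_succ, nf_succ, hb] at h
    intro β hβ
    rcases Nat.lt_succ_iff_lt_or_eq.1 hβ with h2 | rfl
    · exact ih (fun β hβ => ht β (by omega)) (fun β hβ => ht' β (by omega))
        (mul_right_cancel h) β h2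
    · exact hb

theorem prefixPos_congr {t t' : ℕ → ℕ} {b : ℕ} (h : ∀ β < b, t β = t' β) :
    prefixPos t b = prefixPos t' b := by
  induction b with
  | zero => rfl
  | succ b ih => rw [prefixPos, prefixPos, ih fun β hβ => h β (by omega), h b (by omega)]

theorem nf_congr {t t' : ℕ → ℕ} {b : ℕ} (h : ∀ β < b, t β = t' β) : nf t b = nf t' b := by
  rw [nf, nf, prefixPos_congr h]

theorem exists_nf {b : ℕ} : ∀ w ∈ W b, ∃ t : ℕ → ℕ, (∀ β, t β ≤ 2 * β + 1) ∧ nf t b = w := by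
  induction b with
  | zero =>
    intro w hw
    refine ⟨fun _ => 0, by simp, ?_⟩
    exact eq_of_forall_eq (one_mem (W 0)) hw fun j h1 h2 => by omega
  | succ b ih =>
    intro w hw
    obtain ⟨z, hz⟩ : ∃ z, z = w⁻¹ ((b : ℤ) + 1) := ⟨_, rfl⟩
    have hz0 : z ≠ 0 := hz ▸ apply_ne_zero (inv_mem hw) (by omega)
    have hzle : |z| ≤ (b + 1 : ℕ) := hz ▸ abs_apply_le (inv_mem hw)
      (by push_cast; rw [abs_of_nonneg (by omega)])
    rw [abs_le] at hzle
    push_cast at hzle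
    obtain ⟨τ, hτ, hτz⟩ : ∃ τ : ℕ, τ ≤ 2 * b + 1 ∧
        (if τ ≤ b then (b : ℤ) + 1 - τ else (b : ℤ) - τ) = z := by
      by_cases hpos : 0 < z
      · exact ⟨((b : ℤ) + 1 - z).toNat, by omega, by rw [if_pos (by omega)]; omega⟩
      · exact ⟨((b : ℤ) - z).toNat, by omega, by rw [if_neg (by omega)]; omega⟩
    have hv1 : w * (blockProd b τ)⁻¹ ∈ W (b + 1) := mul_mem hw (inv_mem (blockProd_mem hτ))
    have hv2 : (w * (blockProd b τ)⁻¹) ((b : ℤ) + 1) = (b : ℤ) + 1 := by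
      rw [Equiv.Perm.mul_apply, blockProd_inv_apply hτ, hτz, hz, ← Equiv.Perm.mul_apply, mul_inv_cancel, Equiv.Perm.one_apply]
    -- After removing the coset representative, the point `b + 1` is fixed, and by oddness also `-(b
    -- + 1)`.
    have hv : w * (blockProd b τ)⁻¹ ∈ W b := by
      refine ⟨hv1.1, fun x hx => ?_⟩
      by_cases hx' : ((b + 1 : ℕ) : ℤ) < |x|
      · exact hv1.2 x hx'
      · have : |x| = (b : ℤ) + 1 := by push_cast at hx'; omega
        rcases eq_or_eq_neg_of_abs_eq this with rfl | rfl
        · exact hv2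
        · rw [hv1.1, hv2]
    obtain ⟨t, ht, hnf⟩ := ih _ hv
    refine ⟨Function.update t b τ, fun β => ?_, ?_⟩
    · by_cases hβ : β = b
      · rw [hβ, Function.update_self]; exact hτ
      · rw [Function.update_of_ne hβ]; exact ht β
    · rw [nf_succ, Function.update_self,
        nf_congr (t' := t) fun β hβ => Function.update_of_ne (by omega) _ _, hnf]
      simp

/-! ### Prefix forms -/

/-- The skew pipe dream whose complement consists of the first `t b` boxes of each block `b`. -/
def PF (n : ℕ) (t : ℕ → ℕ) : Finset (ℕ × ℕ) :=
  (SY n).filter fun x => t (n - x.1) ≤ 2 * n - x.1 - x.2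

theorem PF_subset (n : ℕ) (t : ℕ → ℕ) : PF n t ⊆ SY n := Finset.filter_subset _ _

theorem mem_PF {n : ℕ} {t : ℕ → ℕ} {a c : ℕ} :
    (a, c) ∈ PF n t ↔ (a, c) ∈ SY n ∧ t (n - a) ≤ 2 * n - a - c := by
  rw [PF, Finset.mem_filter]

theorem PF_congr {n : ℕ} {t t' : ℕ → ℕ} (h : ∀ b < n, t b = t' b) : PF n t = PF n t' := by
  ext ⟨a, c⟩
  rw [mem_PF, mem_PF, mem_SY]
  refine and_congr_right fun hs => ?_
  rw [h (n - a) (by omega)]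

theorem complPositions_PF {n : ℕ} {t : ℕ → ℕ} (ht : ∀ b < n, t b ≤ 2 * b + 1) :
    complPositions n (PF n t) = prefixPos t n := by
  have key : ∀ b ≤ n, (List.range' 1 (b ^ 2)).filter (fun k => (p n k, q n k) ∉ PF n t) =
      prefixPos t b := by
    intro b
    induction b with
    | zero => intro _; rfl
    | succ b ih =>
      intro hb
      have h1 : (b + 1) ^ 2 = b ^ 2 + (2 * b + 1) := by ring
      obtain ⟨r, hr⟩ : ∃ r, 2 * b + 1 = t b + r := ⟨2 * b + 1 - t b, by
        have := ht b (by omega); omega⟩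
      rw [h1, ← List.range'_append_1, List.filter_append, ih (by omega), prefixPos, hr,
        ← List.range'_append_1, List.filter_append]
      have hmem : ∀ m ≤ 2 * b, ((p n (b ^ 2 + m + 1), q n (b ^ 2 + m + 1)) ∈ PF n t ↔ t b ≤ m) := by
        intro m hm
        rw [mem_PF, mem_SY, p, q, blockOf_eq hm, offsetOf_eq hm]
        have h2 : n - (n - b) = b := by omega
        rw [h2]
        omega
      congr 1
      have e1 : (List.range' (1 + b ^ 2) (t b)).filter (fun k => (p n k, q n k) ∉ PF n t) =
          List.range' (1 + b ^ 2) (t b) := by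
        rw [List.filter_eq_self]
        intro k hk
        rw [List.mem_range'_1] at hk
        obtain ⟨m, rfl⟩ : ∃ m, k = b ^ 2 + m + 1 := ⟨k - b ^ 2 - 1, by omega⟩
        rw [decide_eq_true_eq, hmem m (by omega)]
        omega
      have e2 : (List.range' (1 + b ^ 2 + t b) r).filter (fun k => (p n k, q n k) ∉ PF n t) =
          [] := by
        rw [List.filter_eq_nil_iff]
        intro k hk
        rw [List.mem_range'_1] at hk
        obtain ⟨m, rfl⟩ : ∃ m, k = b ^ 2 + m + 1 := ⟨k - b ^ 2 - 1, by omega⟩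
        rw [decide_eq_true_eq, not_not, hmem m (by omega)]
        omega
      rw [e1, e2, List.append_nil, add_comm]
  exact key n le_rfl

theorem complPositions_toFinset (n : ℕ) (D : Finset (ℕ × ℕ)) :
    ((complPositions n D).map fun k => (p n k, q n k)).toFinset = SY n \ D := by
  ext ⟨a, c⟩
  rw [List.mem_toFinset, List.mem_map, Finset.mem_sdiff]
  constructor
  · rintro ⟨k, hk, hkb⟩
    rw [complPositions, List.mem_filter, List.mem_range'_1, decide_eq_true_eq] at hk
    rw [← hkb]
    exact ⟨(pos_spec hk.1.1 (by omega)).1, hk.2⟩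
  · rintro ⟨h1, h2⟩
    refine ⟨pos n a c, ?_, by rw [p_pos h1, q_pos h1]⟩
    rw [complPositions, List.mem_filter, List.mem_range'_1, decide_eq_true_eq, p_pos h1, q_pos h1]
    have := pos_le h1
    exact ⟨⟨one_le_pos, by omega⟩, h2⟩

theorem complPositions_length {n : ℕ} {D : Finset (ℕ × ℕ)} (hD : D ⊆ SY n) :
    D.card + (complPositions n D).length = n ^ 2 := by
  have h1 : (((complPositions n D).map fun k => (p n k, q n k)).toFinset).card =
      (complPositions n D).length := by
    rw [List.toFinset_card_of_nodup, List.length_map]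
    refine List.Nodup.map_on ?_ ((List.nodup_range' ..).filter _)
    intro k hk k' hk' h
    rw [complPositions, List.mem_filter, List.mem_range'_1] at hk hk'
    obtain ⟨hk, -⟩ := hk
    obtain ⟨hk', -⟩ := hk'
    rw [Prod.mk.injEq] at h
    rw [← (pos_spec (n := n) hk.1 (by omega)).2, ← (pos_spec (n := n) hk'.1 (by omega)).2,
      h.1, h.2]
  rw [← h1, complPositions_toFinset, Finset.card_sdiff_of_subset hD, card_SY]
  have := Finset.card_le_card hD
  rw [card_SY] at this
  omega

theorem nf_eq_of_zero {t : ℕ → ℕ} {b n : ℕ} (hb : b ≤ n) (h : ∀ β, b ≤ β → t β = 0) :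
    nf t n = nf t b := by
  induction n with
  | zero => rw [Nat.le_zero.1 hb]
  | succ n ih =>
    rcases hb.eq_or_lt with rfl | hb
    · rfl
    · rw [nf_succ, h n (by omega), ih (by omega)]
      simp [blockProd]

/-- Removing from a prefix form the box at the first position after its complement. -/
theorem toggle_PF {n b m : ℕ} {t t' : ℕ → ℕ} (hb : b < n) (hm : m ≤ 2 * b) (htb : t b = m + 1)
    (ht'b : t' b = m) (htt' : ∀ β, β ≠ b → t' β = t β) (h0 : ∀ β, b < β → t β = 0) :
    ∃ κ, Toggle n (iC (b ^ 2 + m + 1)) 0 κ (PF n t') (PF n t) := by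
  have hx : (n - b, n + b - m) ∈ SY n := by rw [mem_SY]; omega
  obtain ⟨i, κ, hi, hin, hκ1, hκ2, hκ⟩ := exists_xb hx
  have hpr : pr n i κ = b ^ 2 + m + 1 := by
    have e1 : n - (n - b) = b := by omega
    rw [pr, hκ, pos, e1]
    simp only
    omega
  rw [← hpr, iC_pr hi hin hκ1 hκ2]
  have hnb : n - (n - b) = b := by omega
  -- Every box at the removed position or later lies in `PF n t'`. The strip rows above `κ` consist
  -- of such boxes, so they are full.
  have hmem : ∀ a c, (a, c) ∈ SY n → (a < n - b ∨ (a = n - b ∧ c ≤ n + b - m)) →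
      (a, c) ∈ PF n t' := by
    intro a c h1 h2
    rw [mem_PF]
    refine ⟨h1, ?_⟩
    rw [mem_SY] at h1
    rcases h2 with h2 | ⟨rfl, h2⟩
    · rw [htt' _ (by omega), h0 _ (by omega)]; omega
    · rw [hnb, ht'b]; omega
  refine ⟨κ, hi, hin, by omega, hκ2, ?_, ?_, by omega, ?_, by omega, ?_⟩
  · rw [yb, hκ, mem_PF, mem_SY, hnb, ht'b]
    omega
  · intro ρ h1 h2
    have h3 := (pr_lt_pr hi hin hκ1 hκ2 h1 (by omega)).2 h2
    have hxρ := xb_mem (n := n) hi h1 (by omega : ρ ≤ slen n i)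
    have hyρ := yb_mem (n := n) hi h1 (by omega : ρ < slen n i)
    rw [pr, pr, hκ] at h3
    rw [yb] at hyρ
    rw [Full, yb]
    obtain ⟨⟨a, c⟩, hac⟩ : ∃ z, xb n i ρ = z := ⟨_, rfl⟩
    rw [hac] at h3 hxρ hyρ ⊢
    rw [pos_lt_pos hx hxρ] at h3
    exact ⟨hmem _ _ hxρ (by omega), hmem _ _ hyρ (by omega)⟩
  · rw [hκ, mem_PF, mem_PF, hnb, htb, ht'b]
    have : 2 * n - (n - b) - (n + b - m) = m := by omega
    rw [this]
    simp [hx]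
  · rintro ⟨a, c⟩ h1 -
    rw [hκ, Ne, Prod.mk.injEq] at h1
    rw [mem_PF, mem_PF]
    refine and_congr_right fun hs => ?_
    rw [mem_SY] at hs
    by_cases hab : n - a = b
    · rw [hab, htb, ht'b]; omega
    · rw [htt' _ hab]

/-- Starting from `SY n`, boxes are removed in the order of positions. Each removal is a toggle that
reaches the top, and it multiplies by the letter of its position on the right. -/
theorem lab_PF {n : ℕ} {t : ℕ → ℕ} (ht : ∀ b < n, t b ≤ 2 * b + 1) : Lab n (PF n t) (nf t n) := by
  have key : ∀ b ≤ n, ∀ t : ℕ → ℕ, (∀ β < n, t β ≤ 2 * β + 1) → (∀ β, b ≤ β → t β = 0) →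
      Lab n (PF n t) (nf t n) := by
    intro b
    induction b with
    | zero =>
      intro _ t ht h0
      have h1 : PF n t = SY n := by
        ext ⟨a, c⟩
        rw [mem_PF, h0 _ (Nat.zero_le _)]
        simp
      rw [h1, nf_eq_of_zero (Nat.zero_le n) h0]
      exact lab_SY n
    | succ b ih =>
      intro hb t ht h0
      obtain ⟨m, hm⟩ : ∃ m, t b = m := ⟨_, rfl⟩
      induction m generalizing t with
      | zero =>
        refine ih (by omega) t ht fun β hβ => ?_
        rcases hβ.eq_or_lt with rfl | hβ
        · exact hm
        · exact h0 β hβ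
      | succ m ihm =>
        have hmb : m ≤ 2 * b := by have := ht b (by omega); omega
        obtain ⟨t', ht'⟩ : ∃ t' : ℕ → ℕ, t' = Function.update t b m := ⟨_, rfl⟩
        have ht'b : t' b = m := by rw [ht', Function.update_self]
        have htt' : ∀ β, β ≠ b → t' β = t β := fun β hβ => by rw [ht', Function.update_of_ne hβ]
        have hbd : ∀ β < n, t' β ≤ 2 * β + 1 := fun β hβ => by
          by_cases hβb : β = b
          · rw [hβb, ht'b]; omega
          · rw [htt' β hβb]; exact ht β hβ
        have h0' : ∀ β, b + 1 ≤ β → t' β = 0 := fun β hβ => by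
          rw [htt' β (by omega)]; exact h0 β hβ
        obtain ⟨κ, hκ⟩ := toggle_PF (show b < n by omega) hmb hm ht'b htt' h0
        have := Lab.toggle_top (nf_mem hbd) (ihm t' hbd h0' ht'b) hκ
        rw [nf_eq_of_zero hb h0', nf_succ, ht'b, mul_assoc, ← blockProd_succ,
          nf_congr (t := t') (b := b) (t' := t) (fun β hβ => htt' β (Nat.ne_of_lt hβ)), ← hm, ← nf_succ,
          ← nf_eq_of_zero hb h0] at this
        exact this
  -- Exponents of blocks from `n` on are irrelevant and are set to `0`, as the induction requires.
  have hcut : ∀ β < n, t β = (fun β => if β < n then t β else 0) β := fun β hβ => by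
    simp only [if_pos hβ]
  rw [PF_congr hcut, nf_congr hcut]
  refine key n le_rfl _ (fun β hβ => ?_) fun β hβ => ?_
  · show (if β < n then t β else 0) ≤ _
    rw [if_pos hβ]; exact ht β hβ
  · exact if_neg (by omega)

/-! ### Reduction to prefix forms -/

variable {n : ℕ}

/-- A ladder move from `D` to `D'` in the strip of the letter `i`, from row `κ` to row `l`. -/
structure StripMove (n i l κ : ℕ) (D D' : Finset (ℕ × ℕ)) : Prop where
  one_le : 1 ≤ i
  le : i ≤ n
  one_le_top : 1 ≤ l
  lt : l < κ
  le_slen : κ ≤ slen n i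
  x_bot : xb n i κ ∈ D
  y_bot : yb n i κ ∉ D
  x_top : xb n i l ∉ D
  y_top : yb n i l ∉ D
  full : ∀ ρ, l < ρ → ρ < κ → Full n i D ρ
  eq : D' = insert (yb n i l) (D.erase (xb n i κ))

theorem ladderMove_iff_stripMove {D D' : Finset (ℕ × ℕ)} (hD : D ⊆ SY n) {a j : ℕ} :
    LadderMove n a j D D' ↔ ∃ i κ l, StripMove n i l κ D D' ∧ xb n i κ = (a, j) := by
  rw [ladderMove_iff hD]
  constructor
  · rintro ⟨i, κ, l, h1, h2, h3, h4, h5, h6, h7, h8, h9, h10, h11, h12⟩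
    exact ⟨i, κ, l, ⟨h1, h2, h3, h4, h5, h7, h8, h9, h10, h11, h12⟩, h6⟩
  · rintro ⟨i, κ, l, ⟨h1, h2, h3, h4, h5, h7, h8, h9, h10, h11, h12⟩, h6⟩
    exact ⟨i, κ, l, h1, h2, h3, h4, h5, h6, h7, h8, h9, h10, h11, h12⟩

namespace StripMove

variable {i l κ : ℕ} {D D' : Finset (ℕ × ℕ)}

theorem subset (m : StripMove n i l κ D D') (hD : D ⊆ SY n) : D' ⊆ SY n := by
  rw [m.eq]
  refine Finset.insert_subset (yb_mem m.one_le m.one_le_top ?_) ((Finset.erase_subset _ _).trans hD)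
  have := m.lt
  have := m.le_slen
  omega

theorem card_eq (m : StripMove n i l κ D D') : D'.card = D.card := by
  rw [m.eq, Finset.card_insert_of_notMem fun h => m.y_top (Finset.mem_of_mem_erase h),
    Finset.card_erase_of_mem m.x_bot]
  have := Finset.card_pos.2 ⟨_, m.x_bot⟩
  omega

theorem toggle (m : StripMove n i l κ D D') : Toggle n i l κ D D' := by
  refine ⟨m.one_le, m.le, m.lt, m.le_slen, m.y_bot, m.full, fun _ => m.x_top, ?_, fun _ => ?_,
    fun b h1 h2 => ?_⟩
  · rw [m.eq, Finset.mem_insert, Finset.mem_erase]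
    simp [m.x_bot, xb_ne_yb m.one_le m.le]
  · rw [m.eq]
    simp [m.y_top]
  · rw [m.eq, Finset.mem_insert, Finset.mem_erase]
    simp [h1, h2 m.one_le_top]

theorem ladderMove (m : StripMove n i l κ D D') (hD : D ⊆ SY n) :
    LadderMove n (xb n i κ).1 (xb n i κ).2 D D' :=
  (ladderMove_iff_stripMove hD).2 ⟨i, κ, l, m, rfl⟩

end StripMove

theorem LadderMove.preserves {a j : ℕ} {D D' : Finset (ℕ × ℕ)} (hD : D ⊆ SY n)
    (h : LadderMove n a j D D') :
    D' ⊆ SY n ∧ D'.card = D.card ∧ ∀ w, Lab n D w → Lab n D' w := by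
  obtain ⟨i, κ, l, m, -⟩ := (ladderMove_iff_stripMove hD).1 h
  exact ⟨m.subset hD, m.card_eq, fun w hw => hw.toggle m.toggle m.one_le_top⟩

theorem preserves_of_mem_ladderOrbit {C : ℕ → ℕ → Prop} {D D' : Finset (ℕ × ℕ)} (hD : D ⊆ SY n)
    (h : D' ∈ ladderOrbit n C D) :
    D' ⊆ SY n ∧ D'.card = D.card ∧ ∀ w, Lab n D w → Lab n D' w := by
  induction h with
  | refl => exact ⟨hD, rfl, fun _ h => h⟩
  | tail _ h ih =>
    obtain ⟨a, j, -, h⟩ := h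
    obtain ⟨h1, h2, h3⟩ := h.preserves ih.1
    exact ⟨h1, h2.trans ih.2.1, fun w hw => h3 w (ih.2.2 w hw)⟩

/-- The inverse of a ladder move. -/
theorem stripMove_of_insert {i l κ : ℕ} {D : Finset (ℕ × ℕ)} (hi : 1 ≤ i) (hn : i ≤ n) (hl : 1 ≤ l)
    (hlκ : l < κ) (hκ : κ ≤ slen n i) (hxκ : xb n i κ ∉ D) (hyκ : yb n i κ ∉ D)
    (hxl : xb n i l ∉ D) (hyl : yb n i l ∈ D) (hf : ∀ ρ, l < ρ → ρ < κ → Full n i D ρ) :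
    StripMove n i l κ (insert (xb n i κ) (D.erase (yb n i l))) D := by
  have hxy : ∀ ρ σ, xb n i ρ ≠ yb n i σ := fun ρ σ => xb_ne_yb hi hn
  refine ⟨hi, hn, hl, hlκ, hκ, Finset.mem_insert_self _ _, ?_, ?_, ?_, fun ρ h1 h2 => ⟨?_, ?_⟩, ?_⟩
  · simp [hyκ, (hxy _ _).symm]
  · rw [Finset.mem_insert, Finset.mem_erase]
    rintro (h | h)
    · have := xb_inj h; omega
    · exact hxl h.2
  · simp [(hxy _ _).symm]
  · rw [Finset.mem_insert, Finset.mem_erase]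
    exact Or.inr ⟨hxy _ _, (hf ρ h1 h2).1⟩
  · rw [Finset.mem_insert, Finset.mem_erase]
    exact Or.inr ⟨fun h => by have := yb_inj h; omega, (hf ρ h1 h2).2⟩
  · rw [Finset.erase_insert fun h => hxκ (Finset.mem_of_mem_erase h), Finset.insert_erase hyl]

/-- Removing a double crossing. -/
theorem toggle_of_erase {i l κ : ℕ} {D : Finset (ℕ × ℕ)} (hi : 1 ≤ i) (hn : i ≤ n) (hl : 1 ≤ l)
    (hlκ : l < κ) (hκ : κ ≤ slen n i) (hxκ : xb n i κ ∈ D) (hyκ : yb n i κ ∉ D)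
    (hxl : xb n i l ∉ D) (hyl : yb n i l ∈ D) (hf : ∀ ρ, l < ρ → ρ < κ → Full n i D ρ) :
    Toggle n i l κ ((D.erase (xb n i κ)).erase (yb n i l)) D := by
  have hxy : ∀ ρ σ, xb n i ρ ≠ yb n i σ := fun ρ σ => xb_ne_yb hi hn
  refine ⟨hi, hn, hlκ, hκ, ?_, fun ρ h1 h2 => ⟨?_, ?_⟩, fun _ => ?_, ?_, fun _ => ?_,
    fun b h1 h2 => ?_⟩
  · simp [hyκ]
  · rw [Finset.mem_erase, Finset.mem_erase]
    exact ⟨hxy _ _, fun h => by have := xb_inj h; omega, (hf ρ h1 h2).1⟩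
  · rw [Finset.mem_erase, Finset.mem_erase]
    exact ⟨fun h => by have := yb_inj h; omega, (hxy _ _).symm, (hf ρ h1 h2).2⟩
  · simp [hxl]
  · simp [hxκ]
  · simp [hyl]
  · simp [h1, h2 hl]

/-- An inverse ladder move replaces `yb n i l` by `xb n i κ`, so the sum of the positions of the
boxes drops. This is the termination measure of `exists_PF_of_subset`. -/
theorem pos_xb_lt_pos_yb {i l κ : ℕ} (hi : 1 ≤ i) (hn : i ≤ n) (hl : 1 ≤ l) (hlκ : l < κ)
    (hκ : κ ≤ slen n i) :
    pos n (xb n i κ).1 (xb n i κ).2 < pos n (yb n i l).1 (yb n i l).2 := by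
  have h1 : ((xb n i κ).1, (xb n i κ).2) ∈ SY n := xb_mem hi (by omega) hκ
  have h2 : ((yb n i l).1, (yb n i l).2) ∈ SY n := yb_mem hi hl (by omega)
  have h3 := (pr_lt_pr hi hn (by omega : 1 ≤ κ) hκ hl (by omega)).2 hlκ
  have h4 : pr n i l = pos n (yb n i l).1 (yb n i l).2 + 1 := by
    rw [mem_SY] at h2
    simp only [yb] at h2
    simp only [pr, pos, yb]
    omega
  have h5 : pos n (xb n i κ).1 (xb n i κ).2 ≠ pos n (yb n i l).1 (yb n i l).2 := fun h => by
    have e1 := congrArg (p n) h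
    have e2 := congrArg (q n) h
    rw [p_pos h1, p_pos h2] at e1
    rw [q_pos h1, q_pos h2] at e2
    exact xb_ne_yb hi hn (Prod.ext e1 e2)
  rw [h4, pr] at h3
  omega

/-- A skew pipe dream in which the left neighbour of each box belongs to it as well is a prefix
form. -/
theorem exists_eq_PF {D : Finset (ℕ × ℕ)} (hD : D ⊆ SY n)
    (h : ∀ i ρ, 1 ≤ i → i ≤ n → 1 ≤ ρ → ρ ≤ slen n i → yb n i ρ ∈ D → xb n i ρ ∈ D) :
    ∃ t : ℕ → ℕ, (∀ b, t b ≤ 2 * b + 1) ∧ PF n t = D := by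
  have hstep : ∀ a c, (a, c) ∈ SY n → (a, c + 1) ∈ D → (a, c) ∈ D := by
    intro a c h1 h2
    obtain ⟨i, ρ, hi, hn, hρ1, hρ2, hρ⟩ := exists_xb h1
    rw [← hρ]
    exact h i ρ hi hn hρ1 hρ2 (by rw [yb, hρ]; exact h2)
  refine ⟨fun b => sInf {m | m = 2 * b + 1 ∨ (n - b, n + b - m) ∈ D},
    fun b => Nat.sInf_le (Or.inl rfl), ?_⟩
  ext ⟨a, c⟩
  rw [mem_PF]
  constructor
  · rintro ⟨h1, h2⟩
    have hs := mem_SY.1 h1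
    have key : ∀ m, sInf {m | m = 2 * (n - a) + 1 ∨ (n - (n - a), n + (n - a) - m) ∈ D} ≤ m →
        m ≤ 2 * (n - a) → (a, 2 * n - a - m) ∈ D := by
      intro m hm
      induction m, hm using Nat.le_induction with
      | base =>
        intro hle
        have := Nat.sInf_mem (s := {m | m = 2 * (n - a) + 1 ∨ (n - (n - a), n + (n - a) - m) ∈ D})
          ⟨_, Or.inl rfl⟩
        rcases this with h | h
        · omega
        · have e1 : n - (n - a) = a := by omega
          have e2 : n + (n - a) = 2 * n - a := by omega
          rw [← e2]
          simp only [e1] at h ⊢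
          exact h
      | succ m hm ih =>
        intro hle
        refine hstep _ _ (mem_SY.2 (by omega)) ?_
        have e : 2 * n - a - (m + 1) + 1 = 2 * n - a - m := by omega
        rw [e]
        exact ih (by omega)
    have := key _ h2 (by omega)
    have e : 2 * n - a - (2 * n - a - c) = c := by omega
    rwa [e] at this
  · intro h1
    have hs := mem_SY.1 (hD h1)
    refine ⟨hD h1, Nat.sInf_le (Or.inr ?_)⟩
    have e1 : n - (n - a) = a := by omega
    have e2 : n + (n - a) - (2 * n - a - c) = c := by omega
    rwa [e1, e2]

/-- The next row of a strip which is not full. -/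
theorem exists_next_not_full {i l : ℕ} {D : Finset (ℕ × ℕ)} (hD : D ⊆ SY n) (hn : i ≤ n)
    (hl : l < slen n i) : ∃ κ, l < κ ∧ κ ≤ slen n i ∧ ¬ Full n i D κ ∧
      ∀ ρ, l < ρ → ρ < κ → Full n i D ρ := by
  classical
  -- The last row is never full, because its right box lies outside `SY n`.
  have hex : ∃ κ, l < κ ∧ ¬ Full n i D κ := ⟨slen n i, hl, fun h => yb_notMem hn (hD h.2)⟩
  refine ⟨Nat.find hex, (Nat.find_spec hex).1, ?_, (Nat.find_spec hex).2, fun ρ h1 h2 => ?_⟩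
  · exact Nat.find_min' hex ⟨hl, fun h => yb_notMem hn (hD h.2)⟩
  · by_contra h3
    exact Nat.find_min hex h2 ⟨h1, h3⟩

/-- As long as `D` is not a prefix form, some strip row contains its right box but not its left one.
Together with the next row that is not full it allows either the deletion of a double crossing or an
inverse ladder move. Both keep the permutation and lower the sum of positions; only the deletion
changes the cardinality. So equality of cardinalities means that no deletion occurred. -/
theorem exists_PF_of_subset {D : Finset (ℕ × ℕ)} (hD : D ⊆ SY n) :
    ∃ t : ℕ → ℕ, (∀ b, t b ≤ 2 * b + 1) ∧ (PF n t).card ≤ D.card ∧ Lab n D (nf t n) ∧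
      ((PF n t).card = D.card → D ∈ LL n (PF n t)) := by
  classical
  obtain ⟨μ, hμ⟩ : ∃ μ, μ = ∑ b ∈ D, pos n b.1 b.2 := ⟨_, rfl⟩
  induction μ using Nat.strong_induction_on generalizing D with
  | _ μ ih =>
  by_cases h : ∀ i ρ, 1 ≤ i → i ≤ n → 1 ≤ ρ → ρ ≤ slen n i → yb n i ρ ∈ D → xb n i ρ ∈ D
  · obtain ⟨t, ht, rfl⟩ := exists_eq_PF hD h
    exact ⟨t, ht, le_rfl, lab_PF fun b _ => ht b, fun _ => Relation.ReflTransGen.refl⟩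
  push Not at h
  obtain ⟨i, ρ₀, hi, hn, h1, h2, h3, h4⟩ := h
  -- The lowest such row is taken, so that the next row `κ` that is not full cannot contain its
  -- right box.
  obtain ⟨ρ, hρ, hmax⟩ := ((Finset.Icc 1 (slen n i)).filter
    fun ρ => yb n i ρ ∈ D ∧ xb n i ρ ∉ D).exists_max_image id
      ⟨ρ₀, by rw [Finset.mem_filter, Finset.mem_Icc]; exact ⟨⟨h1, h2⟩, h3, h4⟩⟩
  rw [Finset.mem_filter, Finset.mem_Icc] at hρ
  obtain ⟨⟨hρ1, hρ2⟩, hyρ, hxρ⟩ := hρ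
  have hlt : ρ < slen n i := by
    refine hρ2.lt_of_ne ?_
    rintro rfl
    exact yb_notMem hn (hD hyρ)
  obtain ⟨κ, hκ1, hκ2, hκ3, hκ4⟩ := exists_next_not_full hD hn hlt
  have hyκ : yb n i κ ∉ D := by
    intro hy
    have := hmax κ (by
      rw [Finset.mem_filter, Finset.mem_Icc]
      exact ⟨⟨by omega, hκ2⟩, hy, fun hx => hκ3 ⟨hx, hy⟩⟩)
    simp only [id] at this
    omega
  have hpos := pos_xb_lt_pos_yb hi hn hρ1 hκ1 hκ2
  by_cases hxκ : xb n i κ ∈ D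
  · have htog := toggle_of_erase hi hn hρ1 hκ1 hκ2 hxκ hyκ hxρ hyρ hκ4
    have hy' : yb n i ρ ∈ D.erase (xb n i κ) :=
      Finset.mem_erase.2 ⟨(xb_ne_yb hi hn).symm, hyρ⟩
    have hc1 := Finset.card_erase_lt_of_mem hxκ
    have hc2 := Finset.card_erase_lt_of_mem hy'
    have hs1 := Finset.sum_erase_add D (fun b => pos n b.1 b.2) hxκ
    have hs2 := Finset.sum_erase_add _ (fun b => pos n b.1 b.2) hy'
    obtain ⟨t, ht, hc, hL, -⟩ := ih
      (∑ b ∈ (D.erase (xb n i κ)).erase (yb n i ρ), pos n b.1 b.2) (by omega)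
      (((Finset.erase_subset _ _).trans (Finset.erase_subset _ _)).trans hD) rfl
    exact ⟨t, ht, by omega, hL.toggle htog hρ1, fun h => by omega⟩
  · have hm := stripMove_of_insert hi hn hρ1 hκ1 hκ2 hxκ hyκ hxρ hyρ hκ4
    obtain ⟨D', hD'⟩ : ∃ D', D' = insert (xb n i κ) (D.erase (yb n i ρ)) := ⟨_, rfl⟩
    have hs1 := Finset.sum_erase_add D (fun b => pos n b.1 b.2) hyρ
    have hs2 : ∑ b ∈ D', pos n b.1 b.2 = pos n (xb n i κ).1 (xb n i κ).2 +
        ∑ b ∈ D.erase (yb n i ρ), pos n b.1 b.2 := by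
      rw [hD', Finset.sum_insert fun h => hxκ (Finset.mem_of_mem_erase h)]
    rw [← hD'] at hm
    have hsub : D' ⊆ SY n := by
      rw [hD']
      exact Finset.insert_subset (xb_mem hi (by omega) hκ2) ((Finset.erase_subset _ _).trans hD)
    obtain ⟨t, ht, hc, hL, hLL⟩ := ih _ (by omega) hsub rfl
    refine ⟨t, ht, hm.card_eq ▸ hc, hL.toggle hm.toggle hρ1, fun h => ?_⟩
    exact (hLL (h.trans hm.card_eq)).tail ⟨_, _, trivial, hm.ladderMove hsub⟩

/-! ### Lengths -/

/-- The prefix form to which `D` reduces has the same permutation, hence by uniqueness of normal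
forms it is `PF n t`. -/
theorem card_PF_le {t : ℕ → ℕ} {D : Finset (ℕ × ℕ)} (ht : ∀ b < n, t b ≤ 2 * b + 1)
    (hD : D ⊆ SY n) (hL : Lab n D (nf t n)) : (PF n t).card ≤ D.card := by
  obtain ⟨t', ht', hc, hL', -⟩ := exists_PF_of_subset hD
  have h := Lab.unique hD (nf_mem ht) (nf_mem fun b _ => ht' b) hL hL'
  rwa [PF_congr (nf_inj ht (fun b _ => ht' b) h)]

theorem mem_LL_PF {t : ℕ → ℕ} {D : Finset (ℕ × ℕ)} (ht : ∀ b < n, t b ≤ 2 * b + 1)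
    (hD : D ⊆ SY n) (hL : Lab n D (nf t n)) (hc : (PF n t).card = D.card) : D ∈ LL n (PF n t) := by
  obtain ⟨t', ht', -, hL', h'⟩ := exists_PF_of_subset hD
  have h := Lab.unique hD (nf_mem ht) (nf_mem fun b _ => ht' b) hL hL'
  have e := PF_congr (nf_inj ht (fun b _ => ht' b) h)
  rw [e] at hc ⊢
  exact h' hc

theorem toggle_top_insert {i κ : ℕ} {D : Finset (ℕ × ℕ)} (hi : 1 ≤ i) (hn : i ≤ n) (h1 : 1 ≤ κ)
    (hκ : κ ≤ slen n i) (hx : xb n i κ ∉ D) (hy : yb n i κ ∉ D)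
    (hf : ∀ ρ, 0 < ρ → ρ < κ → Full n i D ρ) : Toggle n i 0 κ D (insert (xb n i κ) D) :=
  ⟨hi, hn, h1, hκ, hy, hf, fun h => by omega, by simp [hx], fun h => by omega,
    fun b hb _ => by simp [hb]⟩

theorem toggle_top_erase {i κ : ℕ} {D : Finset (ℕ × ℕ)} (hi : 1 ≤ i) (hn : i ≤ n) (h1 : 1 ≤ κ)
    (hκ : κ ≤ slen n i) (hx : xb n i κ ∈ D) (hy : yb n i κ ∉ D)
    (hf : ∀ ρ, 0 < ρ → ρ < κ → Full n i D ρ) : Toggle n i 0 κ D (D.erase (xb n i κ)) :=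
  ⟨hi, hn, h1, hκ, hy, hf, fun h => by omega, by simp [hx], fun h => by omega,
    fun b hb _ => by simp [hb]⟩

theorem slen_pos {i : ℕ} (hn : i ≤ n) : 0 < slen n i := by
  rw [slen]; split_ifs <;> omega

theorem mul_s_mul_s {i : ℕ} (hi : 1 ≤ i) (w : Equiv.Perm ℤ) : w * s i * s i = w := by
  rw [mul_assoc, s_mul_self hi, mul_one]

/-- In a prefix form the first strip row that is not full lacks its right box, so toggling its left
box multiplies by `s j`. The result differs by one box from `PF n t'`, and minimality of `PF n t`
applies. -/
theorem card_PF_le_succ {t t' : ℕ → ℕ} {j : ℕ} (ht : ∀ b < n, t b ≤ 2 * b + 1)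
    (ht' : ∀ b < n, t' b ≤ 2 * b + 1) (hj : 1 ≤ j) (hn : j ≤ n) (h : nf t' n = nf t n * s j) :
    (PF n t).card ≤ (PF n t').card + 1 := by
  obtain ⟨κ, h1, h2, h3, h4⟩ := exists_next_not_full (PF_subset n t') hn (slen_pos hn)
  have hxS := xb_mem (n := n) hj h1 h2
  have hy : yb n j κ ∉ PF n t' := by
    intro hy
    refine h3 ⟨?_, hy⟩
    rw [yb] at hy
    obtain ⟨⟨a, c⟩, hac⟩ : ∃ b, xb n j κ = b := ⟨_, rfl⟩
    rw [hac] at hy hxS ⊢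
    rw [mem_PF] at hy ⊢
    refine ⟨hxS, ?_⟩
    have := hy.2
    simp only at this
    omega
  have hL := lab_PF ht'
  have hw' := nf_mem ht'
  by_cases hx : xb n j κ ∈ PF n t'
  · have := hL.toggle_top hw' (toggle_top_erase hj hn h1 h2 hx hy h4)
    rw [h, mul_s_mul_s hj] at this
    have h5 := card_PF_le ht ((Finset.erase_subset _ _).trans (PF_subset n t')) this
    have h6 := Finset.card_erase_le (s := PF n t') (a := xb n j κ)
    omega
  · have := hL.toggle_top hw' (toggle_top_insert hj hn h1 h2 hx hy h4)
    rw [h, mul_s_mul_s hj] at this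
    have h5 := card_PF_le ht (Finset.insert_subset hxS (PF_subset n t')) this
    rwa [Finset.card_insert_of_notMem hx] at h5

theorem mem_W_of_isWord {w : Equiv.Perm ℤ} {l : List ℕ} (h : IsWord n w l) : w ∈ W n := by
  obtain ⟨h1, rfl⟩ := h
  refine Subgroup.list_prod_mem _ fun x hx => ?_
  obtain ⟨i, hi, rfl⟩ := List.mem_map.1 hx
  exact s_mem_W (h1 i hi).1 (h1 i hi).2

theorem mem_prefixPos {t : ℕ → ℕ} {b x : ℕ} :
    x ∈ prefixPos t b ↔ ∃ β < b, ∃ m < t β, x = β ^ 2 + m + 1 := by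
  induction b with
  | zero => simp [prefixPos]
  | succ b ih =>
    rw [prefixPos, List.mem_append, ih, List.mem_range'_1]
    constructor
    · rintro (⟨β, h1, h2⟩ | h)
      · exact ⟨β, by omega, h2⟩
      · exact ⟨b, by omega, x - b ^ 2 - 1, by omega, by omega⟩
    · rintro ⟨β, h1, m, h2, rfl⟩
      rcases Nat.lt_succ_iff_lt_or_eq.1 h1 with h3 | rfl
      · exact Or.inl ⟨β, h3, m, h2, rfl⟩
      · right; omega

theorem prefixPos_pairwise {t : ℕ → ℕ} (ht : ∀ b < n, t b ≤ 2 * b + 1) :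
    (prefixPos t n).Pairwise (· < ·) := by
  rw [← complPositions_PF ht, complPositions]
  exact (List.pairwise_lt_range' ..).filter _

theorem prefixPos_le {t : ℕ → ℕ} (ht : ∀ b < n, t b ≤ 2 * b + 1) {x : ℕ}
    (hx : x ∈ prefixPos t n) : 1 ≤ x ∧ x ≤ n ^ 2 := by
  rw [← complPositions_PF ht, complPositions, List.mem_filter, List.mem_range'_1] at hx
  omega

theorem isWord_prefixPos {t : ℕ → ℕ} (ht : ∀ b < n, t b ≤ 2 * b + 1) :
    IsWord n (nf t n) ((prefixPos t n).map iC) := by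
  refine ⟨fun i hi => ?_, rfl⟩
  obtain ⟨x, hx, rfl⟩ := List.mem_map.1 hi
  obtain ⟨β, h1, m, h2, rfl⟩ := mem_prefixPos.1 hx
  have := ht β h1
  have := iC_le (b := β) (m := m) (by omega)
  omega

theorem card_PF_add_length {t : ℕ → ℕ} (ht : ∀ b < n, t b ≤ 2 * b + 1) :
    (PF n t).card + (prefixPos t n).length = n ^ 2 := by
  rw [← complPositions_PF ht, complPositions_length (PF_subset n t)]

theorem PF_zero : PF n (fun _ => 0) = SY n := by
  ext ⟨a, c⟩
  rw [mem_PF]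
  simp

theorem nf_zero : nf (fun _ => 0) n = 1 := nf_eq_of_zero (Nat.zero_le n) fun _ _ => rfl

/-- Each letter of a word lowers the minimal cardinality by at most one. So no word is shorter than
the prefix word, and prefix words are reduced. -/
theorem le_card_PF_add_length {t : ℕ → ℕ} (ht : ∀ b < n, t b ≤ 2 * b + 1) {l : List ℕ}
    (h : IsWord n (nf t n) l) : n ^ 2 ≤ (PF n t).card + l.length := by
  induction l using List.reverseRecOn generalizing t with
  | nil =>
    have h1 : nf (fun _ => 0) n = nf t n := nf_zero.trans h.2
    have h2 := nf_inj (fun _ _ => Nat.zero_le _) ht h1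
    rw [← PF_congr h2, PF_zero, card_SY]
    omega
  | append_singleton l j ih =>
    have hl : IsWord n (l.map s).prod l :=
      ⟨fun i hi => h.1 i (List.mem_append_left _ hi), rfl⟩
    obtain ⟨t', ht', hnf⟩ := exists_nf _ (mem_W_of_isWord hl)
    rw [← hnf] at hl
    have hj := h.1 j (by simp)
    have h2 := h.2
    rw [List.map_append, List.prod_append, ← hnf] at h2
    have h3 := ih (fun b _ => ht' b) hl
    have h4 := card_PF_le_succ (fun b _ => ht' b) ht hj.1 hj.2 (by simpa using h2.symm)
    rw [List.length_append, List.length_singleton]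
    omega

theorem len_le {w : Equiv.Perm ℤ} {l : List ℕ} (h : IsWord n w l) : len n w ≤ l.length :=
  Nat.sInf_le ⟨l, h, rfl⟩

theorem exists_isWord_length_eq {w : Equiv.Perm ℤ} {l : List ℕ} (h : IsWord n w l) :
    ∃ l', IsWord n w l' ∧ l'.length = len n w :=
  Nat.sInf_mem (s := {r | ∃ l, IsWord n w l ∧ l.length = r}) ⟨_, l, h, rfl⟩

theorem isReducedWord_iff {w : Equiv.Perm ℤ} {l : List ℕ} :
    IsReducedWord n w l ↔ IsWord n w l ∧ l.length = len n w := by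
  refine and_congr_right fun h => ⟨fun h' => ?_, fun h' l' hl' => h' ▸ len_le hl'⟩
  obtain ⟨l', hl', hlen⟩ := exists_isWord_length_eq h
  have := h' l' hl'
  have := len_le h
  omega

theorem card_PF_add_len {t : ℕ → ℕ} (ht : ∀ b < n, t b ≤ 2 * b + 1) :
    (PF n t).card + len n (nf t n) = n ^ 2 := by
  have h1 := isWord_prefixPos ht
  obtain ⟨l, h2, h3⟩ := exists_isWord_length_eq h1
  have h4 := le_card_PF_add_length ht h2
  have h5 := card_PF_add_length ht
  have h6 := len_le h1
  rw [List.length_map] at h6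
  omega

theorem isReducedWord_prefixPos {t : ℕ → ℕ} (ht : ∀ b < n, t b ≤ 2 * b + 1) :
    IsReducedWord n (nf t n) ((prefixPos t n).map iC) := by
  rw [isReducedWord_iff, List.length_map]
  have := card_PF_add_len ht
  have := card_PF_add_length ht
  exact ⟨isWord_prefixPos ht, by omega⟩

theorem len_w₀ (n : ℕ) : len n (w₀ n) = n ^ 2 := by
  have ht : ∀ b < n, (fun b => 2 * b + 1) b ≤ 2 * b + 1 := fun _ _ => le_rfl
  have h1 : PF n (fun b => 2 * b + 1) = ∅ := by
    ext ⟨a, c⟩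
    rw [mem_PF, mem_SY]
    simp only [Finset.notMem_empty, iff_false]
    omega
  have h2 := lab_PF ht
  have h3 := card_PF_add_len ht
  rw [h1] at h2 h3
  rw [Lab.unique (Finset.empty_subset _) (nf_mem ht) (w₀_mem n) h2 (lab_empty n)] at h3
  simpa using h3

theorem mem_RSP {w : Equiv.Perm ℤ} (hw : w ∈ W n) {D : Finset (ℕ × ℕ)} :
    D ∈ RSP n w ↔ D ⊆ SY n ∧ Lab n D w ∧ D.card + len n w = n ^ 2 := by
  rw [RSP, Set.mem_ofPred_eq, len_w₀]
  refine and_congr_right fun hD => and_congr_left fun _ => ⟨fun h => ?_, fun h => h.isPermOf hD hw⟩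
  -- Every `D` has some labelling, and its permutation must be the one read off the pipes.
  obtain ⟨t, ht, -, hL, -⟩ := exists_PF_of_subset hD
  rwa [← hL.eq_of_isPermOf hD (nf_mem fun b _ => ht b) h]

theorem le_card_add_len {w : Equiv.Perm ℤ} (hw : w ∈ W n) {D : Finset (ℕ × ℕ)} (hD : D ⊆ SY n)
    (hL : Lab n D w) : n ^ 2 ≤ D.card + len n w := by
  obtain ⟨t, ht, rfl⟩ := exists_nf w hw
  have := card_PF_le (fun b _ => ht b) hD hL
  have := card_PF_add_len (n := n) fun b _ => ht b
  omega

theorem LL_PF {t : ℕ → ℕ} (ht : ∀ b < n, t b ≤ 2 * b + 1) : LL n (PF n t) = RSP n (nf t n) := by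
  ext D
  have hc := card_PF_add_len ht
  rw [mem_RSP (nf_mem ht)]
  constructor
  · intro h
    obtain ⟨h1, h2, h3⟩ := preserves_of_mem_ladderOrbit (PF_subset n t) h
    exact ⟨h1, h3 _ (lab_PF ht), by omega⟩
  · rintro ⟨h1, h2, h3⟩
    exact mem_LL_PF ht h1 h2 (by omega)

/-! ### The lexicographically smallest reduced subword -/

theorem eq_prefixPos {t : ℕ → ℕ} (ht : ∀ b < n, t b ≤ 2 * b + 1) {l : List ℕ}
    (hl : l.Pairwise (· < ·))
    (h : ∀ x, x ∈ l ↔ ∃ β < n, ∃ m < t β, x = β ^ 2 + m + 1) : l = prefixPos t n :=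
  hl.eq_of_mem_iff (prefixPos_pairwise ht) fun x => by rw [h, mem_prefixPos]

theorem exists_first_difference {α : Type*} {l l' : List α} (h : l.length = l'.length)
    (hne : l ≠ l') : ∃ u r v r' v', l = u ++ r :: v ∧ l' = u ++ r' :: v' ∧ r ≠ r' := by
  induction l generalizing l' with
  | nil =>
    rw [List.length_nil] at h
    exact absurd (List.length_eq_zero_iff.1 h.symm).symm hne
  | cons a l ih =>
    cases l' with
    | nil => simp at h
    | cons a' l' =>
      by_cases ha : a = a'
      · subst ha
        obtain ⟨u, r, v, r', v', h1, h2, h3⟩ := ih (by simpa using h) fun e => hne (by rw [e])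
        exact ⟨a :: u, r, v, r', v', by rw [h1]; rfl, by rw [h2]; rfl, h3⟩
      · exact ⟨[], a, l, a', l', rfl, rfl, ha⟩

theorem lex_append {u v v' : List ℕ} {r r' : ℕ} (h : r < r') :
    List.Lex (· < ·) (u ++ r :: v) (u ++ r' :: v') := by
  induction u with
  | nil => exact List.Lex.rel h
  | cons a u ih => exact List.Lex.cons ih

/-- If a competitor chose `r' < r` first, then `r` would start a block `b`, and the letter `j` of
`r'` would be at most `b`. Cancelling the common beginning, `s j` times the remaining prefix word
would have the short word `v'`. But putting the first position of block `j - 1` in front of that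
word gives a prefix word again, which is reduced and two letters longer than `v'`. -/
theorem not_lt_of_first_difference {t : ℕ → ℕ} (ht : ∀ b < n, t b ≤ 2 * b + 1) {u v v' : List ℕ}
    {r r' : ℕ} (h1 : prefixPos t n = u ++ r :: v) (h2 : u ++ r' :: v' ∈ reducedSubwords n (nf t n)) :
    ¬ r' < r := by
  intro hlt
  have hp := prefixPos_pairwise ht
  rw [h1] at hp
  obtain ⟨hs, hbd, hred⟩ := h2
  obtain ⟨hu, hrv, hurv⟩ := List.pairwise_append.1 hp
  obtain ⟨-, hrv', hurv'⟩ := List.pairwise_append.1 hs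
  obtain ⟨b, hb, m, hm, hr⟩ := mem_prefixPos.1 (by rw [h1]; simp : r ∈ prefixPos t n)
  have htb := ht b hb
  -- Otherwise `r - 1` would also be a position of the prefix word, hence in `u`, leaving no room
  -- for `r'` below `r`.
  have hm0 : m = 0 := by
    by_contra hm0
    have h3 : r - 1 ∈ prefixPos t n := mem_prefixPos.2 ⟨b, hb, m - 1, by omega, by omega⟩
    rw [h1, List.mem_append, List.mem_cons] at h3
    rcases h3 with h3 | h3 | h3
    · have := hurv' _ h3 r' (by simp)
      omega
    · omega
    · have := (List.pairwise_cons.1 hrv).1 _ h3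
      omega
  subst hm0
  have hr'1 := hbd r' (by simp)
  obtain ⟨j, hj⟩ : ∃ j, j = iC r' := ⟨_, rfl⟩
  have hjb : 1 ≤ j ∧ j ≤ b := by
    have hsq : r' ≤ b ^ 2 := by omega
    obtain ⟨β, hβ, m', hm', rfl⟩ := exists_block hr'1.1 hsq
    have := iC_le hm'
    omega
  have hblock : ∀ β < b, ∀ m ≤ 2 * β, β ^ 2 + m + 1 ≤ b ^ 2 := fun β hβ m hm => by
    nlinarith
  have hblock' : ∀ β, b ≤ β → b ^ 2 ≤ β ^ 2 := fun β hβ => Nat.pow_le_pow_left hβ 2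
  have hmem : ∀ x, x ∈ r :: v ↔ x ∈ prefixPos t n ∧ r ≤ x := by
    intro x
    rw [h1, List.mem_append]
    constructor
    · intro h
      refine ⟨Or.inr h, ?_⟩
      rcases List.mem_cons.1 h with rfl | h
      · exact le_rfl
      · exact ((List.pairwise_cons.1 hrv).1 x h).le
    · rintro ⟨h | h, hle⟩
      · have := hurv x h r (by simp)
        omega
      · exact h
  -- The first letter of block `j - 1` is `j`; the blocks below `b` are otherwise emptied, and those
  -- from `b` on keep their prefixes.
  obtain ⟨τ, hτ⟩ : ∃ τ : ℕ → ℕ, τ = fun β => if β = j - 1 then 1 else if β < b then 0 else t β :=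
    ⟨_, rfl⟩
  have hτ1 : τ (j - 1) = 1 := by rw [hτ]; simp
  have hτ2 : ∀ β, β ≠ j - 1 → β < b → τ β = 0 := fun β h h' => by rw [hτ]; simp [h, h']
  have hτ3 : ∀ β, b ≤ β → τ β = t β := fun β h => by
    rw [hτ]; simp only; rw [if_neg (by omega), if_neg (by omega)]
  have hτb : ∀ β < n, τ β ≤ 2 * β + 1 := by
    intro β hβ
    by_cases h3 : b ≤ β
    · rw [hτ3 β h3]; exact ht β hβ
    · by_cases h4 : β = j - 1
      · rw [h4, hτ1]; omega
      · rw [hτ2 β h4 (by omega)]; omega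
  have hl : ((j - 1) ^ 2 + 1) :: r :: v = prefixPos τ n := by
    refine eq_prefixPos hτb (List.pairwise_cons.2 ⟨fun x hx => ?_, hrv⟩) fun x => ?_
    · have := ((hmem x).1 hx).2
      have := hblock (j - 1) (by omega) 0 (by omega)
      omega
    · rw [List.mem_cons, hmem, mem_prefixPos]
      constructor
      · rintro (rfl | ⟨⟨β, h3, m, h4, rfl⟩, h5⟩)
        · exact ⟨j - 1, by omega, 0, by omega, by omega⟩
        · have hle : b ≤ β := by
            by_contra hle
            have := ht β h3
            have := hblock β (by omega) m (by omega)
            omega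
          exact ⟨β, h3, m, by rw [hτ3 β hle]; exact h4, rfl⟩
      · rintro ⟨β, h3, m, h4, rfl⟩
        by_cases hle : b ≤ β
        · rw [hτ3 β hle] at h4
          have := hblock' β hle
          exact Or.inr ⟨⟨β, h3, m, h4, rfl⟩, by omega⟩
        · by_cases hβj : β = j - 1
          · rw [hβj, hτ1] at h4
            left
            rw [hβj]; omega
          · rw [hτ2 β hβj (by omega)] at h4
            omega
  have hprod : nf τ n = ((v'.map iC).map s).prod := by
    have e2 : (((u ++ r' :: v').map iC).map s).prod = (((u ++ r :: v).map iC).map s).prod := by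
      rw [← h1]; exact hred.1.2
    simp only [List.map_append, List.prod_append, List.map_cons, List.prod_cons] at e2
    have e3 := mul_left_cancel e2
    have e4 : iC ((j - 1) ^ 2 + 1) = j := by
      have := iC_eq (b := j - 1) (m := 0) (by omega)
      rw [add_zero] at this
      omega
    rw [nf, ← hl]
    simp only [List.map_cons, List.prod_cons]
    rw [← e3, e4, hj, ← mul_assoc, s_mul_self (hj ▸ hjb.1), one_mul]
  have hword : IsWord n (nf τ n) (v'.map iC) := by
    refine ⟨fun i hi => hred.1.1 i ?_, hprod.symm⟩
    simp only [List.map_append, List.map_cons, List.mem_append, List.mem_cons]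
    exact Or.inr (Or.inr hi)
  have h5 := len_le hword
  have h6 := card_PF_add_len hτb
  have h7 := card_PF_add_length hτb
  rw [← hl] at h7
  have h8 := (isReducedWord_iff.1 hred).2
  have h9 := (isReducedWord_iff.1 (isReducedWord_prefixPos ht)).2
  rw [h1, ← h8] at h9
  simp only [List.length_map, List.length_append, List.length_cons] at h5 h7 h9
  omega

theorem minSubword_nf {t : ℕ → ℕ} (ht : ∀ b < n, t b ≤ 2 * b + 1) :
    minSubword n (nf t n) = prefixPos t n := by
  have h1 : prefixPos t n ∈ reducedSubwords n (nf t n) :=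
    ⟨prefixPos_pairwise ht, fun r hr => prefixPos_le ht hr, isReducedWord_prefixPos ht⟩
  have h2 : ∀ k ∈ reducedSubwords n (nf t n), k = prefixPos t n ∨
      List.Lex (· < ·) (prefixPos t n) k := by
    intro k hk
    by_cases hne : prefixPos t n = k
    · exact Or.inl hne.symm
    have hlen : (prefixPos t n).length = k.length := by
      have e1 := (isReducedWord_iff.1 h1.2.2).2
      have e2 := (isReducedWord_iff.1 hk.2.2).2
      rw [List.length_map] at e1 e2
      omega
    obtain ⟨u, r, v, r', v', h3, h4, h5⟩ := exists_first_difference hlen hne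
    right
    have h6 := not_lt_of_first_difference ht h3 (h4 ▸ hk)
    rw [h3, h4]
    exact lex_append (by omega)
  -- The choice made by `Classical.epsilon` is pinned down by asymmetry: two smallest elements would
  -- precede each other.
  obtain ⟨h3, h4⟩ : minSubword n (nf t n) ∈ reducedSubwords n (nf t n) ∧
      ∀ k' ∈ reducedSubwords n (nf t n), k' = minSubword n (nf t n) ∨
        List.Lex (· < ·) (minSubword n (nf t n)) k' :=
    Classical.epsilon_spec (p := fun k => k ∈ reducedSubwords n (nf t n) ∧
      ∀ k' ∈ reducedSubwords n (nf t n), k' = k ∨ List.Lex (· < ·) k k') ⟨_, h1, h2⟩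
  rcases h2 _ h3 with h5 | h5
  · exact h5
  · rcases h4 _ h1 with h6 | h6
    · exact h6.symm
    · exact absurd h6 (_root_.asymm h5)

theorem Dmin_nf {t : ℕ → ℕ} (ht : ∀ b < n, t b ≤ 2 * b + 1) : Dmin n (nf t n) = PF n t := by
  rw [Dmin, minSubword_nf ht, ← complPositions_PF ht, complPositions_toFinset,
    Finset.sdiff_sdiff_eq_self (PF_subset n t)]

theorem LL_Dmin {w : Equiv.Perm ℤ} (hw : w ∈ W n) : LL n (Dmin n w) = RSP n w := by
  obtain ⟨t, ht, rfl⟩ := exists_nf w hw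
  rw [Dmin_nf fun b _ => ht b, LL_PF fun b _ => ht b]

theorem exists_MM_eq {w : Equiv.Perm ℤ} (hw : w ∈ W n) :
    ∃ l, IsReducedWord n w l ∧ MM n w = MWord n l := by
  obtain ⟨t, ht, rfl⟩ := exists_nf w hw
  refine ⟨_, isReducedWord_prefixPos fun b _ => ht b, ?_⟩
  rw [MM, Dmin_nf fun b _ => ht b, complPositions_PF fun b _ => ht b]

/-! ### Mitosis -/

/-- Toggles transport labellings forwards. Backwards, `D` has some permutation anyway, and
uniqueness at `D'` identifies it. -/
theorem Lab.of_toggle {i l κ : ℕ} {D D' : Finset (ℕ × ℕ)} {w : Equiv.Perm ℤ} (hw : w ∈ W n)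
    (hD : D ⊆ SY n) (hD' : D' ⊆ SY n) (t : Toggle n i l κ D D') (hl : 1 ≤ l) (hL : Lab n D' w) :
    Lab n D w := by
  obtain ⟨τ, hτ, -, hL', -⟩ := exists_PF_of_subset hD
  rwa [Lab.unique hD' hw (nf_mem fun b _ => hτ b) hL (hL'.toggle t hl)]

theorem ladderOrbit_mono {C C' : ℕ → ℕ → Prop} (h : ∀ a c, C a c → C' a c)
    (D : Finset (ℕ × ℕ)) : ladderOrbit n C D ⊆ ladderOrbit n C' D := by
  intro E hE
  induction hE with
  | refl => exact Relation.ReflTransGen.refl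
  | tail _ hm ih =>
    obtain ⟨a, c, hC, hm⟩ := hm
    exact ih.tail ⟨a, c, h a c hC, hm⟩

theorem ladderOrbit_subset_RSP {C : ℕ → ℕ → Prop} {D : Finset (ℕ × ℕ)} {w : Equiv.Perm ℤ}
    (hw : w ∈ W n) (hD : D ∈ RSP n w) : ladderOrbit n C D ⊆ RSP n w := by
  intro E hE
  rw [mem_RSP hw] at hD ⊢
  obtain ⟨h1, h2, h3⟩ := preserves_of_mem_ladderOrbit hD.1 hE
  exact ⟨h1, h3 w hD.2.1, h2 ▸ hD.2.2⟩

theorem exists_isWord {w : Equiv.Perm ℤ} (hw : w ∈ W n) : ∃ l, IsWord n w l := by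
  obtain ⟨t, ht, rfl⟩ := exists_nf w hw
  exact ⟨_, isWord_prefixPos fun b _ => ht b⟩

theorem len_mul_s_le {w : Equiv.Perm ℤ} (hw : w ∈ W n) {j : ℕ} (hj : 1 ≤ j) (hn : j ≤ n) :
    len n (w * s j) ≤ len n w + 1 := by
  obtain ⟨l₀, h₀⟩ := exists_isWord hw
  obtain ⟨l, h1, h2⟩ := exists_isWord_length_eq h₀
  have : IsWord n (w * s j) (l ++ [j]) := by
    refine ⟨fun i hi => ?_, by simp [h1.2]⟩
    rcases List.mem_append.1 hi with h | h
    · exact h1.1 i h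
    · rw [List.mem_singleton.1 h]; exact ⟨hj, hn⟩
  have := len_le this
  rw [List.length_append, List.length_singleton] at this
  omega

theorem mitosis_subset_M (n j : ℕ) (A : Set (Finset (ℕ × ℕ))) : mitosis n j A ⊆ M n j A := by
  refine Set.iUnion₂_mono fun D _ => ?_
  rintro E ⟨r, h1, h2⟩
  exact ⟨r, h1, ladderOrbit_mono (fun _ _ h => h.1) _ h2⟩

/-- Removing the box at `r_0` is a toggle that reaches the top, and the ascent makes the length grow
by exactly one, matching the lost box. The ladder moves that follow preserve reducedness. -/
theorem M_RSP_subset {w : Equiv.Perm ℤ} (hw : w ∈ W n) {j : ℕ} (hj : 1 ≤ j) (hn : j ≤ n)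
    (hlen : len n w < len n (w * s j)) : M n j (RSP n w) ⊆ RSP n (w * s j) := by
  have hws := mul_mem hw (s_mem_W hj hn)
  intro E hE
  obtain ⟨D, hD, r, hr, hE⟩ := Set.mem_iUnion₂.1 hE
  obtain ⟨ρ, h1, h2, rfl, hx, hy, hf⟩ := (mitosisAt_iff hj hn).1 hr
  rw [p_pr hj h1 h2, q_pr hj h1 h2, Finset.sdiff_singleton_eq_erase] at hE
  refine ladderOrbit_subset_RSP hws ?_ hE
  rw [mem_RSP hw] at hD
  rw [mem_RSP hws]
  have hL := hD.2.1.toggle_top hw (toggle_top_erase hj hn h1 h2 hx hy hf)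
  have hc := Finset.card_erase_add_one hx
  have := len_mul_s_le hw hj hn
  refine ⟨(Finset.erase_subset _ _).trans hD.1, hL, ?_⟩
  change (D.erase (xb n j ρ)).card + _ = _
  omega

/-- If `E` is reduced and row `t` of a strip does not contain `xb n i t`, then inverse ladder moves
in the rows from `t` on make row `t` empty. -/
theorem exists_row_empty {i : ℕ} (hi : 1 ≤ i) (hn : i ≤ n) {w : Equiv.Perm ℤ} (hw : w ∈ W n)
    {E : Finset (ℕ × ℕ)} (hE : E ∈ RSP n w) {t : ℕ} (ht : 1 ≤ t) (hts : t ≤ slen n i)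
    (hx : xb n i t ∉ E) :
    ∃ D ∈ RSP n w, ∃ K, t ≤ K ∧ K ≤ slen n i ∧ xb n i t ∉ D ∧ yb n i t ∉ D ∧
      (∀ ρ < t, (xb n i ρ ∈ D ↔ xb n i ρ ∈ E) ∧ (yb n i ρ ∈ D ↔ yb n i ρ ∈ E)) ∧
      (∀ ρ, t < ρ → ρ ≤ K → xb n i ρ ∈ D) ∧
      E ∈ ladderOrbit n (fun a c => ∃ ρ, t < ρ ∧ ρ ≤ K ∧ xb n i ρ = (a, c)) D := by
  obtain ⟨d, hd⟩ : ∃ d, d = slen n i - t := ⟨_, rfl⟩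
  induction d using Nat.strong_induction_on generalizing t with
  | _ d ih =>
  by_cases hy : yb n i t ∈ E
  swap
  · exact ⟨E, hE, t, le_rfl, hts, hx, hy, fun _ _ => ⟨Iff.rfl, Iff.rfl⟩,
      fun ρ h1 h2 => by omega, Relation.ReflTransGen.refl⟩
  have hE' := (mem_RSP hw).1 hE
  have hlt : t < slen n i := by
    refine hts.lt_of_ne ?_
    rintro rfl
    exact yb_notMem hn (hE'.1 hy)
  obtain ⟨κ, hκ1, hκ2, hκ3, hκ4⟩ := exists_next_not_full hE'.1 hn hlt
  -- Otherwise rows `t` and `κ` would form a double crossing, and deleting it would leave fewer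
  -- boxes than the length permits.
  have hxκ : xb n i κ ∉ E := by
    intro hxκ
    have hyκ : yb n i κ ∉ E := fun h => hκ3 ⟨hxκ, h⟩
    have hsub : (E.erase (xb n i κ)).erase (yb n i t) ⊆ SY n :=
      ((Finset.erase_subset _ _).trans (Finset.erase_subset _ _)).trans hE'.1
    have hL := Lab.of_toggle hw hsub hE'.1
      (toggle_of_erase hi hn ht hκ1 hκ2 hxκ hyκ hx hy hκ4) ht hE'.2.1
    have h1 := le_card_add_len hw hsub hL
    have h2 := Finset.card_erase_add_one hxκ
    have h3 := Finset.card_erase_le (s := E.erase (xb n i κ)) (a := yb n i t)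
    have h4 := hE'.2.2
    omega
  -- Row `κ` is emptied first, without touching the rows above it. Then the box `yb n i t` can be
  -- moved down into row `κ`.
  obtain ⟨D, hD, K, hK1, hK2, hDx, hDy, hDE, hDK, horb⟩ :=
    ih (slen n i - κ) (by omega) (by omega) hκ2 hxκ rfl
  have hD' := (mem_RSP hw).1 hD
  have hm := stripMove_of_insert hi hn ht hκ1 hκ2 hDx hDy (fun h => hx ((hDE t hκ1).1.1 h))
    ((hDE t hκ1).2.2 hy) fun ρ h1 h2 => ⟨(hDE ρ h2).1.2 (hκ4 ρ h1 h2).1,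
      (hDE ρ h2).2.2 (hκ4 ρ h1 h2).2⟩
  obtain ⟨D₀, hD₀⟩ : ∃ D₀, D₀ = insert (xb n i κ) (D.erase (yb n i t)) := ⟨_, rfl⟩
  rw [← hD₀] at hm
  have hsub : D₀ ⊆ SY n := by
    rw [hD₀]
    exact Finset.insert_subset (xb_mem hi (by omega) hκ2) ((Finset.erase_subset _ _).trans hD'.1)
  have hxmem : ∀ ρ, ρ ≠ κ → (xb n i ρ ∈ D₀ ↔ xb n i ρ ∈ D) := fun ρ h =>
    (hm.toggle.x_mem h).symm
  refine ⟨D₀, ?_, K, by omega, hK2, hm.x_top, hm.y_top, fun ρ h => ⟨?_, ?_⟩, fun ρ h1 h2 => ?_, ?_⟩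
  · rw [mem_RSP hw]
    exact ⟨hsub, Lab.of_toggle hw hsub hD'.1 hm.toggle ht hD'.2.1, hm.card_eq ▸ hD'.2.2⟩
  · rw [hxmem ρ (by omega)]
    exact (hDE ρ (by omega)).1
  · rw [← hm.toggle.y_mem (by omega)]
    exact (hDE ρ (by omega)).2
  · by_cases hρ : ρ = κ
    · rw [hρ]; exact hm.x_bot
    · rw [hxmem ρ hρ]
      by_cases hlt : ρ < κ
      · exact (hDE ρ hlt).1.2 (hκ4 ρ h1 hlt).1
      · exact hDK ρ (by omega) h2
  · refine Relation.ReflTransGen.head ⟨_, _, ⟨κ, hκ1, hK1, rfl⟩, hm.ladderMove hsub⟩ ?_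
    refine ladderOrbit_mono ?_ _ horb
    rintro a c ⟨ρ, h1, h2, h3⟩
    exact ⟨ρ, by omega, h2, h3⟩

/-- A box of the two columns missing from `D` lies in a strip row beyond `K ≥ ρ`. Strip rows
alternate between the left and the right column, so a gap in the right column still allows `ρ` to be
in the same row of `SY n`; hence the shift `a + 1` in `start`. -/
theorem lt_start {i ρ K : ℕ} {D : Finset (ℕ × ℕ)} (hi : 1 ≤ i) (hn : i ≤ n) (hρ : ρ ≤ K)
    (hK : K ≤ slen n i) (h : ∀ σ, 1 ≤ σ → σ ≤ K → xb n i σ ∈ D) :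
    (xb n i ρ).1 < start n i D := by
  have hne : ({a | (a, n + 1 - i) ∈ SY n \ D} ∪ {b | ∃ a, b = a + 1 ∧ (a, n + i - 1) ∈ SY n \ D} ∪
    {n + 2 - i} : Set ℕ).Nonempty := ⟨_, Or.inr rfl⟩
  have key : ∀ a c, InCols n i c → (a, c) ∈ SY n \ D → ∃ σ, K < σ ∧ xb n i σ = (a, c) := by
    intro a c h1 h2
    rw [Finset.mem_sdiff] at h2
    obtain ⟨σ, h3, h4, h5⟩ := exists_xb_of_inCols hi hn h2.1 h1
    refine ⟨σ, ?_, h5⟩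
    by_contra h6
    exact h2.2 (h5 ▸ h σ h3 (by omega))
  have hmem := Nat.sInf_mem hne
  rw [start]
  generalize (sInf _ : ℕ) = v at hmem ⊢
  rcases hmem with (h1 | ⟨a, rfl, h2⟩) | h1
  · obtain ⟨σ, hσ, h3⟩ := key _ _ (Or.inl rfl) h1
    rw [xb] at h3 ⊢
    split_ifs at h3 ⊢ <;> simp only [Prod.mk.injEq] at h3 ⊢ <;> omega
  · obtain ⟨σ, hσ, h3⟩ := key _ _ (Or.inr rfl) h2
    rw [xb] at h3 ⊢
    split_ifs at h3 ⊢ <;> simp only [Prod.mk.injEq] at h3 ⊢ <;> omega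
  · rw [Set.mem_singleton_iff] at h1
    rw [slen] at hK
    rw [xb]
    split_ifs at hK ⊢ <;> simp only <;> omega

/-- Mitosis is undone: the first strip row of `E` that is not full is emptied by inverse ladder
moves, and adding its left box gives an element of `RSP n w`. Since the left boxes of all strip rows
down to `K` are then present, the moves leading back to `E` satisfy the bound by `start`. -/
theorem RSP_subset_mitosis {w : Equiv.Perm ℤ} (hw : w ∈ W n) {j : ℕ} (hj : 1 ≤ j) (hn : j ≤ n)
    (hlen : len n w < len n (w * s j)) : RSP n (w * s j) ⊆ mitosis n j (RSP n w) := by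
  have hws := mul_mem hw (s_mem_W hj hn)
  have hle := len_mul_s_le hw hj hn
  intro E hE
  have hE' := (mem_RSP hws).1 hE
  obtain ⟨t, h1, h2, h3, h4⟩ := exists_next_not_full hE'.1 hn (slen_pos hn)
  have hx : xb n j t ∉ E := by
    -- Removing this box would give a skew pipe dream for `w` with fewer boxes than possible.
    intro hx
    have hL := hE'.2.1.toggle_top hws
      (toggle_top_erase hj hn h1 h2 hx (fun hy => h3 ⟨hx, hy⟩) h4)
    rw [mul_s_mul_s hj] at hL
    have h5 := le_card_add_len hw ((Finset.erase_subset _ _).trans hE'.1) hL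
    have h6 := Finset.card_erase_add_one hx
    have h7 := hE'.2.2
    omega
  obtain ⟨D₀, hD₀, K, hK1, hK2, hDx, hDy, hDE, hDK, horb⟩ :=
    exists_row_empty hj hn hws hE h1 h2 hx
  have hD₀' := (mem_RSP hws).1 hD₀
  have hfull : ∀ ρ, 0 < ρ → ρ < t → Full n j D₀ ρ := fun ρ h5 h6 =>
    ⟨(hDE ρ h6).1.2 (h4 ρ h5 h6).1, (hDE ρ h6).2.2 (h4 ρ h5 h6).2⟩
  have hL := hD₀'.2.1.toggle_top hws (toggle_top_insert hj hn h1 h2 hDx hDy hfull)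
  rw [mul_s_mul_s hj] at hL
  obtain ⟨D, hD⟩ : ∃ D, D = insert (xb n j t) D₀ := ⟨_, rfl⟩
  rw [← hD] at hL
  have hsub : D₀ ⊆ D := by rw [hD]; exact Finset.subset_insert _ _
  have hxD : xb n j t ∈ D := by rw [hD]; exact Finset.mem_insert_self _ _
  have hDR : D ∈ RSP n w := by
    rw [mem_RSP hw]
    refine ⟨?_, hL, ?_⟩
    · rw [hD]; exact Finset.insert_subset (xb_mem hj h1 h2) hD₀'.1
    · rw [hD, Finset.card_insert_of_notMem hDx]
      have := hD₀'.2.2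
      omega
  refine Set.mem_iUnion₂.2 ⟨D, hDR, pr n j t, (mitosisAt_iff hj hn).2 ⟨t, h1, h2, rfl, hxD, ?_,
    fun σ h5 h6 => ⟨hsub (hfull σ h5 h6).1, hsub (hfull σ h5 h6).2⟩⟩, ?_⟩
  · rw [hD, Finset.mem_insert]
    rintro (h | h)
    · exact xb_ne_yb hj hn h.symm
    · exact hDy h
  · rw [p_pr hj h1 h2, q_pr hj h1 h2, Finset.sdiff_singleton_eq_erase]
    have e : D.erase ((xb n j t).1, (xb n j t).2) = D₀ := by
      change D.erase (xb n j t) = D₀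
      rw [hD, Finset.erase_insert hDx]
    rw [e]
    refine ladderOrbit_mono ?_ _ horb
    rintro a c ⟨ρ, h5, h6, h7⟩
    have h8 := inCols_xb (n := n) (i := j) (ρ := ρ)
    have h9 := lt_start (D := D) hj hn h6 hK2 fun σ h10 h11 => by
      rcases lt_trichotomy σ t with h | rfl | h
      · exact hsub (hfull σ h10 h).1
      · exact hxD
      · exact hsub (hDK σ h h11)
    rw [h7] at h8 h9
    exact ⟨h8, h9⟩

theorem M_RSP {w : Equiv.Perm ℤ} (hw : w ∈ W n) {j : ℕ} (hj : 1 ≤ j) (hn : j ≤ n)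
    (hlen : len n w < len n (w * s j)) : M n j (RSP n w) = RSP n (w * s j) :=
  (M_RSP_subset hw hj hn hlen).antisymm
    ((RSP_subset_mitosis hw hj hn hlen).trans (mitosis_subset_M n j _))

theorem mitosis_RSP {w : Equiv.Perm ℤ} (hw : w ∈ W n) {j : ℕ} (hj : 1 ≤ j) (hn : j ≤ n)
    (hlen : len n w < len n (w * s j)) : mitosis n j (RSP n w) = RSP n (w * s j) :=
  ((mitosis_subset_M n j _).trans (M_RSP_subset hw hj hn hlen)).antisymm
    (RSP_subset_mitosis hw hj hn hlen)

theorem RSP_one : RSP n 1 = {SY n} := by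
  have h0 : len n 1 = 0 := Nat.le_zero.1 (len_le (l := []) ⟨by simp, rfl⟩)
  ext D
  rw [mem_RSP (one_mem _), h0, Set.mem_singleton_iff, ← card_SY]
  constructor
  · rintro ⟨h1, -, h2⟩
    exact Finset.eq_of_subset_of_card_le h1 h2.ge
  · rintro rfl
    exact ⟨Finset.Subset.refl _, lab_SY n, rfl⟩

/-- A beginning of a reduced word is reduced, so the last letter is an ascent and the one-letter
results apply. -/
theorem MWord_eq_RSP {w : Equiv.Perm ℤ} {l : List ℕ} (h : IsReducedWord n w l) :
    MWord n l = RSP n w ∧ mitosisWord n l = RSP n w := by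
  induction l using List.reverseRecOn generalizing w with
  | nil =>
    have : w = 1 := h.1.2.symm
    rw [this, RSP_one]
    exact ⟨rfl, rfl⟩
  | append_singleton l j ih =>
    rw [isReducedWord_iff, List.length_append, List.length_singleton] at h
    obtain ⟨⟨h1, rfl⟩, h2⟩ := h
    have hl : IsWord n (l.map s).prod l :=
      ⟨fun i hi => h1 i (List.mem_append_left _ hi), rfl⟩
    have hw := mem_W_of_isWord hl
    have hj := h1 j (by simp)
    have e : ((l ++ [j]).map s).prod = (l.map s).prod * s j := by simp
    rw [e] at h2 ⊢
    have h3 := len_le hl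
    have h4 := len_mul_s_le hw hj.1 hj.2
    obtain ⟨h5, h6⟩ := ih (isReducedWord_iff.2 ⟨hl, by omega⟩)
    rw [MWord, mitosisWord, List.foldl_append, List.foldl_append, ← MWord, ← mitosisWord, h5, h6]
    exact ⟨M_RSP hw hj.1 hj.2 (by omega), mitosis_RSP hw hj.1 hj.2 (by omega)⟩

end SkewPipeDream

theorem theoremt (n : ℕ) (hn : 2 ≤ n) :
    (∀ w ∈ W n, ∀ j : ℕ, 1 ≤ j → j ≤ n → len n w < len n (w * s j) →
      LL n (Dmin n (w * s j)) = M n j (LL n (Dmin n w)) ∧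
      M n j (LL n (Dmin n w)) = mitosis n j (LL n (Dmin n w))) ∧
    (∀ w ∈ W n, ∀ l : List ℕ, IsReducedWord n w l →
      LL n (Dmin n w) = MM n w ∧ MM n w = MWord n l ∧ MWord n l = mitosisWord n l) ∧
    (∀ w ∈ W n,
      (∀ D ∈ MM n w, ∀ (i j : ℕ) (D' : Finset (ℕ × ℕ)), LadderMove n i j D D' → D' ∈ MM n w) ∧
      MM n w = RSP n w) := by
  have hMM : ∀ w ∈ W n, MM n w = RSP n w := by
    intro w hw
    obtain ⟨l, hl, h⟩ := exists_MM_eq hw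
    rw [h, (MWord_eq_RSP hl).1]
  refine ⟨fun w hw j hj hjn hlen => ?_, fun w hw l hl => ?_, fun w hw => ⟨?_, hMM w hw⟩⟩
  · rw [LL_Dmin hw, LL_Dmin (mul_mem hw (s_mem_W hj hjn)), M_RSP hw hj hjn hlen,
      mitosis_RSP hw hj hjn hlen]
    exact ⟨rfl, rfl⟩
  · rw [LL_Dmin hw, hMM w hw, (MWord_eq_RSP hl).1, (MWord_eq_RSP hl).2]
    exact ⟨rfl, rfl, rfl⟩
  · intro D hD i j D' hm
    rw [hMM w hw] at hD ⊢
    exact ladderOrbit_subset_RSP (C := fun _ _ => True) hw hD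
      (Relation.ReflTransGen.single ⟨i, j, trivial, hm⟩)
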